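/- There are a deterministic random access machine program $P$ and an absolute constant $C>0$ such that the following holds for all integers $h,k\ge 0$ and $n\ge 1$. Let $G=(B\uplus W,E)$ be a simple undirected graph on the $n$ vertices $0,\dots,n-1$, each of which is coloured either black (the set $B$) or white (the set $W$), and suppose that $G$ is $K_h$-minor-free, i.e. the complete graph $K_h$ cannot be obtained from a subgraph of $G$ by edge contractions. (As $n\ge1$, this forces $h\ge 2$.) On input $n$, $k$, the colours of the vertices, and adjacency lists of $G$ (with neighbours listed in an arbitrary order), the program $P$ halts after at most $$C\,(C\log h)^{hk/2}\,n$$ steps, i.e. in time $(O(\log h))^{hk/2}\,n$, and outputs a set $U\subseteq B\uplus W$ with $|U|\le k$ such that every vertex $v\in B\setminus U$ has a neighbour in $U$, if such a set exists, and outputs NONE if no such set exists. Here a random access machine has finitely many registers and a memory array of natural numbers; it can set a register to a constant, add, subtract (truncated at $0$), load from or store to the memory address held in a register, and branch according to a comparison of two registers, each at unit cost. In addition, all numbers stored during the computation are at most $(n+k+2)^C$, i.e. they fit into words of $O(\log(n+k+2))$ bits. -/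

import Mathlib

/-! ### Graph notions -/

namespace SimpleGraph

/-- `G.HasMinor H`: the graph `H` is a minor of `G`. There are pairwise disjoint (nonempty) connected
branch sets in `G`, one for each vertex of `H`, such that any two branch sets that belong to adjacent
vertices of `H` are joined by an edge of `G`. Contracting the branch sets, in a suitable subgraph
of `G`, yields `H`. -/
def HasMinor {V W : Type*} (G : SimpleGraph V) (H : SimpleGraph W) : Prop :=
  ∃ branch : W → Set V,
    (∀ i, (G.induce (branch i)).Connected) ∧
    (∀ i j, i ≠ j → Disjoint (branch i) (branch j)) ∧
    (∀ i j, H.Adj i j → ∃ u ∈ branch i, ∃ v ∈ branch j, G.Adj u v)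

/-- `G` is `K_h`-minor-free. -/
def CompleteMinorFree {V : Type*} (G : SimpleGraph V) (h : ℕ) : Prop :=
  ¬ G.HasMinor (completeGraph (Fin h))

/-- In the black and white graph with underlying graph `G` and set of black vertices `B`
(all other vertices are white), the set `U` (of vertices of any colour) dominates the black
vertices: every black vertex is in `U` or has a neighbour in `U`. -/
def DominatesBlack {V : Type*} (G : SimpleGraph V) (B U : Finset V) : Prop :=
  ∀ v ∈ B, v ∉ U → ∃ u ∈ U, G.Adj v u

end SimpleGraph

/-! ### A random access machine -/

namespace RAM

/-- Instructions. A program may mention only finitely many registers; the memory is an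
unbounded array that is accessed indirectly. Lower-case letters `d a b s` are
register names and `l` is a position in the program. -/
inductive Instr : Type
  /-- `reg d := c` -/
  | const (d c : ℕ)
  /-- `reg d := reg a + reg b` -/
  | add (d a b : ℕ)
  /-- `reg d := max (reg a - reg b) 0` -/
  | sub (d a b : ℕ)
  /-- `reg d := mem[reg a]` -/
  | load (d a : ℕ)
  /-- `mem[reg a] := reg s` -/
  | store (a s : ℕ)
  /-- if `reg a = reg b` then go to `l` -/
  | jumpEq (a b l : ℕ)
  /-- if `reg a < reg b` then go to `l` -/
  | jumpLt (a b l : ℕ)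

/-- A program is a finite list of instructions. -/
abbrev Program : Type := List Instr

/-- Configurations: program counter, registers, memory. -/
structure Config : Type where
  pc : ℕ
  reg : ℕ → ℕ
  mem : ℕ → ℕ

/-- The effect of one instruction. -/
def Instr.exec : Instr → Config → Config
  | .const d c, σ => { σ with pc := σ.pc + 1, reg := Function.update σ.reg d c }
  | .add d a b, σ =>
      { σ with pc := σ.pc + 1, reg := Function.update σ.reg d (σ.reg a + σ.reg b) }
  | .sub d a b, σ =>
      { σ with pc := σ.pc + 1, reg := Function.update σ.reg d (σ.reg a - σ.reg b) }
  | .load d a, σ =>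
      { σ with pc := σ.pc + 1, reg := Function.update σ.reg d (σ.mem (σ.reg a)) }
  | .store a s, σ =>
      { σ with pc := σ.pc + 1, mem := Function.update σ.mem (σ.reg a) (σ.reg s) }
  | .jumpEq a b l, σ => { σ with pc := if σ.reg a = σ.reg b then l else σ.pc + 1 }
  | .jumpLt a b l, σ => { σ with pc := if σ.reg a < σ.reg b then l else σ.pc + 1 }

/-- The machine has halted when the program counter has left the program. -/
def Halted (P : Program) (σ : Config) : Prop := P.length ≤ σ.pc

/-- One step of the computation, at unit cost; a halted configuration does not change any more. -/
def step (P : Program) (σ : Config) : Config :=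
  match P[σ.pc]? with
  | none => σ
  | some i => i.exec σ

/-- The initial configuration: the input is written into the memory from address `0` on, and
everything else is `0`. -/
def init (input : List ℕ) : Config where
  pc := 0
  reg := fun _ => 0
  mem := fun i => input.getD i 0

/-- The configuration after `t` steps on a given input. -/
def configAt (P : Program) (input : List ℕ) (t : ℕ) : Config := (step P)^[t] (init input)

/-- All numbers stored in the configuration fit into one machine word holding values up to `M`. -/
def Config.FitsIn (σ : Config) (M : ℕ) : Prop := (∀ i, σ.reg i ≤ M) ∧ (∀ i, σ.mem i ≤ M)

/-- The output: register `0` tells whether the answer is `NONE` (value `0`) or a list of numbers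
(any other value); in the latter case register `1` holds the address at which the list starts in
memory, and register `2` its length. -/
def Config.output (σ : Config) : Option (List ℕ) :=
  if σ.reg 0 = 0 then none
  else some ((List.range (σ.reg 2)).map fun i => σ.mem (σ.reg 1 + i))

end RAM

/-! ### The dominating set problem on black and white graphs -/

namespace BlackWhite

/-- `adj` is an adjacency-list representation of `G`: for each vertex, its neighbours in some
order, without repetition. -/
def IsAdjacencyList {n : ℕ} (G : SimpleGraph (Fin n)) (adj : Fin n → List (Fin n)) : Prop :=
  ∀ v, (adj v).Nodup ∧ ∀ u, u ∈ adj v ↔ G.Adj v u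

/-- The input of the algorithm: the numbers `n` and `k`, then the colours of the vertices
`0, …, n - 1` (`1` for black, `0` for white), then for each vertex its degree followed by
the list of its neighbours. -/
def encode {n : ℕ} (B : Finset (Fin n)) (adj : Fin n → List (Fin n)) (k : ℕ) : List ℕ :=
  [n, k] ++ (List.finRange n).map (fun v => if v ∈ B then 1 else 0) ++
    (List.finRange n).flatMap (fun v => (adj v).length :: (adj v).map Fin.val)

/-- `out` is a correct answer: either a list, without repetition, of the elements of a set of at
most `k` vertices that dominates the black vertices, or `NONE`, and then there is no such set. -/
def CorrectAnswer {n : ℕ} (G : SimpleGraph (Fin n)) (B : Finset (Fin n)) (k : ℕ) :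
    Option (List ℕ) → Prop
  | some l => ∃ U : Finset (Fin n), G.DominatesBlack B U ∧ U.card ≤ k ∧
      l.Nodup ∧ ∀ a, a ∈ l ↔ ∃ u ∈ U, u.val = a
  | none => ¬ ∃ U : Finset (Fin n), G.DominatesBlack B U ∧ U.card ≤ k

end BlackWhite

set_option autoImplicit false

/-! ### Minors: transitivity and contraction -/

section

open Finset

namespace SimpleGraph

variable {V W X : Type*}

/-! The algorithm is a bounded search tree. Let `S` be the set of black vertices still to be
dominated. A solution must dominate any given `b ∈ S`, and two vertices that dominate the same part
of `S` are interchangeable, so it suffices to try one vertex of each class of candidates for `b`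
(`sol_succ`). If some `b` always has at most `D` classes, there are at most `D ^ k` paths of length
`k`, and one level of a path takes time linear in the size of the graph.

The point is that `D = branchConst h` works, and that it is of order `(√log h) ^ h` up to a factor
`c ^ h`. Four facts carry this. (1) `card_adj_le`: a `K_h`-minor-free graph has linearly many edges.
A quadratic dependence on `h` suffices, and it follows from a minimal counterexample under
contraction and deletion. (2) `hasMinor_completeGraph_of_dense`: if each vertex of a set of at least
`4 h √log h` vertices, roughly, misses at most a 24th of the set, there is a `K_h` minor. Random
tuples of about `√log h` vertices become the branch sets. (3) `numCliques_le`: by (2), a larger set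
always has a vertex adjacent to less than 23/24 of it. Peeling off such vertices and passing to
their neighbourhoods `O(log h)` times reduces clique counting to sets of about `4 h √log h`
vertices. These have at most `∑ i < h, choose (4 h √log h) i` cliques, which gives the factor `(√log
h) ^ h`. The passage costs only `2 ^ O(h)`. (4) `card_image_domSet_le`: vertices outside `B` leave
only linearly many traces on `B`. Contracting a maximal family of outside vertices onto nonadjacent
pairs of `B` gives a minor on `B` in which all remaining traces are cliques, so (3) applies.
Averaging edges between `B` and representatives of the traces then yields the vertex `b`
(`exists_card_image_domSet_le`).

For the machine, the search is written in a small structured language whose compilation loses a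
constant factor (`Exec.compile`). Classes are found by partition refinement. Paths are visited in
lexicographic order, each one from the root again, and `rest` bounds the number of unseen paths. A
path costs `k` times a polynomial in `h` times `n`. The factor beyond `n` is absorbed by `(2 *
edgeConst h) ^ k`, and squaring `√log h` gives the exponent `h k / 2`. -/

theorem induce_connected_of_reachable {G : SimpleGraph V} {s : Set V} {x : V} (hx : x ∈ s)
    (h : ∀ y (hy : y ∈ s), (G.induce s).Reachable ⟨x, hx⟩ ⟨y, hy⟩) : (G.induce s).Connected := by
  have : Nonempty s := ⟨⟨x, hx⟩⟩
  exact ⟨fun a b => (h a.1 a.2).symm.trans (h b.1 b.2)⟩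

theorem induce_connected_of_star {G : SimpleGraph V} {s : Set V} {x : V} (hx : x ∈ s)
    (h : ∀ y ∈ s, y = x ∨ G.Adj x y ∨ ∃ z ∈ s, G.Adj x z ∧ G.Adj z y) :
    (G.induce s).Connected := by
  refine induce_connected_of_reachable hx fun y hy => ?_
  rcases h y hy with rfl | h | ⟨z, hz, h1, h2⟩
  · exact Reachable.refl _
  · exact Adj.reachable (by simpa using h)
  · have h1' : (G.induce s).Adj ⟨x, hx⟩ ⟨z, hz⟩ := by simpa using h1
    have h2' : (G.induce s).Adj ⟨z, hz⟩ ⟨y, hy⟩ := by simpa using h2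
    exact h1'.reachable.trans h2'.reachable

/-- A walk in `T` lifts, because branch sets are connected and consecutive ones are joined by an
edge. Unions of branch sets can therefore serve as branch sets, which makes the minor relation
transitive. -/
theorem induce_biUnion_connected {G : SimpleGraph V} {H : SimpleGraph W} {b : W → Set V} {T : Set W}
    (hT : (H.induce T).Connected) (hb : ∀ i, (G.induce (b i)).Connected)
    (hadj : ∀ i j, H.Adj i j → ∃ u ∈ b i, ∃ v ∈ b j, G.Adj u v) :
    (G.induce (⋃ w ∈ T, b w)).Connected := by
  obtain ⟨⟨w₀, hw₀⟩⟩ := hT.nonempty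
  obtain ⟨⟨x₀, hx₀⟩⟩ := (hb w₀).nonempty
  have mem : ∀ w ∈ T, ∀ y ∈ b w, y ∈ ⋃ w ∈ T, b w := fun w hw y hy => by
    simp only [Set.mem_iUnion]; exact ⟨w, hw, hy⟩
  have inner : ∀ w (hw : w ∈ T), ∀ y (hy : y ∈ b w), ∀ z (hz : z ∈ b w),
      (G.induce (⋃ w ∈ T, b w)).Reachable ⟨y, mem w hw y hy⟩ ⟨z, mem w hw z hz⟩ := by
    intro w hw y hy z hz
    have := (hb w).preconnected ⟨y, hy⟩ ⟨z, hz⟩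
    let f : G.induce (b w) →g G.induce (⋃ w ∈ T, b w) :=
      { toFun := fun a => ⟨a.1, mem w hw a.1 a.2⟩, map_rel' := fun {a c} h => by simpa using h }
    exact this.map f
  refine induce_connected_of_reachable (mem w₀ hw₀ x₀ hx₀) fun y hy => ?_
  have key : ∀ w : T, (H.induce T).Reachable ⟨w₀, hw₀⟩ w → ∀ y (hy : y ∈ b w),
      (G.induce (⋃ w ∈ T, b w)).Reachable ⟨x₀, mem w₀ hw₀ x₀ hx₀⟩ ⟨y, mem w w.2 y hy⟩ := by
    intro w hw
    rw [reachable_iff_reflTransGen] at hw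
    induction hw with
    | refl => exact fun y hy => inner w₀ hw₀ x₀ hx₀ y hy
    | @tail p q _ hpq ih =>
      intro y hy
      have hpq' : H.Adj p q := by simpa using hpq
      obtain ⟨u, hu, v, hv, huv⟩ := hadj _ _ hpq'
      have hA : (G.induce (⋃ w ∈ T, b w)).Adj ⟨u, mem p p.2 u hu⟩ ⟨v, mem q q.2 v hv⟩ := by
        simpa using huv
      exact ((ih u hu).trans hA.reachable).trans (inner q q.2 v hv y hy)
  have hy' := hy
  simp only [Set.mem_iUnion] at hy'
  obtain ⟨w, hw, hyw⟩ := hy'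
  exact key ⟨w, hw⟩ (hT.preconnected _ _) y hyw

theorem HasMinor.trans {G : SimpleGraph V} {H : SimpleGraph W} {K : SimpleGraph X}
    (h₁ : G.HasMinor H) (h₂ : H.HasMinor K) : G.HasMinor K := by
  obtain ⟨b, hb, hd, ha⟩ := h₁
  obtain ⟨c, hc, hcd, hca⟩ := h₂
  refine ⟨fun k => ⋃ w ∈ c k, b w, fun k => induce_biUnion_connected (hc k) hb ha, ?_, ?_⟩
  · intro i j hij
    simp only [Set.disjoint_iUnion_left, Set.disjoint_iUnion_right]
    intro w hw w' hw'
    apply hd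
    rintro rfl
    exact Set.disjoint_left.1 (hcd i j hij) hw' hw
  · intro i j hij
    obtain ⟨w, hw, w', hw', h⟩ := hca i j hij
    obtain ⟨u, hu, v, hv, h⟩ := ha w w' h
    exact ⟨u, Set.mem_biUnion hw hu, v, Set.mem_biUnion hw' hv, h⟩

theorem induce_singleton_connected (G : SimpleGraph V) (v : V) :
    (G.induce ({v} : Set V)).Connected :=
  induce_connected_of_star (x := v) rfl fun _ hy => Or.inl hy

theorem HasMinor.of_injective {G : SimpleGraph V} {H : SimpleGraph W} (f : W → V)
    (hf : Function.Injective f) (h : ∀ i j, H.Adj i j → G.Adj (f i) (f j)) : G.HasMinor H :=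
  ⟨fun w => {f w}, fun w => induce_singleton_connected G _,
    fun i j hij => by simpa using fun h => hij (hf h),
    fun i j hij => ⟨f i, rfl, f j, rfl, h i j hij⟩⟩

theorem CompleteMinorFree.of_hasMinor {G : SimpleGraph V} {H : SimpleGraph W} {h : ℕ}
    (hG : G.CompleteMinorFree h) (hm : G.HasMinor H) : H.CompleteMinorFree h :=
  fun hH => hG (hm.trans hH)

theorem CompleteMinorFree.mono {G H : SimpleGraph V} {h : ℕ} (hG : G.CompleteMinorFree h)
    (hle : H ≤ G) : H.CompleteMinorFree h :=
  hG.of_hasMinor (.of_injective id Function.injective_id fun _ _ hij => hle hij)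

theorem CompleteMinorFree.induce {G : SimpleGraph V} {h : ℕ} (hG : G.CompleteMinorFree h)
    (s : Set V) : (G.induce s).CompleteMinorFree h :=
  hG.of_hasMinor (.of_injective Subtype.val Subtype.val_injective fun _ _ hij => by simpa using hij)

theorem CompleteMinorFree.two_le [Nonempty V] {G : SimpleGraph V} {h : ℕ}
    (hG : G.CompleteMinorFree h) : 2 ≤ h := by
  by_contra hlt
  have hs : Subsingleton (Fin h) := Fin.subsingleton_iff_le_one.2 (by omega)
  exact hG (.of_injective (fun _ => Classical.arbitrary V) (fun _ _ _ => Subsingleton.elim _ _)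
    fun i j hij => absurd (Subsingleton.elim i j) hij.ne)

/-- Contraction of `v` into `u`. -/
def contract (G : SimpleGraph V) (u v : V) : SimpleGraph {x // x ≠ v} where
  Adj a b := a ≠ b ∧ (G.Adj a b ∨ (a.1 = u ∧ G.Adj v b) ∨ (b.1 = u ∧ G.Adj v a))
  symm := ⟨by
    rintro a b ⟨h, h1⟩
    refine ⟨h.symm, ?_⟩
    rcases h1 with h1 | h1 | h1
    · exact Or.inl h1.symm
    · exact Or.inr (Or.inr h1)
    · exact Or.inr (Or.inl h1)⟩
  loopless := ⟨fun a h => h.1 rfl⟩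

theorem hasMinor_contract (G : SimpleGraph V) {u v : V} (huv : G.Adj u v) :
    G.HasMinor (G.contract u v) := by
  refine ⟨fun x => {y | y = x.1 ∨ (x.1 = u ∧ y = v)}, ?_, ?_, ?_⟩
  · intro x
    refine induce_connected_of_star (x := x.1) (Or.inl rfl) ?_
    rintro y (rfl | ⟨h, rfl⟩)
    · exact Or.inl rfl
    · exact Or.inr (Or.inl (h ▸ huv))
  · intro i j hij
    have hij' : i.1 ≠ j.1 := fun h => hij (Subtype.ext h)
    have := i.2
    have := j.2
    rw [Set.disjoint_left]
    rintro y (rfl | ⟨h, rfl⟩) (h' | ⟨h', h''⟩) <;> grind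
  · rintro i j ⟨hij, h⟩
    rcases h with h | ⟨h, h'⟩ | ⟨h, h'⟩
    · exact ⟨i, Or.inl rfl, j, Or.inl rfl, h⟩
    · exact ⟨v, Or.inr ⟨h, rfl⟩, j, Or.inl rfl, h'⟩
    · exact ⟨i, Or.inl rfl, v, Or.inr ⟨h, rfl⟩, h'.symm⟩

end SimpleGraph

end

/-! ### A linear bound for the number of edges -/

section

open Finset

namespace SimpleGraph

open scoped Classical in
-- Hall's condition is immediate, since each single set is already as large as the whole index set.
theorem exists_injective_of_card_le {ι V : Type*} [Fintype ι] (A : ι → Finset V)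
    (hA : ∀ i, Fintype.card ι ≤ (A i).card) : ∃ f : ι → V, Function.Injective f ∧ ∀ i, f i ∈ A i := by
  refine (Finset.all_card_le_biUnion_card_iff_exists_injective A).1 fun s => ?_
  rcases s.eq_empty_or_nonempty with rfl | ⟨i, hi⟩
  · simp
  · exact (card_le_univ s).trans ((hA i).trans (card_le_card (subset_biUnion_of_mem A hi)))

open scoped Classical in
/-- Vertices with pairwise many common neighbours are the branch vertices of a subdivided
complete graph. -/
theorem hasMinor_completeGraph_of_common_neighbors {V : Type*} [Fintype V] {G : SimpleGraph V}
    {h : ℕ} (x : Fin h → V) (hx : Function.Injective x)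
    (hc : ∀ i j, i ≠ j → h ^ 2 + h ≤ #{z | G.Adj (x i) z ∧ G.Adj (x j) z}) :
    G.HasMinor (completeGraph (Fin h)) := by
  let ι := {p : Fin h × Fin h // p.1 < p.2}
  have hι : Fintype.card ι ≤ h ^ 2 := by
    refine (Fintype.card_subtype_le _).trans ?_
    simp [sq]
  -- Each of the at most `h ^ 2` pairs gets its own connector, a common neighbour outside the branch
  -- vertices. It will join the branch set of the smaller index of the pair.
  obtain ⟨c, hcinj, hcm⟩ := exists_injective_of_card_le
    (fun p : ι => ({z | G.Adj (x p.1.1) z ∧ G.Adj (x p.1.2) z} : Finset V) \ univ.image x) (by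
      intro p
      have h1 := hc p.1.1 p.1.2 p.2.ne
      have h2 := le_card_sdiff (univ.image x) ({z | G.Adj (x p.1.1) z ∧ G.Adj (x p.1.2) z} : Finset V)
      have h3 : (univ.image x).card ≤ h := card_image_le.trans (by simp)
      omega)
  simp only [mem_sdiff, mem_filter, mem_univ, true_and, mem_image, not_exists] at hcm
  refine ⟨fun i => {y | y = x i ∨ ∃ p : ι, p.1.1 = i ∧ y = c p}, ?_, ?_, ?_⟩
  · intro i
    refine induce_connected_of_star (x := x i) (Or.inl rfl) ?_
    rintro y (rfl | ⟨p, rfl, rfl⟩)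
    · exact Or.inl rfl
    · exact Or.inr (Or.inl (hcm p).1.1)
  · intro i j hij
    rw [Set.disjoint_left]
    rintro y (rfl | ⟨p, rfl, rfl⟩) (h' | ⟨q, rfl, h'⟩)
    · exact hij (hx h')
    · exact (hcm q).2 i h'
    · exact (hcm p).2 j h'.symm
    · exact hij (by rw [hcinj h'])
  · have key : ∀ (i j : Fin h) (hij : i < j), G.Adj (x j) (c ⟨(i, j), hij⟩) :=
      fun i j hij => (hcm ⟨(i, j), hij⟩).1.2
    intro i j hij
    rcases lt_or_gt_of_ne (show i ≠ j from hij) with hlt | hlt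
    · exact ⟨_, Or.inr ⟨⟨(i, j), hlt⟩, rfl, rfl⟩, x j, Or.inl rfl, (key i j hlt).symm⟩
    · exact ⟨x i, Or.inl rfl, _, Or.inr ⟨⟨(j, i), hlt⟩, rfl, rfl⟩, key j i hlt⟩

open scoped Classical in
/-- A Ramsey type statement: if among any three elements of `S` two are related, then `S` has
large subsets of pairwise related elements. -/
theorem exists_pairwise_of_triple {V : Type*} (S : Finset V) (R : V → V → Prop)
    (hR : ∀ x ∈ S, ∀ y ∈ S, ∀ z ∈ S, x ≠ y → x ≠ z → y ≠ z → R x y ∨ R x z ∨ R y z)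
    (hsymm : ∀ x y, R x y → R y x) {h : ℕ} (hS : h ^ 2 ≤ S.card) :
    ∃ T ⊆ S, T.card = h ∧ (T : Set V).Pairwise R := by
  -- If `F v` has `h` elements, they are pairwise related by the triple condition with `v`.
  -- Otherwise each choice excludes at most `h` elements, itself included, and a greedy choice of
  -- `h` elements succeeds.
  let F : V → Finset V := fun v => S.filter fun y => y ≠ v ∧ ¬ R v y
  by_cases hbig : ∃ v ∈ S, h ≤ (F v).card
  · obtain ⟨v, hv, hF⟩ := hbig
    obtain ⟨T, hT, hTc⟩ := exists_subset_card_eq hF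
    refine ⟨T, hT.trans (filter_subset _ _), hTc, fun y hy z hz hyz => ?_⟩
    have hy := mem_filter.1 (hT hy)
    have hz := mem_filter.1 (hT hz)
    have := hR v hv y hy.1 z hz.1 hy.2.1.symm hz.2.1.symm hyz
    tauto
  · push Not at hbig
    have : ∀ i ≤ h, ∃ T ⊆ S, T.card = i ∧ (T : Set V).Pairwise R := by
      intro i
      induction i with
      | zero => exact fun _ => ⟨∅, by simp, by simp, by simp⟩
      | succ i ih =>
        intro hi
        obtain ⟨T, hT, hTc, hTp⟩ := ih (by omega)
        have hlt : (T.biUnion fun t => insert t (F t)).card < S.card := by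
          calc _ ≤ T.card * h := card_biUnion_le_card_mul _ _ _ fun t ht =>
                (card_insert_le _ _).trans (hbig t (hT ht))
            _ < h ^ 2 := by rw [hTc, sq]; exact Nat.mul_lt_mul_of_pos_right (by omega) (by omega)
            _ ≤ _ := hS
        obtain ⟨s, hs, hsT⟩ := exists_mem_notMem_of_card_lt_card hlt
        simp only [mem_biUnion, mem_insert, not_exists, not_and, not_or] at hsT
        have hsR : ∀ t ∈ T, R t s := fun t ht => by
          have := hsT t ht
          simp only [F, mem_filter, hs, this.1, true_and, ne_eq, not_false_iff, not_not] at this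
          exact this
        refine ⟨insert s T, insert_subset hs hT, ?_, ?_⟩
        · rw [card_insert_of_notMem (fun h => (hsT s h).1 rfl), hTc]
        · rw [coe_insert]
          exact hTp.insert fun t ht _ => ⟨hsymm _ _ (hsR t ht), hsR t ht⟩
    exact this h le_rfl

open scoped Classical in
-- Ordered pairs are counted. At most the two copies of `uv` disappear, and for each common
-- neighbour `z` the two copies of `vz` merge with those of `uz`. Away from these, the pairs are
-- mapped injectively. Adjacency of `u` and `v` is not needed.
theorem card_adj_le_contract {V : Type*} [Fintype V] (G : SimpleGraph V) {u v : V} (huv : u ≠ v) :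
    #{p : V × V | G.Adj p.1 p.2} ≤ #{p : {x // x ≠ v} × {x // x ≠ v} | (G.contract u v).Adj p.1 p.2}
      + 2 + 2 * #{z | G.Adj u z ∧ G.Adj v z} := by
  set C : Finset V := {z | G.Adj u z ∧ G.Adj v z} with hC
  let r : V → {x // x ≠ v} := fun x => if h : x = v then ⟨u, huv⟩ else ⟨x, h⟩
  set bad : Finset (V × V) := {(u, v), (v, u)} ∪ (C.image (fun z => (v, z)) ∪ C.image (fun z => (z, v)))
    with hbad
  have hbadc : bad.card ≤ 2 + 2 * C.card := by
    refine (card_union_le _ _).trans ?_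
    have h1 : ({(u, v), (v, u)} : Finset (V × V)).card ≤ 2 := card_le_two
    have h2 := card_union_le (C.image (fun z => (v, z))) (C.image (fun z => (z, v)))
    have h3 : (C.image (fun z => (v, z))).card ≤ C.card := card_image_le
    have h4 : (C.image (fun z => (z, v))).card ≤ C.card := card_image_le
    omega
  have hinj : (({p : V × V | G.Adj p.1 p.2} : Finset (V × V)) \ bad).card ≤
      #{p : {x // x ≠ v} × {x // x ≠ v} | (G.contract u v).Adj p.1 p.2} := by
    refine card_le_card_of_injOn (fun p => (r p.1, r p.2)) ?_ ?_
    · rintro ⟨x, y⟩ hp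
      simp only [hbad, hC, coe_sdiff, Set.mem_sdiff, mem_coe, mem_filter, mem_univ, true_and, mem_union,
        mem_insert, mem_singleton, Prod.mk.injEq, mem_image, not_or, not_exists, not_and] at hp
      obtain ⟨hxy, ⟨h1, h2⟩, h3, h4⟩ := hp
      simp only [mem_coe, mem_filter, mem_univ, true_and]
      have := hxy.ne
      by_cases hx : x = v <;> by_cases hy : y = v
      · grind
      · subst hx
        simp only [r, hy, dif_pos, dif_neg, not_false_iff]
        refine ⟨fun h => ?_, Or.inr (Or.inl ⟨rfl, hxy⟩)⟩
        simp only [Subtype.mk.injEq] at h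
        exact h2 rfl h.symm
      · subst hy
        simp only [r, hx, dif_pos, dif_neg, not_false_iff]
        refine ⟨fun h => ?_, Or.inr (Or.inr ⟨rfl, hxy.symm⟩)⟩
        simp only [Subtype.mk.injEq] at h
        exact h1 h rfl
      · simp only [r, hx, hy, dif_neg, not_false_iff]
        exact ⟨fun h => this (congrArg Subtype.val h), Or.inl hxy⟩
    · rintro ⟨x, y⟩ hp ⟨x', y'⟩ hp' heq
      simp only [hbad, hC, coe_sdiff, Set.mem_sdiff, mem_coe, mem_filter, mem_univ, true_and, mem_union,
        mem_insert, mem_singleton, Prod.mk.injEq, mem_image, not_or, not_exists, not_and] at hp hp'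
      have e1 := congrArg (fun p => p.1.1) heq
      have e2 := congrArg (fun p => p.2.1) heq
      obtain ⟨hxy, ⟨h1, h2⟩, h3, h4⟩ := hp
      obtain ⟨hxy', ⟨h1', h2'⟩, h3', h4'⟩ := hp'
      have := hxy.ne
      have := hxy'.ne
      have := hxy.symm
      have := hxy'.symm
      simp only [r] at e1 e2
      by_cases hx : x = v <;> by_cases hy : y = v <;> by_cases hx' : x' = v <;>
        by_cases hy' : y' = v <;> simp only [hx, hy, hx', hy', dif_pos, dif_neg, not_false_iff] at e1 e2 <;>
        grind
  have := le_card_sdiff bad ({p : V × V | G.Adj p.1 p.2} : Finset (V × V))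
  omega

/-- `K_h`-minor-free graphs on `n` vertices have at most `edgeConst h * n` edges. -/
def edgeConst (h : ℕ) : ℕ := 3 * (h ^ 2 + h)

theorem card_adj_eq_sum_degree {V : Type*} [Fintype V] (G : SimpleGraph V) [DecidableRel G.Adj] :
    #{p : V × V | G.Adj p.1 p.2} = ∑ v, G.degree v := by
  classical
  rw [card_filter, Fintype.sum_prod_type]
  exact sum_congr rfl fun v _ => by
    rw [← card_filter, ← card_neighborFinset_eq_degree, neighborFinset_eq_filter]

open scoped Classical in
-- In a counterexample with the fewest vertices and then the fewest edges, every edge lies in at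
-- least `d` triangles, and some vertex has degree at most `2 d + 1`. Its neighbourhood is so
-- crowded that among any three of its vertices two have many common neighbours. The Ramsey type
-- lemma then finds `h` branch vertices of a subdivided `K_h`.
theorem CompleteMinorFree.card_adj_le {h : ℕ} (n : ℕ) : ∀ {V : Type*} [Fintype V]
    (G : SimpleGraph V), Fintype.card V = n → G.CompleteMinorFree h →
    #{p : V × V | G.Adj p.1 p.2} ≤ 2 * edgeConst h * n := by
  induction n with
  | zero =>
    intro V _ G hV hG
    have := Fintype.card_eq_zero_iff.1 hV
    simp [Finset.univ_eq_empty]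
  | succ n ih =>
    intro V _ G hV hG
    set d := edgeConst h with hd
    have hh : 2 ≤ h := by
      have : Nonempty V := Fintype.card_pos_iff.1 (by omega)
      exact hG.two_le
    have hd1 : 18 ≤ d := by rw [hd, edgeConst]; nlinarith
    -- minimal counterexample with respect to the number of edges
    by_contra hlt
    push Not at hlt
    obtain ⟨m, hm⟩ : ∃ m, m = #{p : V × V | G.Adj p.1 p.2} := ⟨_, rfl⟩
    induction m using Nat.strong_induction_on generalizing G with
    | _ m ihm =>
    -- The contracted graph obeys the bound, so the contraction loses more than `2 * d` ordered
    -- pairs.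
    have hcontract : ∀ u v, u ≠ v → (G.contract u v).CompleteMinorFree h →
        d ≤ #{z | G.Adj u z ∧ G.Adj v z} := by
      intro u v huv hmf
      have h1 := card_adj_le_contract G huv
      have h2 := ih (G.contract u v) (by simp [Fintype.card_subtype_compl, hV]) hmf
      rw [show 2 * d * (n + 1) = 2 * d * n + 2 * d by ring] at hlt
      omega
    obtain ⟨⟨a, b⟩, hab⟩ : ∃ p : V × V, p ∈ ({p : V × V | G.Adj p.1 p.2} : Finset (V × V)) := by
      rw [← Finset.Nonempty, ← card_pos]; omega
    replace hab : G.Adj a b := by simpa using hab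
    have hn1 : 1 ≤ n := by
      have := Fintype.one_lt_card_iff.2 ⟨a, b, hab.ne⟩
      omega
    -- Otherwise deleting one edge leaves a smaller counterexample. Hence the average degree is
    -- barely above `2 * d`.
    have hmle : m ≤ 2 * d * (n + 1) + 2 := by
      by_contra hgt
      push Not at hgt
      obtain ⟨G', hG'⟩ : ∃ G', G' = G.deleteEdges {s(a, b)} := ⟨_, rfl⟩
      have hsub : ({p : V × V | G.Adj p.1 p.2} : Finset (V × V)) \ {(a, b), (b, a)} ⊆
          ({p : V × V | G'.Adj p.1 p.2} : Finset (V × V)) := by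
        rintro ⟨x, y⟩ hp
        simp only [mem_sdiff, mem_filter, mem_univ, true_and, mem_insert, mem_singleton,
          Prod.mk.injEq, not_or] at hp ⊢
        simp only [hG', deleteEdges_adj, Set.mem_singleton_iff, Sym2.eq_iff]
        tauto
      have hss : ({p : V × V | G'.Adj p.1 p.2} : Finset (V × V)) ⊂
          ({p : V × V | G.Adj p.1 p.2} : Finset (V × V)) := by
        rw [ssubset_iff_of_subset (fun p hp => by simp [hG', deleteEdges_adj] at hp ⊢; exact hp.1)]
        exact ⟨(a, b), by simpa using hab, by simp [hG', deleteEdges_adj]⟩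
      have h1 := card_lt_card hss
      have h2 := card_le_card hsub
      have h3 := le_card_sdiff {(a, b), (b, a)} ({p : V × V | G.Adj p.1 p.2} : Finset (V × V))
      have h4 : ({(a, b), (b, a)} : Finset (V × V)).card ≤ 2 := card_le_two
      exact ihm _ (hm ▸ h1) G' (hG.mono (hG' ▸ deleteEdges_le _)) (by omega) rfl
    have hcommon : ∀ u v, G.Adj u v → d ≤ #{z | G.Adj u z ∧ G.Adj v z} := fun u v huv =>
      hcontract u v huv.ne (hG.of_hasMinor (hasMinor_contract G huv))
    have hiso : ∀ v, ∃ u, G.Adj v u := by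
      intro v
      by_contra hv
      push Not at hv
      obtain ⟨u, hu⟩ := Fintype.exists_ne_of_one_lt_card (by omega : 1 < Fintype.card V) v
      -- For an isolated `v`, contraction into an arbitrary `u` amounts to deleting `v`, so
      -- minor-freeness needs no edge `uv`.
      have := hcontract u v hu (hG.of_hasMinor (.of_injective Subtype.val Subtype.val_injective
        fun i j hij => by
          rcases hij.2 with h | ⟨_, h⟩ | ⟨_, h⟩
          · exact h
          · exact absurd h (hv _)
          · exact absurd h (hv _)))
      simp [hv] at this
      omega
    obtain ⟨v, hv⟩ : ∃ v, G.degree v ≤ 2 * d + 1 := by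
      by_contra hcon
      push Not at hcon
      have h1 : ∑ v : V, (2 * d + 2) ≤ ∑ v, G.degree v := sum_le_sum fun v _ => hcon v
      rw [← card_adj_eq_sum_degree, sum_const, card_univ, hV, smul_eq_mul, ← hm] at h1
      nlinarith
    obtain ⟨u, huv⟩ := hiso v
    set S := G.neighborFinset v with hS
    have hSc : S.card ≤ 2 * d + 1 := hv
    have hN : ∀ x ∈ S, d ≤ #(S.filter (G.Adj x)) := by
      intro x hx
      have hx' : G.Adj v x := by simpa [hS] using hx
      refine (hcommon v x hx').trans (card_le_card ?_)
      intro z hz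
      simpa [hS] using hz
    set q := h ^ 2 + h with hq
    have hdq : d = 3 * q := hd
    -- Three neighbourhoods of size at least `3 * q` with pairwise fewer than `q` common elements
    -- would cover more than `6 * q + 1 = 2 * d + 1` vertices, more than `S` has. This is the reason
    -- for the factor 3 in `edgeConst`.
    obtain ⟨T, hTS, hTc, hTp⟩ := exists_pairwise_of_triple S
      (fun x y => q ≤ #{z | G.Adj x z ∧ G.Adj y z}) (h := h) (by
        intro x hx y hy z hz hxy hxz hyz
        by_contra hcon
        push Not at hcon
        obtain ⟨h1, h2, h3⟩ := hcon
        have hx := hN x hx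
        have hy := hN y hy
        have hz := hN z hz
        have hXY := card_union_add_card_inter (S.filter (G.Adj x)) (S.filter (G.Adj y))
        have hXYZ := card_union_add_card_inter (S.filter (G.Adj x) ∪ S.filter (G.Adj y))
          (S.filter (G.Adj z))
        have hle : #(S.filter (G.Adj x) ∪ S.filter (G.Adj y) ∪ S.filter (G.Adj z)) ≤ #S :=
          card_le_card (union_subset (union_subset (filter_subset _ _) (filter_subset _ _))
            (filter_subset _ _))
        have h1' : #(S.filter (G.Adj x) ∩ S.filter (G.Adj y)) ≤ #{w | G.Adj x w ∧ G.Adj y w} :=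
          card_le_card fun w hw => by simp at hw ⊢; tauto
        have h2' : #((S.filter (G.Adj x) ∪ S.filter (G.Adj y)) ∩ S.filter (G.Adj z)) ≤
            #{w | G.Adj x w ∧ G.Adj z w} + #{w | G.Adj y w ∧ G.Adj z w} := by
          refine le_trans (card_le_card ?_) (card_union_le _ _)
          intro w hw
          simp at hw ⊢
          tauto
        omega) (fun x y hxy => by simpa only [and_comm] using hxy) (by
        have := hN u (by simpa [hS] using huv)
        have := card_le_card (filter_subset (G.Adj u) S)
        omega)
    refine hG (hasMinor_completeGraph_of_common_neighbors (fun i => (T.equivFin.symm (i.cast hTc.symm)).1)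
      (fun i j hij => by simpa using Subtype.ext hij) fun i j hij => ?_)
    refine hTp (Subtype.prop _) (Subtype.prop _) fun heq => hij ?_
    simpa using Subtype.ext heq

end SimpleGraph

end

/-! ### Complete minors in very dense graphs -/

section

open Finset

namespace SimpleGraph

open scoped Classical in
-- A random tuple from `P` works, in counting form. A fixed `v` is missed by all entries with
-- probability at most `(1/12) ^ s`, since `P` is at least half of `S`. By Markov's inequality the
-- first requirement fails for at most a third of the tuples. A tuple lies inside a given `bads j`
-- with probability at most `2 ^ (-s ^ 2)`, and fewer than `2 ^ (s ^ 2) / 3` such sets are given. In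
-- the application `bads j` is the set of common non-neighbours of an earlier tuple, so leaving it
-- produces an edge to that tuple.
theorem exists_tuple_few_nonneighbors {V : Type*} {G : SimpleGraph V} {S P : Finset V} {s l : ℕ}
    (hs : 1 ≤ s) (hl : 3 * l < 2 ^ (s ^ 2)) (hPS : P ⊆ S) (hP : #S ≤ 2 * #P) (hS : S.Nonempty)
    (hd : ∀ v ∈ S, 24 * #{u ∈ S | ¬ G.Adj v u} ≤ #S) (bads : ℕ → Finset V)
    (hb : ∀ j < l, #(bads j) * 12 ^ s ≤ 3 * #S) :
    ∃ a : Fin s → V, (∀ r, a r ∈ P) ∧ #{v ∈ S | ∀ r, ¬ G.Adj (a r) v} * 12 ^ s ≤ 3 * #S ∧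
      ∀ j < l, ∃ r, a r ∉ bads j := by
  set m := #S with hm
  set p := #P with hp
  have hm0 : 0 < m := card_pos.2 hS
  have hp0 : 0 < p := by omega
  set T : Finset (Fin s → V) := Fintype.piFinset fun _ => P with hT
  have hTc : #T = p ^ s := by simp [hT, hp]
  have hmp : m ^ s ≤ 2 ^ s * p ^ s := by rw [← mul_pow]; exact Nat.pow_le_pow_left hP s
  set B1 : Finset (Fin s → V) := {a ∈ T | 3 * m < #{v ∈ S | ∀ r, ¬ G.Adj (a r) v} * 12 ^ s} with hB1
  have hsum : 24 ^ s * ∑ a ∈ T, #{v ∈ S | ∀ r, ¬ G.Adj (a r) v} ≤ m * m ^ s := by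
    have h1 : ∑ a ∈ T, #{v ∈ S | ∀ r, ¬ G.Adj (a r) v} =
        ∑ v ∈ S, #{a ∈ T | ∀ r, ¬ G.Adj (a r) v} := by
      simp only [card_filter]
      exact sum_comm
    rw [h1, mul_sum]
    refine (sum_le_card_nsmul S _ (m ^ s) fun v hv => ?_).trans (by rw [smul_eq_mul])
    have h2 : #{a ∈ T | ∀ r, ¬ G.Adj (a r) v} ≤ #{u ∈ S | ¬ G.Adj v u} ^ s := by
      have : ({a ∈ T | ∀ r, ¬ G.Adj (a r) v} : Finset _) ⊆
          Fintype.piFinset fun _ : Fin s => ({u ∈ S | ¬ G.Adj v u} : Finset V) := by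
        intro a ha
        simp only [hT, mem_filter, Fintype.mem_piFinset] at ha ⊢
        exact fun r => ⟨hPS (ha.1 r), fun h => ha.2 r h.symm⟩
      refine (card_le_card this).trans (by simp)
    calc _ ≤ 24 ^ s * #{u ∈ S | ¬ G.Adj v u} ^ s := Nat.mul_le_mul_left _ h2
      _ = (24 * #{u ∈ S | ¬ G.Adj v u}) ^ s := (mul_pow _ _ _).symm
      _ ≤ _ := Nat.pow_le_pow_left (hd v hv) s
  have hB1c : 3 * #B1 ≤ p ^ s := by
    have h1 : #B1 * (3 * m) ≤ 12 ^ s * ∑ a ∈ T, #{v ∈ S | ∀ r, ¬ G.Adj (a r) v} := by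
      rw [mul_sum]
      calc #B1 * (3 * m) = ∑ a ∈ B1, 3 * m := by rw [sum_const, smul_eq_mul]
        _ ≤ ∑ a ∈ B1, 12 ^ s * #{v ∈ S | ∀ r, ¬ G.Adj (a r) v} := sum_le_sum fun a ha => by
            have := (mem_filter.1 ha).2
            rw [mul_comm (12 ^ s)]
            exact this.le
        _ ≤ _ := sum_le_sum_of_subset (filter_subset _ _)
    have h2 : 12 ^ s * m * 2 ^ s * (3 * #B1) ≤ 12 ^ s * m * 2 ^ s * p ^ s := by
      have e24 : (24 : ℕ) ^ s = 12 ^ s * 2 ^ s := by rw [← mul_pow]; norm_num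
      calc 12 ^ s * m * 2 ^ s * (3 * #B1) = 24 ^ s * (#B1 * (3 * m)) := by rw [e24]; ring
        _ ≤ 24 ^ s * (12 ^ s * ∑ a ∈ T, #{v ∈ S | ∀ r, ¬ G.Adj (a r) v}) := Nat.mul_le_mul_left _ h1
        _ = 12 ^ s * (24 ^ s * ∑ a ∈ T, #{v ∈ S | ∀ r, ¬ G.Adj (a r) v}) := by ring
        _ ≤ 12 ^ s * (m * m ^ s) := Nat.mul_le_mul_left _ hsum
        _ ≤ 12 ^ s * (m * (2 ^ s * p ^ s)) := by gcongr
        _ = _ := by ring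
    exact Nat.le_of_mul_le_mul_left h2 (by positivity)
  set B2 : Finset (Fin s → V) := (range l).biUnion fun j => Fintype.piFinset fun _ => bads j with hB2
  have hB2c : 3 * #B2 < p ^ s := by
    have h1 : ∀ j < l, 2 ^ (s ^ 2) * #(bads j) ^ s ≤ p ^ s := by
      intro j hj
      -- The probability is at most `(6 / 12 ^ s) ^ s`. Enlarging `6 ^ s` to `6 ^ (s ^ 2)` turns
      -- this into `2 ^ (-s ^ 2)`.
      have h6 : (6 : ℕ) ^ s ≤ 6 ^ (s ^ 2) := Nat.pow_le_pow_right (by norm_num) (by nlinarith)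
      have h2 : 6 ^ s * (2 ^ (s ^ 2) * #(bads j) ^ s) ≤ 6 ^ s * p ^ s := by
        calc 6 ^ s * (2 ^ (s ^ 2) * #(bads j) ^ s)
            ≤ 6 ^ (s ^ 2) * (2 ^ (s ^ 2) * #(bads j) ^ s) := Nat.mul_le_mul_right _ h6
          _ = (#(bads j) * 12 ^ s) ^ s := by
            rw [mul_pow, ← pow_mul, ← mul_assoc, ← mul_pow, sq]; ring
          _ ≤ (3 * m) ^ s := Nat.pow_le_pow_left (hb j hj) s
          _ = 3 ^ s * m ^ s := mul_pow _ _ _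
          _ ≤ 3 ^ s * (2 ^ s * p ^ s) := Nat.mul_le_mul_left _ hmp
          _ = 6 ^ s * p ^ s := by rw [← mul_assoc, ← mul_pow]; norm_num
      exact Nat.le_of_mul_le_mul_left h2 (by positivity)
    have h2 : 2 ^ (s ^ 2) * #B2 ≤ l * p ^ s := by
      calc 2 ^ (s ^ 2) * #B2 ≤ 2 ^ (s ^ 2) * ∑ j ∈ range l, #(bads j) ^ s := by
            refine Nat.mul_le_mul_left _ (card_biUnion_le.trans (le_of_eq ?_))
            simp
        _ = ∑ j ∈ range l, 2 ^ (s ^ 2) * #(bads j) ^ s := mul_sum _ _ _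
        _ ≤ ∑ j ∈ range l, p ^ s := sum_le_sum fun j hj => h1 j (mem_range.1 hj)
        _ = _ := by simp
    have hpos : 0 < p ^ s := by positivity
    have h3 : 2 ^ (s ^ 2) * (3 * #B2) < 2 ^ (s ^ 2) * p ^ s := by
      calc 2 ^ (s ^ 2) * (3 * #B2) = 3 * (2 ^ (s ^ 2) * #B2) := by ring
        _ ≤ 3 * (l * p ^ s) := Nat.mul_le_mul_left _ h2
        _ = 3 * l * p ^ s := by ring
        _ < _ := Nat.mul_lt_mul_of_pos_right hl hpos
    exact Nat.lt_of_mul_lt_mul_left h3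
  have hlt : #(B1 ∪ B2) < #T := by
    have := card_union_le B1 B2
    omega
  obtain ⟨a, haT, ha⟩ := exists_mem_notMem_of_card_lt_card hlt
  simp only [mem_union, not_or, hB1, hB2, mem_filter, haT, true_and, not_lt, mem_biUnion, mem_range,
    Fintype.mem_piFinset, not_exists, not_and, not_forall] at ha
  exact ⟨a, fun r => Fintype.mem_piFinset.1 haT r, ha.1, ha.2⟩

open scoped Classical in
-- The tuples are chosen one after another outside the vertices already used, which are at most a
-- quarter of `S`. The bound on common non-neighbours is carried along so that every later tuple can
-- be made adjacent to all earlier ones.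
theorem exists_adjacent_tuples {V : Type*} {G : SimpleGraph V} {S : Finset V} {s h : ℕ}
    (hs : 1 ≤ s) (hh : 3 * h < 2 ^ (s ^ 2)) (hSc : 4 * h * s ≤ #S) (hS : S.Nonempty)
    (hd : ∀ v ∈ S, 24 * #{u ∈ S | ¬ G.Adj v u} ≤ #S) :
    ∃ a : ℕ → Fin s → V, (∀ i < h, ∀ r, a i r ∈ S) ∧
      (∀ i < h, ∀ j < i, ∀ r r', a i r ≠ a j r') ∧
      ∀ i < h, ∀ j < i, ∃ r r', G.Adj (a i r) (a j r') := by
  have key : ∀ i ≤ h, ∃ a : ℕ → Fin s → V, (∀ i' < i, ∀ r, a i' r ∈ S) ∧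
      (∀ i' < i, ∀ j < i', ∀ r r', a i' r ≠ a j r') ∧
      (∀ i' < i, ∀ j < i', ∃ r r', G.Adj (a i' r) (a j r')) ∧
      ∀ i' < i, #{v ∈ S | ∀ r, ¬ G.Adj (a i' r) v} * 12 ^ s ≤ 3 * #S := by
    intro i
    induction i with
    | zero => exact fun _ => ⟨fun _ _ => hS.choose, by simp, by simp, by simp, by simp⟩
    | succ i ih =>
      intro hi
      obtain ⟨a, ha1, ha2, ha3, ha4⟩ := ih (by omega)
      set U : Finset V := (range i).biUnion fun j => univ.image (a j) with hU
      have hUc : #U ≤ h * s := by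
        calc #U ≤ #(range i) * s := card_biUnion_le_card_mul _ _ _ fun j _ =>
              card_image_le.trans (by simp)
          _ ≤ h * s := by rw [card_range]; exact Nat.mul_le_mul_right _ (by omega)
      have hPc := le_card_sdiff U S
      obtain ⟨b, hb1, hb2, hb3⟩ := exists_tuple_few_nonneighbors (G := G) (S := S) (P := S \ U) (l := i)
        hs (by omega) sdiff_subset (by rw [mul_assoc] at hSc; omega) hS hd
        (fun j => {v ∈ S | ∀ r, ¬ G.Adj (a j r) v}) ha4
      have hup : ∀ j < i, Function.update a i b j = a j := fun j hj =>
        Function.update_of_ne (by omega) _ _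
      refine ⟨Function.update a i b, ?_, ?_, ?_, ?_⟩
      · intro i' hi' r
        rcases Nat.lt_succ_iff_lt_or_eq.1 hi' with h1 | rfl
        · rw [hup _ h1]; exact ha1 i' h1 r
        · rw [Function.update_self]; exact (mem_sdiff.1 (hb1 r)).1
      · intro i' hi' j hj r r'
        rcases Nat.lt_succ_iff_lt_or_eq.1 hi' with h1 | rfl
        · rw [hup _ h1, hup _ (hj.trans h1)]; exact ha2 i' h1 j hj r r'
        · rw [Function.update_self, hup _ hj]
          have := (mem_sdiff.1 (hb1 r)).2
          simp only [hU, mem_biUnion, mem_range, mem_image, mem_univ, true_and, not_exists,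
            not_and] at this
          exact fun h => this j hj r' h.symm
      · intro i' hi' j hj
        rcases Nat.lt_succ_iff_lt_or_eq.1 hi' with h1 | rfl
        · rw [hup _ h1, hup _ (hj.trans h1)]; exact ha3 i' h1 j hj
        · rw [Function.update_self, hup _ hj]
          obtain ⟨r, hr⟩ := hb3 j hj
          simp only [mem_filter, (mem_sdiff.1 (hb1 r)).1, true_and, not_forall, not_not] at hr
          obtain ⟨r', hr'⟩ := hr
          exact ⟨r, r', hr'.symm⟩
      · intro i' hi'
        rcases Nat.lt_succ_iff_lt_or_eq.1 hi' with h1 | rfl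
        · rw [hup _ h1]; exact ha4 i' h1
        · rw [Function.update_self]; exact hb2
  obtain ⟨a, h1, h2, h3, _⟩ := key h le_rfl
  exact ⟨a, h1, h2, h3⟩

open scoped Classical in
/-- A dense graph on `Ω(h √(log h))` vertices has a `K_h` minor. -/
theorem hasMinor_completeGraph_of_dense {V : Type*} {G : SimpleGraph V} {S : Finset V} {s h : ℕ}
    (hs : 1 ≤ s) (hh : 3 * h < 2 ^ (s ^ 2)) (hSc : 4 * h * s ≤ #S) (hS : S.Nonempty)
    (hd : ∀ v ∈ S, 24 * #{u ∈ S | ¬ G.Adj v u} ≤ #S) : G.HasMinor (completeGraph (Fin h)) := by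
  obtain ⟨a, ha1, ha2, ha3⟩ := exists_adjacent_tuples hs hh hSc hS hd
  have ha2' : ∀ i < h, ∀ j < h, i ≠ j → ∀ r r', a i r ≠ a j r' := by
    intro i hi j hj hij r r'
    rcases lt_or_gt_of_ne hij with h1 | h1
    · exact (ha2 j hj i h1 r' r).symm
    · exact ha2 i hi j h1 r r'
  let o : Fin s := ⟨0, hs⟩
  set U : Finset V := (range h).biUnion fun j => univ.image (a j) with hU
  have hUc : #U ≤ h * s := by
    calc #U ≤ #(range h) * s := card_biUnion_le_card_mul _ _ _ fun j _ =>
          card_image_le.trans (by simp)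
      _ = h * s := by rw [card_range]
  -- Tuples need not be connected. Two vertices of `S` have at least 11/12 of `S` as common
  -- neighbours, so even outside `U` every entry of a tuple can get a private connector to the entry
  -- `o` of the same tuple.
  obtain ⟨c, hcinj, hcm⟩ := exists_injective_of_card_le
    (fun p : Fin h × Fin s => ({z ∈ S | G.Adj (a p.1 o) z ∧ G.Adj (a p.1 p.2) z} : Finset V) \ U) (by
      intro p
      have h1 := hd _ (ha1 p.1 p.1.2 o)
      have h2 := hd _ (ha1 p.1 p.1.2 p.2)
      have h3 : #S ≤ #{z ∈ S | G.Adj (a p.1 o) z ∧ G.Adj (a p.1 p.2) z} +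
          (#{u ∈ S | ¬ G.Adj (a p.1 o) u} + #{u ∈ S | ¬ G.Adj (a p.1 p.2) u}) := by
        refine le_trans (le_trans (card_le_card ?_) (card_union_le _ _))
          (Nat.add_le_add_left (card_union_le _ _) _)
        intro z hz
        simp only [mem_union, mem_filter, hz, true_and]
        tauto
      have h4 := le_card_sdiff U ({z ∈ S | G.Adj (a p.1 o) z ∧ G.Adj (a p.1 p.2) z} : Finset V)
      rw [mul_assoc] at hSc
      simp only [Fintype.card_prod, Fintype.card_fin]
      omega)
  simp only [mem_sdiff, mem_filter] at hcm
  have hUmem : ∀ (i : Fin h) r, a i r ∈ U := fun i r => by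
    simp only [hU, mem_biUnion, mem_range, mem_image, mem_univ, true_and]
    exact ⟨i, i.2, r, rfl⟩
  refine ⟨fun i => {y | (∃ r, y = a i r) ∨ ∃ r, y = c (i, r)}, ?_, ?_, ?_⟩
  · intro i
    refine induce_connected_of_star (x := a i o) (Or.inl ⟨o, rfl⟩) ?_
    rintro y (⟨r, rfl⟩ | ⟨r, rfl⟩)
    · exact Or.inr (Or.inr ⟨c (i, r), Or.inr ⟨r, rfl⟩, (hcm (i, r)).1.2.1, (hcm (i, r)).1.2.2.symm⟩)
    · exact Or.inr (Or.inl (hcm (i, r)).1.2.1)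
  · intro i j hij
    rw [Set.disjoint_left]
    rintro y (⟨r, rfl⟩ | ⟨r, rfl⟩) (⟨r', h'⟩ | ⟨r', h'⟩)
    · exact ha2' i i.2 j j.2 (fun h => hij (Fin.ext h)) r r' h'
    · exact (hcm (j, r')).2 (h' ▸ hUmem i r)
    · exact (hcm (i, r)).2 (h' ▸ hUmem j r')
    · exact hij (congrArg Prod.fst (hcinj h'))
  · intro i j hij
    have hij' : i.1 ≠ j.1 := fun h => hij (Fin.ext h)
    rcases lt_or_gt_of_ne hij' with h1 | h1
    · obtain ⟨r, r', h2⟩ := ha3 j j.2 i h1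
      exact ⟨_, Or.inl ⟨r', rfl⟩, _, Or.inl ⟨r, rfl⟩, h2.symm⟩
    · obtain ⟨r, r', h2⟩ := ha3 i i.2 j h1
      exact ⟨_, Or.inl ⟨r, rfl⟩, _, Or.inl ⟨r', rfl⟩, h2⟩

end SimpleGraph

end

/-! ### Counting cliques in minor-free graphs -/

section

open Finset

namespace SimpleGraph

open scoped Classical in
/-- The number of cliques (including the empty one) contained in `S`. -/
noncomputable def numCliques {V : Type*} (G : SimpleGraph V) (S : Finset V) : ℕ :=
  #(S.powerset.filter fun T : Finset V => G.IsClique (T : Set V))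

theorem numCliques_empty {V : Type*} (G : SimpleGraph V) : G.numCliques ∅ = 1 := by
  simp [numCliques, filter_singleton]

open scoped Classical in
theorem numCliques_le_erase_add {V : Type*} (G : SimpleGraph V) (S : Finset V) (v : V) :
    G.numCliques S ≤ G.numCliques (S.erase v) + G.numCliques (S.filter (G.Adj v)) := by
  unfold numCliques
  set A : Finset (Finset V) := S.powerset.filter (fun T : Finset V => G.IsClique (T : Set V)) with hA
  rw [← card_filter_add_card_filter_not (s := A) (fun T => v ∉ T)]
  refine Nat.add_le_add (card_le_card fun T hT => ?_) ?_
  · simp only [hA, mem_filter, mem_powerset] at hT ⊢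
    exact ⟨fun x hx => mem_erase.2 ⟨fun h => hT.2 (h ▸ hx), hT.1.1 hx⟩, hT.1.2⟩
  · refine card_le_card_of_injOn (fun T => T.erase v) ?_ ?_
    · intro T hT
      simp only [hA, coe_filter, mem_filter, mem_powerset, Set.mem_ofPred_eq, not_not] at hT ⊢
      refine ⟨fun x hx => ?_, hT.1.2.subset (by simp)⟩
      have hx := mem_erase.1 hx
      exact mem_filter.2 ⟨hT.1.1 hx.2, hT.1.2 hT.2 hx.2 hx.1.symm⟩
    · intro T hT T' hT' heq
      simp only [hA, coe_filter, mem_filter, mem_powerset, Set.mem_ofPred_eq, not_not] at hT hT'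
      rw [← insert_erase hT.2, ← insert_erase hT'.2]
      exact congrArg (insert v) heq

open scoped Classical in
theorem CompleteMinorFree.numCliques_le_sum_choose {V : Type*} {G : SimpleGraph V} {h : ℕ}
    (hG : G.CompleteMinorFree h) (S : Finset V) :
    G.numCliques S ≤ ∑ i ∈ range h, (#S).choose i := by
  unfold numCliques
  calc _ ≤ #((range h).biUnion fun i => S.powersetCard i) := by
        refine card_le_card fun T hT => ?_
        simp only [mem_filter, mem_powerset] at hT
        simp only [mem_biUnion, mem_range, mem_powersetCard]
        refine ⟨#T, ?_, hT.1, rfl⟩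
        by_contra hcon
        push Not at hcon
        obtain ⟨T', hT', hc⟩ := exists_subset_card_eq hcon
        refine hG (.of_injective (fun i => (T'.equivFin.symm (i.cast hc.symm)).1)
          (fun i j hij => by simpa using Subtype.ext hij) fun i j hij => ?_)
        refine hT.2 (hT' (Subtype.prop _)) (hT' (Subtype.prop _)) fun heq => hij.ne ?_
        simpa using Subtype.ext heq
    _ ≤ ∑ i ∈ range h, #(S.powersetCard i) := card_biUnion_le
    _ = _ := by simp

open scoped Classical in
-- Vertices are removed one by one until at most `M` are left. Each removal accounts for the cliques
-- through the removed vertex, which live in its current neighbourhood.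
theorem numCliques_le_of_peel {V : Type*} (G : SimpleGraph V) {M Q g : ℕ} (S : Finset V)
    (hbase : ∀ S' ⊆ S, #S' ≤ M → G.numCliques S' ≤ Q)
    (hstep : ∀ S' ⊆ S, M < #S' → ∃ v ∈ S', G.numCliques (S'.filter (G.Adj v)) ≤ g) :
    G.numCliques S ≤ Q + #S * g := by
  obtain ⟨m, hm⟩ : ∃ m, #S = m := ⟨_, rfl⟩
  induction m generalizing S with
  | zero => exact (hbase S subset_rfl (by omega)).trans (Nat.le_add_right _ _)
  | succ m ih =>
    by_cases hM : #S ≤ M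
    · exact (hbase S subset_rfl hM).trans (Nat.le_add_right _ _)
    · obtain ⟨v, hv, hg⟩ := hstep S subset_rfl (by omega)
      have hc : #(S.erase v) = m := by rw [card_erase_of_mem hv]; omega
      have h1 := ih (S.erase v) (fun S' hS' => hbase S' (hS'.trans (erase_subset _ _)))
        (fun S' hS' => hstep S' (hS'.trans (erase_subset _ _))) hc
      have h2 := G.numCliques_le_erase_add S v
      rw [hm, Nat.add_mul]
      rw [hc] at h1
      omega

open scoped Classical in
-- A set of more than `4 * h * s` vertices cannot be dense, so it has a vertex adjacent to less than
-- 23/24 of it, and the cliques through this vertex are counted one level lower. At most `A`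
-- vertices are peeled off, so each level costs a factor `A + 1`. After `j` levels the set is small,
-- and there a clique is a subset with fewer than `h` elements.
theorem CompleteMinorFree.numCliques_le_level {V : Type*} {G : SimpleGraph V} {h s : ℕ}
    (hG : G.CompleteMinorFree h) (hs : 1 ≤ s) (hh : 3 * h < 2 ^ (s ^ 2)) (A j : ℕ) :
    ∀ S : Finset V, #S ≤ A → #S * 23 ^ j ≤ 4 * h * s * 24 ^ j →
      G.numCliques S ≤ (∑ i ∈ range h, (4 * h * s).choose i) * (A + 1) ^ j := by
  have hbase : ∀ S : Finset V, #S ≤ 4 * h * s →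
      G.numCliques S ≤ ∑ i ∈ range h, (4 * h * s).choose i := fun S hS =>
    (hG.numCliques_le_sum_choose S).trans (sum_le_sum fun i _ => Nat.choose_le_choose i hS)
  induction j with
  | zero => intro S _ hS; simpa using hbase S (by simpa using hS)
  | succ j ih =>
    intro S hA hS
    set Q := ∑ i ∈ range h, (4 * h * s).choose i
    have := numCliques_le_of_peel G (M := 4 * h * s) (Q := Q) (g := Q * (A + 1) ^ j) S
      (fun S' _ => hbase S') (fun S' hS' hM => by
        obtain ⟨v, hv, hlt⟩ : ∃ v ∈ S', #S' < 24 * #{u ∈ S' | ¬ G.Adj v u} := by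
          by_contra hcon
          push Not at hcon
          exact hG (hasMinor_completeGraph_of_dense hs hh hM.le (card_pos.1 (by omega)) hcon)
        have hsum := card_filter_add_card_filter_not (s := S') (G.Adj v)
        have hle := card_le_card hS'
        refine ⟨v, hv, ih _ (by omega) ?_⟩
        have h1 : 24 * #(S'.filter (G.Adj v)) ≤ 23 * #S := by omega
        have h2 : 24 * (#(S'.filter (G.Adj v)) * 23 ^ j) ≤ 24 * (4 * h * s * 24 ^ j) := by
          calc _ = (24 * #(S'.filter (G.Adj v))) * 23 ^ j := by ring
            _ ≤ (23 * #S) * 23 ^ j := Nat.mul_le_mul_right _ h1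
            _ = #S * 23 ^ (j + 1) := by ring
            _ ≤ _ := hS
            _ = _ := by ring
        exact Nat.le_of_mul_le_mul_left h2 (by norm_num))
    calc _ ≤ _ := this
      _ ≤ Q * (A + 1) ^ j + A * (Q * (A + 1) ^ j) :=
        Nat.add_le_add (Nat.le_mul_of_pos_right _ (by positivity)) (Nat.mul_le_mul_right _ hA)
      _ = _ := by ring

open scoped Classical in
theorem CompleteMinorFree.sum_card_filter_adj_le {V : Type*} {G : SimpleGraph V} {h : ℕ}
    (hG : G.CompleteMinorFree h) (S : Finset V) :
    ∑ v ∈ S, #(S.filter (G.Adj v)) ≤ 2 * edgeConst h * #S := by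
  have h1 := CompleteMinorFree.card_adj_le _ (G.induce (S : Set V)) rfl (hG.induce _)
  have h2 : ∀ v : (S : Set V), #(S.filter (G.Adj v)) = (G.induce (S : Set V)).degree v := by
    intro v
    rw [← card_neighborFinset_eq_degree]
    refine card_bij' (fun x hx => ⟨x, (mem_filter.1 hx).1⟩) (fun x _ => x.1) ?_ ?_ ?_ ?_
    · intro x hx
      simpa using (mem_filter.1 hx).2
    · intro x hx
      have hx' : G.Adj v x := by simpa using hx
      exact mem_filter.2 ⟨x.2, hx'⟩
    · intro x hx; rfl
    · intro x hx; rfl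
  rw [← sum_coe_sort]
  calc ∑ v : (S : Set V), #(S.filter (G.Adj v)) = ∑ v, (G.induce (S : Set V)).degree v :=
        sum_congr rfl fun v _ => h2 v
    _ ≤ 2 * edgeConst h * Fintype.card (S : Set V) := by
      rw [← card_adj_eq_sum_degree]
      convert h1
    _ = _ := by simp

open scoped Classical in
theorem CompleteMinorFree.exists_degree_le {V : Type*} {G : SimpleGraph V} {h : ℕ}
    (hG : G.CompleteMinorFree h) (S : Finset V) (hS : S.Nonempty) :
    ∃ v ∈ S, #(S.filter (G.Adj v)) ≤ 2 * edgeConst h := by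
  by_contra hcon
  push Not at hcon
  have h1 := hG.sum_card_filter_adj_le S
  have h2 : ∑ v ∈ S, (2 * edgeConst h + 1) ≤ ∑ v ∈ S, #(S.filter (G.Adj v)) := sum_le_sum hcon
  have h3 : 0 < #S := card_pos.2 hS
  rw [sum_const, smul_eq_mul] at h2
  nlinarith

/-- The size of a dense graph that has a `K_h` minor is `4 * h * denseConst h`. -/
def denseConst (h : ℕ) : ℕ := Nat.sqrt (Nat.log 2 (3 * h)) + 1

theorem lt_two_pow_denseConst {h : ℕ} : 3 * h < 2 ^ (denseConst h ^ 2) := by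
  refine (Nat.lt_pow_succ_log_self one_lt_two _).trans_le (Nat.pow_le_pow_right two_pos ?_)
  have := Nat.lt_succ_sqrt' (Nat.log 2 (3 * h))
  simpa [denseConst] using this

/-- `K_h`-minor-free graphs on `n` vertices have at most `cliqueConst h * n` nonempty cliques. -/
def cliqueConst (h : ℕ) : ℕ :=
  (∑ i ∈ range h, (4 * h * denseConst h).choose i) *
    (2 * edgeConst h + 1) ^ (17 * (Nat.log 2 (3 * h) + 1))

/-- By the edge bound the whole set can be peeled down to nothing with neighbourhoods of size at
most `2 * edgeConst h`. This makes the count linear in `#S`, and the level bound applies to these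
small neighbourhoods. -/
theorem CompleteMinorFree.numCliques_le {V : Type*} {G : SimpleGraph V} {h : ℕ}
    (hG : G.CompleteMinorFree h) (S : Finset V) : G.numCliques S ≤ 1 + #S * cliqueConst h := by
  classical
  refine numCliques_le_of_peel G (M := 0) S (fun S' _ hS' => ?_) (fun S' _ hS' => ?_)
  · rw [card_eq_zero.1 (Nat.le_zero.1 hS'), numCliques_empty]
  · obtain ⟨v, hv, hd⟩ := hG.exists_degree_le S' (card_pos.1 hS')
    refine ⟨v, hv, hG.numCliques_le_level (Nat.succ_pos _) lt_two_pow_denseConst _ _ _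
      (by convert hd) ?_⟩
    have hne : Nonempty V := ⟨v⟩
    have hh := hG.two_le
    have hd' : #(S'.filter (G.Adj v)) ≤ 2 * edgeConst h := by convert hd
    refine (Nat.mul_le_mul_right _ hd').trans ?_
    set L := Nat.log 2 (3 * h) + 1 with hL
    -- Since `(24 / 23) ^ 17 ≥ 2`, seventeen levels halve the size. The initial size exceeds `4 * h`
    -- by a factor of at most `3 * h ≤ 2 ^ L`.
    have h2 : 2 ^ L * 23 ^ (17 * L) ≤ 24 ^ (17 * L) := by
      rw [pow_mul, pow_mul, ← mul_pow]
      exact Nat.pow_le_pow_left (by norm_num) _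
    have h3 : 3 * h ≤ 2 ^ L := (Nat.lt_pow_succ_log_self one_lt_two _).le
    have h4 : 2 * edgeConst h ≤ 4 * h * (3 * h) := by unfold edgeConst; nlinarith
    have h5 : 4 * h ≤ 4 * h * denseConst h := Nat.le_mul_of_pos_right _ (Nat.succ_pos _)
    calc 2 * edgeConst h * 23 ^ (17 * L) ≤ 4 * h * 2 ^ L * 23 ^ (17 * L) :=
          Nat.mul_le_mul_right _ (h4.trans (Nat.mul_le_mul_left _ h3))
      _ = 4 * h * (2 ^ L * 23 ^ (17 * L)) := by ring
      _ ≤ _ := Nat.mul_le_mul h5 h2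

end SimpleGraph

end

/-! ### Traces of neighbourhoods and the branching vertex -/

section

open Finset

namespace SimpleGraph

open scoped Classical in
/-- The vertices of `B` that `v` dominates. -/
noncomputable def domSet {V : Type*} (G : SimpleGraph V) (B : Finset V) (v : V) : Finset V :=
  B.filter fun x => x = v ∨ G.Adj v x

theorem mem_domSet {V : Type*} {G : SimpleGraph V} {B : Finset V} {v x : V} :
    x ∈ G.domSet B v ↔ x ∈ B ∧ (x = v ∨ G.Adj v x) := by
  simp [domSet]

open scoped Classical in
/-- There are few different traces on `B` of neighbourhoods of vertices outside `B`. -/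
theorem CompleteMinorFree.card_image_domSet_le {V : Type*} [Fintype V] {G : SimpleGraph V} {h : ℕ}
    (hG : G.CompleteMinorFree h) (B : Finset V) :
    #(Bᶜ.image (G.domSet B)) ≤ 2 * edgeConst h * #B + (1 + #B * cliqueConst h) := by
  -- An element `(w, x, y)` assigns to an outside vertex `w` a nonadjacent pair of its neighbours in
  -- `B`. Each `w` and each pair is used at most once.
  let P : Finset (V × V × V) → Prop := fun M =>
    (∀ t ∈ M, t.1 ∉ B ∧ t.2.1 ∈ B ∧ t.2.2 ∈ B ∧ t.2.1 ≠ t.2.2 ∧ ¬ G.Adj t.2.1 t.2.2 ∧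
      G.Adj t.1 t.2.1 ∧ G.Adj t.1 t.2.2) ∧
    (∀ t ∈ M, ∀ t' ∈ M, t.1 = t'.1 → t = t') ∧
    (∀ t ∈ M, ∀ t' ∈ M, t.2 = t'.2 → t = t')
  obtain ⟨M, hM, hmax⟩ := exists_max_image (univ.filter P) card ⟨∅, by simp [P]⟩
  obtain ⟨hM1, hM2, hM3⟩ := (mem_filter.1 hM).2
  -- This is contained in what results from contracting each matched `w` into the first vertex of
  -- its pair, so it is a minor of `G`.
  let Γ : SimpleGraph B :=
    { Adj := fun a b => a ≠ b ∧ (G.Adj a b ∨ ∃ w, (w, a.1, b.1) ∈ M ∨ (w, b.1, a.1) ∈ M)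
      symm := ⟨fun a b hab => ⟨hab.1.symm, hab.2.imp (·.symm) fun ⟨w, hw⟩ => ⟨w, hw.symm⟩⟩⟩
      loopless := ⟨fun a ha => ha.1 rfl⟩ }
  have hΓ : Γ.CompleteMinorFree h := by
    refine hG.of_hasMinor ⟨fun a => {y | y = a.1 ∨ ∃ b, (y, a.1, b) ∈ M}, ?_, ?_, ?_⟩
    · intro a
      refine induce_connected_of_star (x := a.1) (Or.inl rfl) ?_
      rintro y (rfl | ⟨b, hb⟩)
      · exact Or.inl rfl
      · exact Or.inr (Or.inl (hM1 _ hb).2.2.2.2.2.1.symm)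
    · intro a a' haa
      have haa' : a.1 ≠ a'.1 := fun h => haa (Subtype.ext h)
      rw [Set.disjoint_left]
      rintro y (rfl | ⟨b, hb⟩) (h' | ⟨b', hb'⟩)
      · exact haa' h'
      · exact (hM1 _ hb').1 a.2
      · exact (hM1 _ hb).1 (h' ▸ a'.2)
      · have := hM2 _ hb _ hb' rfl
        simp only [Prod.mk.injEq, true_and] at this
        exact haa' this.1
    · rintro a a' ⟨_, h | ⟨w, h | h⟩⟩
      · exact ⟨a, Or.inl rfl, a', Or.inl rfl, h⟩
      · exact ⟨w, Or.inr ⟨_, h⟩, a', Or.inl rfl, (hM1 _ h).2.2.2.2.2.2⟩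
      · exact ⟨a, Or.inl rfl, w, Or.inr ⟨_, h⟩, (hM1 _ h).2.2.2.2.2.2.symm⟩
  have hMc : #M ≤ 2 * edgeConst h * #B := by
    have h1 := CompleteMinorFree.card_adj_le _ Γ rfl hΓ
    rw [Fintype.card_coe] at h1
    refine le_trans ?_ h1
    -- Distinct triples have distinct pairs, so `M` is covered by the ordered adjacent pairs of `Γ`.
    -- The last alternative is a dummy value.
    refine card_le_card_of_surjOn (fun p => if hp : ∃ w, (w, p.1.1, p.2.1) ∈ M then
      (hp.choose, p.1.1, p.2.1) else (p.1.1, p.1.1, p.1.1)) ?_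
    rintro ⟨w, x, y⟩ ht
    obtain ⟨_, hx, hy, hxy, _⟩ := hM1 _ ht
    have hex : ∃ w, (w, x, y) ∈ M := ⟨w, ht⟩
    refine ⟨(⟨x, hx⟩, ⟨y, hy⟩), ?_, ?_⟩
    · simp only [coe_filter, mem_univ, true_and, Set.mem_ofPred_eq]
      exact ⟨fun h => hxy (congrArg Subtype.val h), Or.inr ⟨w, Or.inl ht⟩⟩
    · simp only [hex, dif_pos]
      exact hM3 _ hex.choose_spec _ ht rfl
  have hcl := hΓ.numCliques_le univ
  rw [card_univ, Fintype.card_coe] at hcl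
  have hsub : Bᶜ.image (G.domSet B) ⊆ (M.image Prod.fst).image (G.domSet B) ∪
      ((univ.powerset.filter fun T : Finset B => Γ.IsClique (T : Set B)).image
        fun T => T.map (Function.Embedding.subtype _)) := by
    intro T hT
    obtain ⟨w, hw, rfl⟩ := mem_image.1 hT
    rw [mem_compl] at hw
    rw [mem_union]
    by_cases hwM : w ∈ M.image Prod.fst
    · exact Or.inl (mem_image_of_mem _ hwM)
    · refine Or.inr (mem_image.2 ⟨(G.domSet B w).subtype (· ∈ B), ?_, ?_⟩)
      · simp only [powerset_univ, mem_filter, mem_univ, true_and]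
        -- If two neighbours of an unmatched `w` were nonadjacent in `Γ`, then `w` with this pair
        -- could be added to the maximal `M`. So the trace of `w` is a clique of `Γ`.
        intro a ha b hb hab
        refine ⟨hab, ?_⟩
        by_contra hcon
        push Not at hcon
        obtain ⟨hnadj, hcon⟩ := hcon
        simp only [mem_coe, mem_subtype, mem_domSet, SetLike.coe_mem, true_and] at ha hb
        have hab' : a.1 ≠ b.1 := fun h => hab (Subtype.ext h)
        have hwa : G.Adj w a := ha.resolve_left fun h => hw (h ▸ a.2)
        have hwb : G.Adj w b := hb.resolve_left fun h => hw (h ▸ b.2)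
        have hwM' : ∀ t ∈ M, t.1 ≠ w := fun t ht h => hwM (mem_image.2 ⟨t, ht, h⟩)
        have hnot : (w, a.1, b.1) ∉ M := fun h => hwM' _ h rfl
        have hpair : ∀ t ∈ M, t.2 ≠ (a.1, b.1) := by
          rintro ⟨w', p⟩ ht rfl
          exact (hcon w').1 ht
        have hP : P (insert (w, a.1, b.1) M) := by
          refine ⟨?_, ?_, ?_⟩
          · intro t ht
            rcases mem_insert.1 ht with rfl | ht
            · exact ⟨hw, a.2, b.2, hab', hnadj, hwa, hwb⟩
            · exact hM1 t ht
          · intro t ht t' ht' heq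
            rcases mem_insert.1 ht with rfl | ht <;> rcases mem_insert.1 ht' with rfl | ht'
            · rfl
            · exact absurd heq.symm (hwM' _ ht')
            · exact absurd heq (hwM' _ ht)
            · exact hM2 t ht t' ht' heq
          · intro t ht t' ht' heq
            rcases mem_insert.1 ht with rfl | ht <;> rcases mem_insert.1 ht' with rfl | ht'
            · rfl
            · exact absurd heq.symm (hpair _ ht')
            · exact absurd heq (hpair _ ht)
            · exact hM3 t ht t' ht' heq
        have := hmax _ (mem_filter.2 ⟨mem_univ _, hP⟩)
        rw [card_insert_of_notMem hnot] at this
        omega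
      · exact subtype_map_of_mem fun x hx => (mem_domSet.1 hx).1
  refine (card_le_card hsub).trans ((card_union_le _ _).trans (Nat.add_le_add
    ((card_image_le.trans card_image_le).trans hMc) (card_image_le.trans ?_)))
  refine le_trans (le_of_eq ?_) hcl
  unfold numCliques
  congr!

/-- The branching factor of the search. -/
def branchConst (h : ℕ) : ℕ := 1 + 2 * edgeConst h * (2 + 2 * edgeConst h + cliqueConst h)

open scoped Classical in
/-- Some vertex of `B` has only few candidates for dominating it, if candidates are identified when
they dominate the same part of `B`. -/
theorem CompleteMinorFree.exists_card_image_domSet_le {V : Type*} [Fintype V] {G : SimpleGraph V}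
    {h : ℕ} (hG : G.CompleteMinorFree h) (B : Finset V) (hB : B.Nonempty) :
    ∃ b ∈ B, #(({v | v = b ∨ G.Adj b v} : Finset V).image (G.domSet B)) ≤ branchConst h := by
  -- `c` picks one outside vertex for each trace. The value for sets that are not traces is
  -- irrelevant.
  let c : Finset V → V := fun T => if hT : ∃ v ∈ Bᶜ, G.domSet B v = T then hT.choose else hB.choose
  have hc : ∀ v ∈ Bᶜ, G.domSet B (c (G.domSet B v)) = G.domSet B v := by
    intro v hv
    have hT : ∃ v' ∈ Bᶜ, G.domSet B v' = G.domSet B v := ⟨v, hv, rfl⟩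
    simp only [c, hT, dif_pos]
    exact hT.choose_spec.2
  set W' := (Bᶜ.image (G.domSet B)).image c with hW'
  have hW'c : #W' ≤ 2 * edgeConst h * #B + (1 + #B * cliqueConst h) :=
    card_image_le.trans (hG.card_image_domSet_le B)
  set R := B ∪ W' with hR
  have hRc : #R ≤ #B + #W' := card_union_le _ _
  have hB0 : 0 < #B := card_pos.2 hB
  -- A candidate other than `b` lies in `B` or has the trace of a representative in `W'`, which is
  -- then also a candidate. So the classes are counted by `b` and its neighbours in `R`.
  have hfew : ∀ b ∈ B, #(({v | v = b ∨ G.Adj b v} : Finset V).image (G.domSet B)) ≤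
      1 + #(R.filter (G.Adj b)) := by
    intro b hb
    have : ({v | v = b ∨ G.Adj b v} : Finset V).image (G.domSet B) ⊆
        (insert b (R.filter (G.Adj b))).image (G.domSet B) := by
      intro T hT
      obtain ⟨v, hv, rfl⟩ := mem_image.1 hT
      simp only [mem_filter, mem_univ, true_and] at hv
      rcases hv with rfl | hv
      · exact mem_image_of_mem _ (mem_insert_self _ _)
      · by_cases hvB : v ∈ B
        · exact mem_image_of_mem _ (mem_insert_of_mem (mem_filter.2 ⟨mem_union_left _ hvB, hv⟩))
        · have hvB' : v ∈ Bᶜ := mem_compl.2 hvB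
          have h1 := hc v hvB'
          refine mem_image.2 ⟨c (G.domSet B v), ?_, h1⟩
          have h2 : b ∈ G.domSet B (c (G.domSet B v)) := by
            rw [h1, mem_domSet]; exact ⟨hb, Or.inr hv.symm⟩
          rcases (mem_domSet.1 h2).2 with h3 | h3
          · rw [← h3]; exact mem_insert_self _ _
          · refine mem_insert_of_mem (mem_filter.2 ⟨mem_union_right _ ?_, h3.symm⟩)
            exact mem_image_of_mem _ (mem_image_of_mem _ hvB')
    refine (card_le_card this).trans (card_image_le.trans ((card_insert_le _ _).trans ?_))
    omega
  -- Averaging: `R` has size at most `#B` times a constant, so its edges cannot give every vertex of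
  -- `B` a degree of `branchConst h`.
  by_contra hcon
  push Not at hcon
  have h1 : ∑ b ∈ B, branchConst h ≤ ∑ b ∈ B, #(R.filter (G.Adj b)) :=
    sum_le_sum fun b hb => by have := hfew b hb; have := hcon b hb; omega
  have h2 : ∑ b ∈ B, #(R.filter (G.Adj b)) ≤ ∑ b ∈ R, #(R.filter (G.Adj b)) :=
    sum_le_sum_of_subset subset_union_left
  have h3 := hG.sum_card_filter_adj_le R
  rw [sum_const, smul_eq_mul] at h1
  have h4 : #R ≤ #B * (2 + 2 * edgeConst h + cliqueConst h) := by nlinarith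
  have h5 : 2 * edgeConst h * #R ≤ 2 * edgeConst h * (#B * (2 + 2 * edgeConst h + cliqueConst h)) :=
    Nat.mul_le_mul_left _ h4
  unfold branchConst at h1
  nlinarith

end SimpleGraph

end

namespace RAM

/-! ### A structured language with arrays -/

/-- Memory of the structured language: registers, sixteen unbounded arrays, and a lower part that
holds the input. -/
structure Store : Type where
  reg : ℕ → ℕ
  arr : Fin 16 → ℕ → ℕ
  low : ℕ → ℕ

/-- Structured programs. -/
inductive Cmd : Type
  | skip
  | const (d c : ℕ)
  | add (d a b : ℕ)
  | sub (d a b : ℕ)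
  | load (d : ℕ) (x : Fin 16) (i : ℕ)
  | store (x : Fin 16) (i s : ℕ)
  | loadLow (d i : ℕ)
  | storeLow (i s : ℕ)
  | seq (c c' : Cmd)
  | ifLt (a b : ℕ) (c c' : Cmd)
  | whileLt (a b : ℕ) (c : Cmd)

namespace Store

def setReg (s : Store) (d v : ℕ) : Store := { s with reg := Function.update s.reg d v }

def setArr (s : Store) (x : Fin 16) (i v : ℕ) : Store :=
  { s with arr := Function.update s.arr x (Function.update (s.arr x) i v) }

def setLow (s : Store) (i v : ℕ) : Store := { s with low := Function.update s.low i v }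

end Store

/-- `Exec N base c s t s'`: the program `c` takes the store `s` to the store `s'` in `t` steps, and
all numbers that it computes are at most `N`. -/
inductive Exec (N base : ℕ) : Cmd → Store → ℕ → Store → Prop
  | skip (s) : Exec N base .skip s 0 s
  | const (d c s) : c ≤ N → Exec N base (.const d c) s 1 (s.setReg d c)
  | add (d a b s) : s.reg a + s.reg b ≤ N →
      Exec N base (.add d a b) s 1 (s.setReg d (s.reg a + s.reg b))
  | sub (d a b s) : Exec N base (.sub d a b) s 1 (s.setReg d (s.reg a - s.reg b))
  | load (d x i s) : Exec N base (.load d x i) s 1 (s.setReg d (s.arr x (s.reg i)))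
  | store (x i v s) : Exec N base (.store x i v) s 1 (s.setArr x (s.reg i) (s.reg v))
  | loadLow (d i s) : s.reg i < base →
      Exec N base (.loadLow d i) s 1 (s.setReg d (s.low (s.reg i)))
  | storeLow (i v s) : s.reg i < base →
      Exec N base (.storeLow i v) s 1 (s.setLow (s.reg i) (s.reg v))
  | seq {c c' s t s' t' s''} : Exec N base c s t s' → Exec N base c' s' t' s'' →
      Exec N base (.seq c c') s (t + t') s''
  | ifTrue {a b c c' s t s'} : s.reg a < s.reg b → Exec N base c s t s' →
      Exec N base (.ifLt a b c c') s (t + 1) s'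
  | ifFalse {a b c c' s t s'} : ¬ s.reg a < s.reg b → Exec N base c' s t s' →
      Exec N base (.ifLt a b c c') s (t + 1) s'
  | whileTrue {a b c s t s' t' s''} : s.reg a < s.reg b → Exec N base c s t s' →
      Exec N base (.whileLt a b c) s' t' s'' → Exec N base (.whileLt a b c) s (t + t' + 1) s''
  | whileFalse {a b c s} : ¬ s.reg a < s.reg b → Exec N base (.whileLt a b c) s 1 s

/-- Code that computes the address of entry `reg i` of the array `x` in the temporary
register `1`. -/
def addrCode (x : Fin 16) (i : ℕ) : List Instr :=
  -- Four doublings give sixteen times the index. The sixteen arrays are interleaved, so each of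
  -- them is unbounded.
  [.add 1 (i + 3) (i + 3), .add 1 1 1, .add 1 1 1, .add 1 1 1, .const 2 x, .add 1 1 2, .add 1 1 0]

/-- The machine code of a structured program, to be placed at position `p`. Register `0` holds the
address at which the arrays start, registers `1` and `2` are temporary. -/
def Cmd.compile : Cmd → ℕ → List Instr
  | .skip, _ => []
  | .const d c, _ => [.const (d + 3) c]
  | .add d a b, _ => [.add (d + 3) (a + 3) (b + 3)]
  | .sub d a b, _ => [.sub (d + 3) (a + 3) (b + 3)]
  | .load d x i, _ => addrCode x i ++ [.load (d + 3) 1]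
  | .store x i v, _ => addrCode x i ++ [.store 1 (v + 3)]
  | .loadLow d i, _ => [.load (d + 3) (i + 3)]
  | .storeLow i v, _ => [.store (i + 3) (v + 3)]
  | .seq c c', p => c.compile p ++ c'.compile (p + (c.compile p).length)
  | .ifLt a b c c', p =>
    let e := c'.compile (p + 1)
    let q := p + 1 + e.length + 1
    let f := c.compile q
    -- The alternative branch comes first. The comparison of register `0` with itself is an
    -- unconditional jump.
    .jumpLt (a + 3) (b + 3) q :: (e ++ .jumpEq 0 0 (q + f.length) :: f)
  | .whileLt a b c, p =>
    let e := c.compile (p + 2)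
    .jumpLt (a + 3) (b + 3) (p + 2) :: .jumpEq 0 0 (p + 2 + e.length + 1) :: (e ++ [.jumpEq 0 0 p])

/-! ### Correctness of the compilation -/

/-- The program `P` has the given code at position `p`. -/
def CodeAt (P : Program) (p : ℕ) (code : List Instr) : Prop :=
  ∀ i < code.length, P[p + i]? = code[i]?

theorem CodeAt.head {P p i l} (h : CodeAt P p (i :: l)) : P[p]? = some i := by
  simpa using h 0 (by simp)

theorem CodeAt.tail {P p i l} (h : CodeAt P p (i :: l)) : CodeAt P (p + 1) l := by
  intro j hj
  have := h (j + 1) (by simpa using hj)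
  rw [show p + 1 + j = p + (j + 1) by ring, this, List.getElem?_cons_succ]

theorem CodeAt.left {P p l l'} (h : CodeAt P p (l ++ l')) : CodeAt P p l := by
  intro j hj
  rw [h j (by simp; omega), List.getElem?_append_left hj]

theorem CodeAt.right {P p l l'} (h : CodeAt P p (l ++ l')) : CodeAt P (p + l.length) l' := by
  intro j hj
  rw [add_assoc, h _ (by simp; omega), List.getElem?_append_right (by omega)]
  simp

/-- `P` goes from `σ` to `σ'` in `t` steps, using only numbers up to `M`. -/
def Reaches (P : Program) (M t : ℕ) (σ σ' : Config) : Prop :=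
  (step P)^[t] σ = σ' ∧ ∀ s ≤ t, ((step P)^[s] σ).FitsIn M

theorem Reaches.refl {P M σ} (h : Config.FitsIn σ M) : Reaches P M 0 σ σ :=
  ⟨rfl, fun s hs => by simpa [Nat.le_zero.1 hs] using h⟩

theorem Reaches.trans {P M t t' σ σ' σ''} (h : Reaches P M t σ σ') (h' : Reaches P M t' σ' σ'') :
    Reaches P M (t + t') σ σ'' := by
  refine ⟨by rw [add_comm, Function.iterate_add_apply, h.1, h'.1], fun s hs => ?_⟩
  by_cases hst : s ≤ t
  · exact h.2 s hst
  · obtain ⟨r, rfl⟩ := Nat.exists_eq_add_of_le (show t ≤ s by omega)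
    rw [add_comm, Function.iterate_add_apply, h.1]
    exact h'.2 r (by omega)

theorem Reaches.single {P : Program} {M : ℕ} {σ : Config} {i : Instr} (hi : P[σ.pc]? = some i)
    (h : σ.FitsIn M) (h' : (i.exec σ).FitsIn M) : Reaches P M 1 σ (i.exec σ) := by
  have hs : step P σ = i.exec σ := by simp [step, hi]
  refine ⟨by simpa using hs, fun s hs' => ?_⟩
  interval_cases s
  · simpa using h
  · simpa [hs] using h'

/-- The configuration `σ` represents the store `s`. -/
structure Sim (N base M : ℕ) (s : Store) (σ : Config) : Prop where
  reg : ∀ r, σ.reg (r + 3) = s.reg r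
  reg_zero : σ.reg 0 = base
  tmp : σ.reg 1 ≤ M ∧ σ.reg 2 ≤ M
  low : ∀ a < base, σ.mem a = s.low a
  arr : ∀ (x : Fin 16) i, σ.mem (base + 16 * i + x) = s.arr x i
  reg_le : ∀ r, s.reg r ≤ N
  low_le : ∀ a, s.low a ≤ N
  arr_le : ∀ x i, s.arr x i ≤ N

variable {N base M : ℕ} {P : Program} {s : Store} {σ : Config} {p : ℕ}

/-- The margin in `hM` also leaves room for the addresses of array entries, the largest numbers that
the compiled code computes. A memory cell from `base` on belongs to the array given by its offset
modulo 16. -/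
theorem Sim.fitsIn {s σ} (hM : base + 16 * N + 16 ≤ M) (h : Sim N base M s σ) : σ.FitsIn M := by
  constructor
  · intro r
    match r with
    | 0 => rw [h.reg_zero]; omega
    | 1 => exact h.tmp.1
    | 2 => exact h.tmp.2
    | r + 3 => rw [h.reg]; have := h.reg_le r; omega
  · intro a
    by_cases ha : a < base
    · rw [h.low a ha]; have := h.low_le a; omega
    · have := h.arr ⟨(a - base) % 16, Nat.mod_lt _ (by norm_num)⟩ ((a - base) / 16)
      simp only at this
      rw [show base + 16 * ((a - base) / 16) + (a - base) % 16 = a by omega] at this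
      rw [this]
      have := h.arr_le ⟨(a - base) % 16, Nat.mod_lt _ (by norm_num)⟩ ((a - base) / 16)
      omega

theorem Sim.setPc {s σ} (h : Sim N base M s σ) (p : ℕ) : Sim N base M s { σ with pc := p } :=
  ⟨h.reg, h.reg_zero, h.tmp, h.low, h.arr, h.reg_le, h.low_le, h.arr_le⟩

theorem Sim.setTmp {s σ} (h : Sim N base M s σ) (p : ℕ) {d v : ℕ} (hd : d = 1 ∨ d = 2) (hv : v ≤ M) :
    Sim N base M s { σ with pc := p, reg := Function.update σ.reg d v } := by
  refine ⟨fun r => ?_, ?_, ?_, h.low, h.arr, h.reg_le, h.low_le, h.arr_le⟩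
  · simpa [Function.update_of_ne (show r + 3 ≠ d by omega)] using h.reg r
  · simpa [Function.update_of_ne (show 0 ≠ d by omega)] using h.reg_zero
  · have := h.tmp
    rcases hd with rfl | rfl <;> simpa [Function.update_apply] using ⟨by omega, by omega⟩

theorem Sim.setReg {s σ} (h : Sim N base M s σ) (p : ℕ) {d v : ℕ} (hv : v ≤ N) :
    Sim N base M (s.setReg d v) { σ with pc := p, reg := Function.update σ.reg (d + 3) v } := by
  refine ⟨fun r => ?_, ?_, ?_, h.low, h.arr, fun r => ?_, h.low_le, h.arr_le⟩
  · by_cases hr : r = d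
    · subst hr; simp [Store.setReg]
    · simpa [Store.setReg, Function.update_apply, hr] using h.reg r
  · simpa [Function.update_apply] using h.reg_zero
  · simpa [Function.update_apply] using h.tmp
  · by_cases hr : r = d
    · subst hr; simpa [Store.setReg]
    · simpa [Store.setReg, Function.update_apply, hr] using h.reg_le r

theorem Sim.setLow {s σ} (h : Sim N base M s σ) (p : ℕ) {a v : ℕ} (ha : a < base) (hv : v ≤ N) :
    Sim N base M (s.setLow a v) { σ with pc := p, mem := Function.update σ.mem a v } := by
  refine ⟨h.reg, h.reg_zero, h.tmp, fun b hb => ?_, fun x i => ?_, h.reg_le, fun b => ?_, h.arr_le⟩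
  · by_cases hr : b = a
    · subst hr; simp [Store.setLow]
    · simpa [Store.setLow, Function.update_apply, hr] using h.low b hb
  · simpa [Store.setLow, Function.update_of_ne (show base + 16 * i + x ≠ a by omega)] using h.arr x i
  · by_cases hr : b = a
    · subst hr; simpa [Store.setLow]
    · simpa [Store.setLow, Function.update_apply, hr] using h.low_le b

theorem Sim.setArr {s σ} (h : Sim N base M s σ) (p : ℕ) (x : Fin 16) (i : ℕ) {v : ℕ} (hv : v ≤ N) :
    Sim N base M (s.setArr x i v)
      { σ with pc := p, mem := Function.update σ.mem (base + 16 * i + x) v } := by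
  refine ⟨h.reg, h.reg_zero, h.tmp, fun b hb => ?_, fun y j => ?_, h.reg_le, h.low_le, fun y j => ?_⟩
  · simpa [Store.setArr, Function.update_of_ne (show b ≠ base + 16 * i + x by omega)] using h.low b hb
  · by_cases hy : y = x
    · subst hy
      by_cases hj : j = i
      · subst hj; simp [Store.setArr]
      · simpa [Store.setArr, Function.update_apply, hj] using h.arr y j
    · have : base + 16 * j + y ≠ base + 16 * i + x := by
        have := y.2
        have := x.2
        have : y.1 ≠ x.1 := fun h => hy (Fin.ext h)
        omega
      simpa [Store.setArr, Function.update_of_ne this, Function.update_of_ne hy] using h.arr y j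
  · by_cases hy : y = x
    · subst hy
      by_cases hj : j = i
      · subst hj; simpa [Store.setArr]
      · simpa [Store.setArr, Function.update_apply, hj] using h.arr_le y j
    · simpa [Store.setArr, Function.update_of_ne hy] using h.arr_le y j

theorem reaches_tmp {P : Program} {s σ} {i : Instr} (hM : base + 16 * N + 16 ≤ M)
    (h : Sim N base M s σ) {d v p : ℕ} (hd : d = 1 ∨ d = 2) (hv : v ≤ M) (hp : σ.pc = p)
    (hi : P[p]? = some i)
    (hex : i.exec σ = { σ with pc := σ.pc + 1, reg := Function.update σ.reg d v }) :
    ∃ σ', Reaches P M 1 σ σ' ∧ Sim N base M s σ' ∧ σ'.pc = p + 1 ∧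
      σ'.reg = Function.update σ.reg d v ∧ σ'.mem = σ.mem := by
  have h' := h.setTmp (σ.pc + 1) hd hv
  refine ⟨_, Reaches.single (by rw [hp]; exact hi) (h.fitsIn hM) (by rw [hex]; exact h'.fitsIn hM), ?_⟩
  rw [hex]
  exact ⟨h', by simp [hp], rfl, rfl⟩

theorem reaches_addrCode {P : Program} {s σ p} (hM : base + 16 * N + 16 ≤ M)
    (h : Sim N base M s σ) (hp : σ.pc = p) {x : Fin 16} {i : ℕ} (hc : CodeAt P p (addrCode x i)) :
    ∃ σ', Reaches P M 7 σ σ' ∧ Sim N base M s σ' ∧ σ'.pc = p + 7 ∧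
      σ'.reg 1 = base + 16 * s.reg i + x ∧ σ'.mem = σ.mem := by
  have hN := h.reg_le i
  have hx := x.2
  obtain ⟨σ1, r1, h1, p1, e1, m1⟩ := reaches_tmp (d := 1) (v := 2 * s.reg i) hM h (by simp) (by omega) hp
    hc.head (by simp [Instr.exec, h.reg, two_mul])
  have e1' : σ1.reg 1 = 2 * s.reg i := by simp [e1]
  obtain ⟨σ2, r2, h2, p2, e2, m2⟩ := reaches_tmp (d := 1) (v := 4 * s.reg i) hM h1 (by simp) (by omega) p1
    hc.tail.head (by simp [Instr.exec, e1']; congr 1; ring)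
  have e2' : σ2.reg 1 = 4 * s.reg i := by simp [e2]
  obtain ⟨σ3, r3, h3, p3, e3, m3⟩ := reaches_tmp (d := 1) (v := 8 * s.reg i) hM h2 (by simp) (by omega) p2
    hc.tail.tail.head (by simp [Instr.exec, e2']; congr 1; ring)
  have e3' : σ3.reg 1 = 8 * s.reg i := by simp [e3]
  obtain ⟨σ4, r4, h4, p4, e4, m4⟩ := reaches_tmp (d := 1) (v := 16 * s.reg i) hM h3 (by simp) (by omega) p3
    hc.tail.tail.tail.head (by simp [Instr.exec, e3']; congr 1; ring)
  have e4' : σ4.reg 1 = 16 * s.reg i := by simp [e4]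
  obtain ⟨σ5, r5, h5, p5, e5, m5⟩ := reaches_tmp (d := 2) (v := x) hM h4 (by simp) (by omega) p4
    hc.tail.tail.tail.tail.head (by simp [Instr.exec])
  have e5' : σ5.reg 1 = 16 * s.reg i := by simp [e5, e4']
  have e5'' : σ5.reg 2 = x := by simp [e5]
  obtain ⟨σ6, r6, h6, p6, e6, m6⟩ := reaches_tmp (d := 1) (v := 16 * s.reg i + x) hM h5 (by simp)
    (by omega) p5 hc.tail.tail.tail.tail.tail.head (by simp [Instr.exec, e5', e5''])
  have e6' : σ6.reg 1 = 16 * s.reg i + x := by simp [e6]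
  obtain ⟨σ7, r7, h7, p7, e7, m7⟩ := reaches_tmp (d := 1) (v := base + 16 * s.reg i + x) hM h6 (by simp)
    (by omega) p6 hc.tail.tail.tail.tail.tail.tail.head (by
      simp only [Instr.exec, e6', h6.reg_zero, Config.mk.injEq, true_and, and_true]; congr 1; ring)
  refine ⟨σ7, ((((((r1.trans r2).trans r3).trans r4).trans r5).trans r6).trans r7), h7, p7, by simp [e7],
    by rw [m7, m6, m5, m4, m3, m2, m1]⟩

/-- The compiled program simulates the structured program with a constant factor loss of time. -/
theorem Exec.compile {P : Program} (hM : base + 16 * N + 16 ≤ M) {c s t s'}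
    (h : Exec N base c s t s') : ∀ {p σ}, CodeAt P p (c.compile p) → Sim N base M s σ → σ.pc = p →
      ∃ t' ≤ 8 * t, ∃ σ', Reaches P M t' σ σ' ∧ Sim N base M s' σ' ∧
        σ'.pc = p + (c.compile p).length := by
  induction h with
  | skip s => exact fun _ hσ hp => ⟨0, by simp, _, .refl (hσ.fitsIn hM), hσ, by simpa [Cmd.compile]⟩
  | const d c s hc =>
    intro p σ hP hσ hp
    have h' := hσ.setReg (σ.pc + 1) (d := d) hc
    exact ⟨1, by omega, _, Reaches.single (i := .const (d + 3) c) (by rw [hp]; exact hP.head) (hσ.fitsIn hM)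
      (h'.fitsIn hM), h', by simp [Instr.exec, hp, Cmd.compile]⟩
  | add d a b s hc =>
    intro p σ hP hσ hp
    have h' := hσ.setReg (σ.pc + 1) (d := d) hc
    simp only [← hσ.reg] at h' ⊢
    exact ⟨1, by omega, _, Reaches.single (i := .add (d + 3) (a + 3) (b + 3)) (by rw [hp]; exact hP.head) (hσ.fitsIn hM)
      (h'.fitsIn hM), h', by simp [Instr.exec, hp, Cmd.compile]⟩
  | sub d a b s =>
    intro p σ hP hσ hp
    have h' := hσ.setReg (σ.pc + 1) (d := d) ((Nat.sub_le _ _).trans (hσ.reg_le a) :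
      s.reg a - s.reg b ≤ N)
    simp only [← hσ.reg] at h' ⊢
    exact ⟨1, by omega, _, Reaches.single (i := .sub (d + 3) (a + 3) (b + 3)) (by rw [hp]; exact hP.head) (hσ.fitsIn hM)
      (h'.fitsIn hM), h', by simp [Instr.exec, hp, Cmd.compile]⟩
  | load d x i s =>
    intro p σ hP hσ hp
    obtain ⟨σ1, r1, h1, p1, e1, m1⟩ := reaches_addrCode hM hσ hp hP.left
    have h' := h1.setReg (σ1.pc + 1) (d := d) (h1.arr_le x (s.reg i))
    have e2 : σ1.mem (σ1.reg 1) = s.arr x (s.reg i) := by rw [e1, h1.arr]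
    rw [← e2] at h' ⊢
    -- Seven instructions for the address and one for the access are the worst case, whence the
    -- factor 8.
    exact ⟨7 + 1, by omega, _, r1.trans (Reaches.single (i := .load (d + 3) 1) (by rw [p1]; exact hP.right.head) (h1.fitsIn hM)
      (h'.fitsIn hM)), h', by simp [Instr.exec, p1, Cmd.compile, addrCode]⟩
  | store x i v s =>
    intro p σ hP hσ hp
    obtain ⟨σ1, r1, h1, p1, e1, m1⟩ := reaches_addrCode hM hσ hp hP.left
    have h' := h1.setArr (σ1.pc + 1) x (s.reg i) (h1.reg_le v)
    rw [← e1, ← h1.reg v] at h'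
    rw [← h1.reg v]
    exact ⟨7 + 1, by omega, _, r1.trans (Reaches.single (i := .store 1 (v + 3)) (by rw [p1]; exact hP.right.head) (h1.fitsIn hM)
      (h'.fitsIn hM)), h', by simp [Instr.exec, p1, Cmd.compile, addrCode]⟩
  | loadLow d i s hi =>
    intro p σ hP hσ hp
    have h' := hσ.setReg (σ.pc + 1) (d := d) (hσ.low_le (s.reg i))
    rw [← hσ.low _ hi, ← hσ.reg i] at h'
    rw [← hσ.low _ hi, ← hσ.reg i]
    exact ⟨1, by omega, _, Reaches.single (i := .load (d + 3) (i + 3)) (by rw [hp]; exact hP.head) (hσ.fitsIn hM)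
      (h'.fitsIn hM), h', by simp [Instr.exec, hp, Cmd.compile]⟩
  | storeLow i v s hi =>
    intro p σ hP hσ hp
    have h' := hσ.setLow (σ.pc + 1) hi (hσ.reg_le v)
    rw [← hσ.reg i, ← hσ.reg v] at h' ⊢
    exact ⟨1, by omega, _, Reaches.single (i := .store (i + 3) (v + 3)) (by rw [hp]; exact hP.head) (hσ.fitsIn hM)
      (h'.fitsIn hM), h', by simp [Instr.exec, hp, Cmd.compile]⟩
  | @seq c c' s t s' t' s'' _ _ ih1 ih2 =>
    intro p σ hP hσ hp
    obtain ⟨t1, ht1, σ1, r1, h1, p1⟩ := ih1 hP.left hσ hp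
    obtain ⟨t2, ht2, σ2, r2, h2, p2⟩ := ih2 hP.right h1 p1
    exact ⟨t1 + t2, by omega, σ2, r1.trans r2, h2, by rw [p2]; simp [Cmd.compile, add_assoc]⟩
  | @ifTrue a b c c' s t s' hab _ ih =>
    intro p σ hP hσ hp
    simp only [Cmd.compile] at hP ⊢
    set e := c'.compile (p + 1) with he
    have h0 := hσ.setPc (p + 1 + e.length + 1)
    have hr := Reaches.single (i := .jumpLt (a + 3) (b + 3) (p + 1 + e.length + 1))
      (by rw [hp]; exact hP.head) (hσ.fitsIn hM)
      (by simp only [Instr.exec, hσ.reg, hab, if_true]; exact h0.fitsIn hM)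
    simp only [Instr.exec, hσ.reg, hab, if_true] at hr
    obtain ⟨t1, ht1, σ1, r1, h1, p1⟩ := ih (p := p + 1 + e.length + 1) hP.tail.right.tail h0 rfl
    exact ⟨1 + t1, by omega, σ1, hr.trans r1, h1, by rw [p1]; simp; ring⟩
  | @ifFalse a b c c' s t s' hab _ ih =>
    intro p σ hP hσ hp
    simp only [Cmd.compile] at hP ⊢
    set e := c'.compile (p + 1) with he
    have h0 := hσ.setPc (p + 1)
    have hr := Reaches.single (i := .jumpLt (a + 3) (b + 3) (p + 1 + e.length + 1))
      (by rw [hp]; exact hP.head) (hσ.fitsIn hM)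
      (by simp only [Instr.exec, hσ.reg, hab, if_false, hp]; exact h0.fitsIn hM)
    simp only [Instr.exec, hσ.reg, hab, if_false, hp] at hr
    obtain ⟨t1, ht1, σ1, r1, h1, p1⟩ := ih (p := p + 1) hP.tail.left h0 rfl
    have h2 := h1.setPc (p + 1 + e.length + 1 + (c.compile (p + 1 + e.length + 1)).length)
    have hr' := Reaches.single (by rw [p1]; exact hP.tail.right.head) (h1.fitsIn hM)
      (by simp only [Instr.exec, if_true]; exact h2.fitsIn hM)
    simp only [Instr.exec, if_true] at hr'
    exact ⟨1 + t1 + 1, by omega, _, (hr.trans r1).trans hr', h2, by simp; ring⟩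
  | @whileTrue a b c s t s' t' s'' hab _ _ ih1 ih2 =>
    intro p σ hP hσ hp
    have hP' := hP
    simp only [Cmd.compile] at hP'
    set e := c.compile (p + 2) with he
    have h0 := hσ.setPc (p + 2)
    have hr := Reaches.single (i := .jumpLt (a + 3) (b + 3) (p + 2))
      (by rw [hp]; exact hP'.head) (hσ.fitsIn hM)
      (by simp only [Instr.exec, hσ.reg, hab, if_true]; exact h0.fitsIn hM)
    simp only [Instr.exec, hσ.reg, hab, if_true] at hr
    obtain ⟨t1, ht1, σ1, r1, h1, p1⟩ := ih1 (p := p + 2) hP'.tail.tail.left h0 rfl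
    have h2 := h1.setPc p
    have hr' := Reaches.single (by rw [p1]; exact hP'.tail.tail.right.head) (h1.fitsIn hM)
      (by simp only [Instr.exec, if_true]; exact h2.fitsIn hM)
    simp only [Instr.exec, if_true] at hr'
    obtain ⟨t2, ht2, σ2, r2, h3, p2⟩ := ih2 hP h2 rfl
    exact ⟨1 + t1 + 1 + t2, by omega, σ2, ((hr.trans r1).trans hr').trans r2, h3, p2⟩
  | @whileFalse a b c s hab =>
    intro p σ hP hσ hp
    simp only [Cmd.compile] at hP ⊢
    set e := c.compile (p + 2) with he
    have h0 := hσ.setPc (p + 1)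
    have hr := Reaches.single (i := .jumpLt (a + 3) (b + 3) (p + 2))
      (by rw [hp]; exact hP.head) (hσ.fitsIn hM)
      (by simp only [Instr.exec, hσ.reg, hab, if_false, hp]; exact h0.fitsIn hM)
    simp only [Instr.exec, hσ.reg, hab, if_false, hp] at hr
    have h2 := hσ.setPc (p + 2 + e.length + 1)
    have hr' := Reaches.single (σ := { σ with pc := p + 1 }) hP.tail.head (h0.fitsIn hM)
      (by simp only [Instr.exec, if_true]; exact h2.fitsIn hM)
    simp only [Instr.exec, if_true] at hr'
    exact ⟨1 + 1, by omega, _, hr.trans hr', h2, by simp; ring⟩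

end RAM

namespace RAM

/-! ### Reasoning about structured programs -/

/-- The program `c`, started in `s`, halts, and `Q` holds for its running time and final store. -/
def Wp (N base : ℕ) (c : Cmd) (s : Store) (Q : ℕ → Store → Prop) : Prop :=
  ∃ t s', Exec N base c s t s' ∧ Q t s'

variable {N base : ℕ} {s : Store} {Q Q' : ℕ → Store → Prop}

theorem Wp.mono {c : Cmd} (h : Wp N base c s Q) (hQ : ∀ t s', Q t s' → Q' t s') :
    Wp N base c s Q' :=
  let ⟨t, s', he, hq⟩ := h
  ⟨t, s', he, hQ t s' hq⟩

theorem wp_skip : Wp N base .skip s Q ↔ Q 0 s :=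
  ⟨fun ⟨_, _, h, hq⟩ => by cases h; exact hq, fun h => ⟨_, _, .skip s, h⟩⟩

theorem wp_const {d c : ℕ} : Wp N base (.const d c) s Q ↔ c ≤ N ∧ Q 1 (s.setReg d c) :=
  ⟨fun ⟨_, _, h, hq⟩ => by cases h; exact ⟨‹_›, hq⟩, fun h => ⟨_, _, .const d c s h.1, h.2⟩⟩

theorem wp_add {d a b : ℕ} : Wp N base (.add d a b) s Q ↔
    s.reg a + s.reg b ≤ N ∧ Q 1 (s.setReg d (s.reg a + s.reg b)) :=
  ⟨fun ⟨_, _, h, hq⟩ => by cases h; exact ⟨‹_›, hq⟩, fun h => ⟨_, _, .add d a b s h.1, h.2⟩⟩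

theorem wp_sub {d a b : ℕ} : Wp N base (.sub d a b) s Q ↔ Q 1 (s.setReg d (s.reg a - s.reg b)) :=
  ⟨fun ⟨_, _, h, hq⟩ => by cases h; exact hq, fun h => ⟨_, _, .sub d a b s, h⟩⟩

theorem wp_load {d : ℕ} {x : Fin 16} {i : ℕ} : Wp N base (.load d x i) s Q ↔
    Q 1 (s.setReg d (s.arr x (s.reg i))) :=
  ⟨fun ⟨_, _, h, hq⟩ => by cases h; exact hq, fun h => ⟨_, _, .load d x i s, h⟩⟩

theorem wp_store {x : Fin 16} {i v : ℕ} : Wp N base (.store x i v) s Q ↔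
    Q 1 (s.setArr x (s.reg i) (s.reg v)) :=
  ⟨fun ⟨_, _, h, hq⟩ => by cases h; exact hq, fun h => ⟨_, _, .store x i v s, h⟩⟩

theorem wp_loadLow {d i : ℕ} : Wp N base (.loadLow d i) s Q ↔
    s.reg i < base ∧ Q 1 (s.setReg d (s.low (s.reg i))) :=
  ⟨fun ⟨_, _, h, hq⟩ => by cases h; exact ⟨‹_›, hq⟩, fun h => ⟨_, _, .loadLow d i s h.1, h.2⟩⟩

theorem wp_storeLow {i v : ℕ} : Wp N base (.storeLow i v) s Q ↔
    s.reg i < base ∧ Q 1 (s.setLow (s.reg i) (s.reg v)) :=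
  ⟨fun ⟨_, _, h, hq⟩ => by cases h; exact ⟨‹_›, hq⟩, fun h => ⟨_, _, .storeLow i v s h.1, h.2⟩⟩

theorem wp_seq {c c' : Cmd} : Wp N base (.seq c c') s Q ↔
    Wp N base c s fun t s' => Wp N base c' s' fun t' s'' => Q (t + t') s'' :=
  ⟨fun ⟨_, _, h, hq⟩ => by cases h with | seq h1 h2 => exact ⟨_, _, h1, _, _, h2, hq⟩,
    fun ⟨_, _, h1, _, _, h2, hq⟩ => ⟨_, _, h1.seq h2, hq⟩⟩

theorem wp_ifLt {a b : ℕ} {c c' : Cmd} : Wp N base (.ifLt a b c c') s Q ↔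
    (s.reg a < s.reg b → Wp N base c s fun t s' => Q (t + 1) s') ∧
    (¬ s.reg a < s.reg b → Wp N base c' s fun t s' => Q (t + 1) s') := by
  constructor
  · rintro ⟨_, _, h, hq⟩
    cases h with
    | ifTrue h1 h2 => exact ⟨fun _ => ⟨_, _, h2, hq⟩, fun h => absurd h1 h⟩
    | ifFalse h1 h2 => exact ⟨fun h => absurd h h1, fun _ => ⟨_, _, h2, hq⟩⟩
  · rintro ⟨h1, h2⟩
    by_cases hab : s.reg a < s.reg b
    · obtain ⟨t, s', he, hq⟩ := h1 hab
      exact ⟨_, _, .ifTrue hab he, hq⟩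
    · obtain ⟨t, s', he, hq⟩ := h2 hab
      exact ⟨_, _, .ifFalse hab he, hq⟩

/-- A loop with an invariant that is indexed by a bound for the remaining number of iterations. -/
theorem wp_while {a b : ℕ} {c : Cmd} (I : ℕ → Store → Prop) (K m : ℕ) (hI : I m s)
    (hc : ∀ m s, I m s → s.reg a < s.reg b →
      Wp N base c s fun t s' => t ≤ K ∧ ∃ m' < m, I m' s')
    (hQ : ∀ t s' m', t ≤ m * (K + 1) + 1 → I m' s' → ¬ s'.reg a < s'.reg b → Q t s') :
    Wp N base (.whileLt a b c) s Q := by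
  induction m using Nat.strong_induction_on generalizing s Q with
  | _ m ih =>
  by_cases hab : s.reg a < s.reg b
  · obtain ⟨t, s', he, ht, m', hm', hI'⟩ := hc m s hI hab
    obtain ⟨t', s'', he', hq⟩ := ih m' hm' (Q := fun t' s'' => Q (t + t' + 1) s'') hI'
      fun t' s'' m'' ht' hI'' hn => hQ _ _ m'' (by nlinarith) hI'' hn
    exact ⟨_, _, .whileTrue hab he he', hq⟩
  · exact ⟨_, _, .whileFalse hab, hQ _ _ m (by omega) hI hab⟩

/-! ### Frame conditions -/

/-- The registers that a program may change. -/
def Cmd.regs : Cmd → List ℕ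
  | .const d _ | .add d _ _ | .sub d _ _ | .load d _ _ | .loadLow d _ => [d]
  | .seq c c' | .ifLt _ _ c c' => c.regs ++ c'.regs
  | .whileLt _ _ c => c.regs
  | _ => []

/-- The arrays that a program may change. -/
def Cmd.arrs : Cmd → List (Fin 16)
  | .store x _ _ => [x]
  | .seq c c' | .ifLt _ _ c c' => c.arrs ++ c'.arrs
  | .whileLt _ _ c => c.arrs
  | _ => []

/-- Whether a program may change the lower part of the memory. -/
def Cmd.changesLow : Cmd → Bool
  | .storeLow _ _ => true
  | .seq c c' | .ifLt _ _ c c' => c.changesLow || c'.changesLow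
  | .whileLt _ _ c => c.changesLow
  | _ => false

/-- `c` changes only what it may change. -/
structure Frame (c : Cmd) (s s' : Store) : Prop where
  reg : ∀ r, r ∉ c.regs → s'.reg r = s.reg r
  arr : ∀ x, x ∉ c.arrs → s'.arr x = s.arr x
  low : c.changesLow = false → s'.low = s.low

/-- What a program may change is read off its syntax, so later `by decide` shows that a register or
an array survives a whole subprogram. -/
theorem Exec.frame {c : Cmd} {t : ℕ} {s' : Store} (h : Exec N base c s t s') : Frame c s s' := by
  induction h with
  | skip | whileFalse => exact ⟨fun _ _ => rfl, fun _ _ => rfl, fun _ => rfl⟩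
  | const | add | sub | load | loadLow =>
    exact ⟨fun r hr => by simp_all [Cmd.regs, Store.setReg], fun _ _ => rfl, fun _ => rfl⟩
  | store =>
    exact ⟨fun _ _ => rfl, fun r hr => by simp_all [Cmd.arrs, Store.setArr], fun _ => rfl⟩
  | storeLow => exact ⟨fun _ _ => rfl, fun _ _ => rfl, fun h => by simp [Cmd.changesLow] at h⟩
  | seq _ _ h1 h2 =>
    exact ⟨fun r hr => by simp_all [Cmd.regs, h1.reg, h2.reg],
      fun x hx => by simp_all [Cmd.arrs, h1.arr, h2.arr],
      fun h => by simp_all [Cmd.changesLow, h1.low, h2.low]⟩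
  | ifTrue _ _ h1 | ifFalse _ _ h1 =>
    exact ⟨fun r hr => by simp_all [Cmd.regs, h1.reg],
      fun x hx => by simp_all [Cmd.arrs, h1.arr], fun h => by simp_all [Cmd.changesLow, h1.low]⟩
  | whileTrue _ _ _ h1 h2 =>
    exact ⟨fun r hr => (h2.reg r hr).trans (h1.reg r hr), fun r hr => (h2.arr r hr).trans (h1.arr r hr),
      fun h => (h2.low h).trans (h1.low h)⟩

theorem Wp.frame {c : Cmd} (h : Wp N base c s Q) :
    Wp N base c s fun t s' => Q t s' ∧ Frame c s s' :=
  let ⟨t, s', he, hq⟩ := h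
  ⟨t, s', he, hq, he.frame⟩

theorem Frame.refl (c : Cmd) (s : Store) : Frame c s s :=
  ⟨fun _ _ => rfl, fun _ _ => rfl, fun _ => rfl⟩

theorem Frame.trans {c : Cmd} {s s' s'' : Store} (h : Frame c s s') (h' : Frame c s' s'') :
    Frame c s s'' :=
  ⟨fun r hr => (h'.reg r hr).trans (h.reg r hr), fun x hx => (h'.arr x hx).trans (h.arr x hx),
    fun hl => (h'.low hl).trans (h.low hl)⟩

/-- A loop whose counter, the register `a`, runs from `i₀` to `i₀ + m`. -/
theorem wp_for {a b : ℕ} {c : Cmd} (I : ℕ → Store → Prop) (K : ℕ → ℕ) (i₀ m : ℕ)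
    (hb : b ∉ c.regs) (ha₀ : s.reg a = i₀) (hb₀ : s.reg b = i₀ + m) (hI : I 0 s)
    (hc : ∀ i < m, ∀ s', Frame c s s' → s'.reg a = i₀ + i → I i s' →
      Wp N base c s' fun t s'' => t ≤ K i ∧ s''.reg a = i₀ + (i + 1) ∧ I (i + 1) s'')
    (hQ : ∀ t s', t ≤ ∑ i ∈ Finset.range m, (K i + 1) + 1 → Frame c s s' → s'.reg a = i₀ + m →
      I m s' → Q t s') :
    Wp N base (.whileLt a b c) s Q := by
  have key : ∀ l i s', i + l = m → Frame c s s' → s'.reg a = i₀ + i → I i s' →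
      Wp N base (.whileLt a b c) s' fun t s'' => t ≤ ∑ j ∈ Finset.Ico i m, (K j + 1) + 1 ∧
        Frame c s s'' ∧ s''.reg a = i₀ + m ∧ I m s'' := by
    intro l
    induction l with
    | zero =>
      intro i s' hi hF ha hI
      obtain rfl : i = m := by omega
      have h2 := hF.reg b hb
      exact ⟨_, _, .whileFalse (by omega), by simp, hF, ha, hI⟩
    | succ l ih =>
      intro i s' hi hF ha hI
      have h2 := hF.reg b hb
      obtain ⟨t, s'', he, ht, ha', hI'⟩ := hc i (by omega) s' hF ha hI
      obtain ⟨t', s₃, he', ht', hF', hI''⟩ := ih (i + 1) s'' (by omega) (hF.trans he.frame) ha' hI'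
      refine ⟨_, _, .whileTrue (by omega) he he', ?_, hF', hI''⟩
      rw [Finset.sum_eq_sum_Ico_succ_bot (by omega)]
      omega
  refine (key m 0 s (by omega) (.refl c s) ha₀ hI).mono fun t s' h => hQ t s' ?_ h.2.1 h.2.2.1 h.2.2.2
  rw [Finset.range_eq_Ico]
  exact h.1

theorem Store.setReg_reg (d v r : ℕ) : (s.setReg d v).reg r = if r = d then v else s.reg r := by
  simp [Store.setReg, Function.update_apply]

theorem Store.setReg_arr (d v : ℕ) : (s.setReg d v).arr = s.arr := rfl

theorem Store.setReg_low (d v : ℕ) : (s.setReg d v).low = s.low := rfl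

theorem Store.setArr_reg (x : Fin 16) (i v : ℕ) : (s.setArr x i v).reg = s.reg := rfl

theorem Store.setArr_low (x : Fin 16) (i v : ℕ) : (s.setArr x i v).low = s.low := rfl

theorem Store.setArr_arr (x y : Fin 16) (i j v : ℕ) :
    (s.setArr x i v).arr y j = if y = x ∧ j = i then v else s.arr y j := by
  by_cases hy : y = x
  · subst hy; simp [Store.setArr, Function.update_apply]
  · simp [Store.setArr, hy]

theorem Store.setLow_reg (i v : ℕ) : (s.setLow i v).reg = s.reg := rfl

theorem Store.setLow_arr (i v : ℕ) : (s.setLow i v).arr = s.arr := rfl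

theorem Store.setLow_low (i v j : ℕ) : (s.setLow i v).low j = if j = i then v else s.low j := by
  simp [Store.setLow, Function.update_apply]

attribute [simp] wp_skip wp_const wp_add wp_sub wp_load wp_store wp_loadLow wp_storeLow wp_seq
  wp_ifLt Store.setReg_reg Store.setReg_arr Store.setReg_low Store.setArr_reg Store.setArr_low
  Store.setArr_arr Store.setLow_reg Store.setLow_arr Store.setLow_low

infixr:60 " ;; " => Cmd.seq

end RAM

section

open Finset

namespace DomSearch

/-! ### The search tree -/

/-- `cl v` lists the closed neighbourhood of `v`, for each vertex `v < n` of a graph. -/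
structure ClosedLists (n : ℕ) (cl : ℕ → List ℕ) : Prop where
  nodup : ∀ v < n, (cl v).Nodup
  lt : ∀ v < n, ∀ x ∈ cl v, x < n
  self : ∀ v < n, v ∈ cl v
  symm : ∀ v < n, ∀ x ∈ cl v, v ∈ cl x

variable {n : ℕ} {cl : ℕ → List ℕ}

/-- At most `k` vertices suffice to dominate `S`. -/
def Sol (n : ℕ) (cl : ℕ → List ℕ) (S : Finset ℕ) (k : ℕ) : Prop :=
  ∃ U : Finset ℕ, U ⊆ range n ∧ #U ≤ k ∧ ∀ b ∈ S, ∃ u ∈ U, u ∈ cl b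

/-- The part of `S` that `x` dominates. -/
def sig (cl : ℕ → List ℕ) (S : Finset ℕ) (x : ℕ) : Finset ℕ := S.filter fun b => x ∈ cl b

theorem mem_sig {S : Finset ℕ} {x b : ℕ} : b ∈ sig cl S x ↔ b ∈ S ∧ x ∈ cl b := mem_filter

/-- `x` is the first vertex that dominates just this part of `S`. -/
def IsRep (cl : ℕ → List ℕ) (S : Finset ℕ) (x : ℕ) : Prop := ∀ y < x, sig cl S y ≠ sig cl S x

instance (cl : ℕ → List ℕ) (S : Finset ℕ) : DecidablePred (IsRep cl S) := fun x =>
  inferInstanceAs (Decidable (∀ y < x, sig cl S y ≠ sig cl S x))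

/-- The candidates for dominating `b`. -/
def cands (cl : ℕ → List ℕ) (S : Finset ℕ) (b : ℕ) : List ℕ := (cl b).filter (IsRep cl S)

theorem mem_cands {S : Finset ℕ} {b x : ℕ} : x ∈ cands cl S b ↔ x ∈ cl b ∧ IsRep cl S x := by
  simp [cands]

/-- `b` is the first vertex of `S` with the least number of candidates. -/
def IsPick (cl : ℕ → List ℕ) (S : Finset ℕ) (b : ℕ) : Prop :=
  b ∈ S ∧ ∀ b' ∈ S, (cands cl S b).length < (cands cl S b').length ∨
    (cands cl S b).length = (cands cl S b').length ∧ b ≤ b'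

/-- Ties are broken in favour of the smaller vertex. A scan in increasing order that replaces its
choice only upon strict improvement therefore finds exactly `pick`. -/
theorem IsPick.unique {S : Finset ℕ} {b b' : ℕ} (h : IsPick cl S b) (h' : IsPick cl S b') :
    b = b' := by
  have h1 := h.2 b' h'.1
  have h2 := h'.2 b h.1
  omega

theorem exists_isPick {S : Finset ℕ} (hS : S.Nonempty) : ∃ b, IsPick cl S b := by
  obtain ⟨b, hb, hmin⟩ := exists_min_image S (fun b => toLex ((cands cl S b).length, b)) hS
  exact ⟨b, hb, fun b' hb' => by simpa [Prod.Lex.toLex_le_toLex] using hmin b' hb'⟩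

open scoped Classical in
/-- The vertex of `S` on which the search branches. -/
noncomputable def pick (cl : ℕ → List ℕ) (S : Finset ℕ) : ℕ :=
  if h : ∃ b, IsPick cl S b then h.choose else 0

theorem isPick_pick {S : Finset ℕ} (hS : S.Nonempty) : IsPick cl S (pick cl S) := by
  rw [pick, dif_pos (exists_isPick hS)]
  exact (exists_isPick hS).choose_spec

/-- The number of branches. -/
noncomputable def deg (cl : ℕ → List ℕ) (S : Finset ℕ) : ℕ := (cands cl S (pick cl S)).length

/-- The vertex that is chosen in the branch `i`. -/
noncomputable def cand (cl : ℕ → List ℕ) (S : Finset ℕ) (i : ℕ) : ℕ :=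
  (cands cl S (pick cl S)).getD i 0

/-- What remains to be dominated in the branch `i`. -/
noncomputable def child (cl : ℕ → List ℕ) (S : Finset ℕ) (i : ℕ) : Finset ℕ :=
  S.filter fun b => cand cl S i ∉ cl b

theorem child_subset (S : Finset ℕ) (i : ℕ) : child cl S i ⊆ S := filter_subset _ _

theorem cand_mem {S : Finset ℕ} {i : ℕ} (hi : i < deg cl S) :
    cand cl S i ∈ cands cl S (pick cl S) := by
  rw [cand, List.getD_eq_getElem _ _ hi]
  exact List.getElem_mem hi

theorem card_child_lt {S : Finset ℕ} (hS : S.Nonempty) {i : ℕ} (hi : i < deg cl S) :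
    #(child cl S i) < #S :=
  card_lt_card (filter_ssubset.2 ⟨_, (isPick_pick hS).1, not_not.2 (mem_cands.1 (cand_mem hi)).1⟩)

theorem exists_rep (S : Finset ℕ) (u : ℕ) : ∃ r ≤ u, sig cl S r = sig cl S u ∧ IsRep cl S r := by
  have hex : ∃ r, sig cl S r = sig cl S u := ⟨u, rfl⟩
  refine ⟨Nat.find hex, Nat.find_min' hex rfl, Nat.find_spec hex, fun y hy h => ?_⟩
  exact Nat.find_min hex hy (h.trans (Nat.find_spec hex))

/-- The representative of the class of `u` has the same trace, so it dominates `pick cl S` as well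
and is one of the candidates. -/
theorem exists_cand {S : Finset ℕ} (hS : S.Nonempty) {u : ℕ} (hu : u ∈ cl (pick cl S)) :
    ∃ i < deg cl S, sig cl S (cand cl S i) = sig cl S u := by
  obtain ⟨r, _, hr, hrep⟩ := exists_rep (cl := cl) S u
  have hb := (isPick_pick (cl := cl) hS).1
  have h1 : pick cl S ∈ sig cl S r := by rw [hr]; exact mem_sig.2 ⟨hb, hu⟩
  obtain ⟨i, hi, he⟩ := List.mem_iff_getElem.1 (mem_cands.2 ⟨(mem_sig.1 h1).2, hrep⟩)
  exact ⟨i, hi, by rw [cand, List.getD_eq_getElem _ _ hi, he, hr]⟩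

theorem deg_pos (hcl : ClosedLists n cl) {S : Finset ℕ} (hSn : S ⊆ range n) (hS : S.Nonempty) :
    0 < deg cl S := by
  have hb := (isPick_pick (cl := cl) hS).1
  obtain ⟨i, hi, _⟩ := exists_cand hS (hcl.self _ (mem_range.1 (hSn hb)))
  omega

theorem sol_of_empty (k : ℕ) : Sol n cl ∅ k := ⟨∅, by simp, by simp, by simp⟩

theorem sol_zero {S : Finset ℕ} : Sol n cl S 0 ↔ S = ∅ := by
  refine ⟨fun ⟨U, _, hU, hd⟩ => ?_, fun h => h ▸ sol_of_empty 0⟩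
  rw [Nat.le_zero, card_eq_zero] at hU
  subst hU
  exact eq_empty_of_forall_notMem fun b hb => by simpa using hd b hb

/-- Correctness of the branching. Some `u` of a solution dominates the picked vertex. A candidate
with the same trace dominates the same part of `S`, so what it leaves over is dominated by the
solution without `u`. -/
theorem sol_succ (hcl : ClosedLists n cl) {S : Finset ℕ} (hSn : S ⊆ range n) (hS : S.Nonempty)
    {k : ℕ} : Sol n cl S (k + 1) ↔ ∃ i < deg cl S, Sol n cl (child cl S i) k := by
  have hb := (isPick_pick (cl := cl) hS).1
  constructor
  · rintro ⟨U, hUn, hUc, hU⟩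
    obtain ⟨u, huU, hu⟩ := hU _ hb
    obtain ⟨i, hi, hsig⟩ := exists_cand hS hu
    refine ⟨i, hi, U.erase u, (erase_subset _ _).trans hUn, ?_, fun b hb => ?_⟩
    · rw [card_erase_of_mem huU]; omega
    · obtain ⟨hbS, hbn⟩ := mem_filter.1 hb
      obtain ⟨v, hvU, hv⟩ := hU b hbS
      refine ⟨v, mem_erase.2 ⟨?_, hvU⟩, hv⟩
      rintro rfl
      have : b ∈ sig cl S v := mem_sig.2 ⟨hbS, hv⟩
      rw [← hsig] at this
      exact hbn (mem_sig.1 this).2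
  · rintro ⟨i, hi, U, hUn, hUc, hU⟩
    have hc := (mem_cands.1 (cand_mem hi)).1
    refine ⟨insert (cand cl S i) U, insert_subset (mem_range.2 ?_) hUn,
      (card_insert_le _ _).trans (by omega), fun b hbS => ?_⟩
    · exact hcl.lt _ (mem_range.1 (hSn hb)) _ hc
    · by_cases h : cand cl S i ∈ cl b
      · exact ⟨_, mem_insert_self _ _, h⟩
      · obtain ⟨u, hu, h⟩ := hU b (mem_filter.2 ⟨hbS, h⟩)
        exact ⟨u, mem_insert_of_mem hu, h⟩

/-- What remains to be dominated after following the path `f` for `j` levels. -/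
noncomputable def sub (cl : ℕ → List ℕ) (S : Finset ℕ) (f : ℕ → ℕ) : ℕ → Finset ℕ
  | 0 => S
  | j + 1 => child cl (sub cl S f j) (f j)

theorem sub_succ' (S : Finset ℕ) (f : ℕ → ℕ) (j : ℕ) :
    sub cl S f (j + 1) = sub cl (child cl S (f 0)) (fun i => f (i + 1)) j := by
  induction j with
  | zero => rfl
  | succ j ih => rw [sub, ih]; rfl

theorem sub_subset (S : Finset ℕ) (f : ℕ → ℕ) (j : ℕ) : sub cl S f j ⊆ S := by
  induction j with
  | zero => exact subset_rfl
  | succ j ih => exact (child_subset _ _).trans ih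

theorem sub_congr (S : Finset ℕ) {f g : ℕ → ℕ} {j : ℕ} (h : ∀ i < j, f i = g i) :
    sub cl S f j = sub cl S g j := by
  induction j with
  | zero => rfl
  | succ j ih => rw [sub, sub, ih fun i hi => h i (by omega), h j (by omega)]

/-- The part of the search tree that the search has not seen when it is at the path `f` contains a
solution. -/
def Rem (n : ℕ) (cl : ℕ → List ℕ) : ℕ → Finset ℕ → (ℕ → ℕ) → Prop
  | 0, S, _ => S = ∅
  | k + 1, S, f => S = ∅ ∨ Rem n cl k (child cl S (f 0)) (fun i => f (i + 1)) ∨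
      ∃ i, f 0 < i ∧ i < deg cl S ∧ Sol n cl (child cl S i) k

/-- A bound for the number of paths that the search has not seen when it is at the path `f`. -/
noncomputable def rest (cl : ℕ → List ℕ) (D : ℕ) : ℕ → Finset ℕ → (ℕ → ℕ) → ℕ
  | 0, _, _ => 1
  | k + 1, S, f => rest cl D k (child cl S (f 0)) (fun i => f (i + 1)) +
      (min (deg cl S) D - 1 - f 0) * D ^ k

theorem rest_pos (D k : ℕ) (S : Finset ℕ) (f : ℕ → ℕ) : 0 < rest cl D k S f := by
  induction k generalizing S f with
  | zero => exact one_pos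
  | succ k ih => exact (ih _ _).trans_le (Nat.le_add_right _ _)

/-- The minimum with `D` in `rest` makes this true without any bound on `deg`. Such a bound is
needed only for `rest_incr_lt`. -/
theorem rest_le {D : ℕ} (hD : 0 < D) (k : ℕ) (S : Finset ℕ) (f : ℕ → ℕ) :
    rest cl D k S f ≤ D ^ k := by
  induction k generalizing S f with
  | zero => simp [rest]
  | succ k ih =>
    calc rest cl D (k + 1) S f ≤ D ^ k + (D - 1) * D ^ k :=
          Nat.add_le_add (ih _ _) (Nat.mul_le_mul_right _ (by omega))
      _ = (D - 1 + 1) * D ^ k := by ring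
      _ = D ^ (k + 1) := by rw [Nat.sub_add_cancel hD]; ring

theorem rem_zero (hcl : ClosedLists n cl) (k : ℕ) {S : Finset ℕ} (hSn : S ⊆ range n) :
    Rem n cl k S (fun _ => 0) ↔ Sol n cl S k := by
  induction k generalizing S with
  | zero => rw [Rem, sol_zero]
  | succ k ih =>
    rcases S.eq_empty_or_nonempty with rfl | hS
    · simp [Rem, sol_of_empty]
    · rw [Rem, ih ((child_subset _ _).trans hSn), sol_succ hcl hSn hS]
      have h0 := deg_pos hcl hSn hS
      constructor
      · rintro (h | h | ⟨i, _, hi, h⟩)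
        · exact absurd h hS.ne_empty
        · exact ⟨0, h0, h⟩
        · exact ⟨i, hi, h⟩
      · rintro ⟨i, hi, h⟩
        rcases Nat.eq_zero_or_pos i with rfl | hi0
        · exact Or.inr (Or.inl h)
        · exact Or.inr (Or.inr ⟨i, hi0, hi, h⟩)

theorem not_rem_of_last {k : ℕ} {S : Finset ℕ} {f : ℕ → ℕ}
    (hne : ∀ j ≤ k, (sub cl S f j).Nonempty) (hlast : ∀ j < k, deg cl (sub cl S f j) ≤ f j + 1) :
    ¬ Rem n cl k S f := by
  induction k generalizing S f with
  | zero => exact (hne 0 le_rfl).ne_empty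
  | succ k ih =>
    rintro (h | h | ⟨i, h0, hi, _⟩)
    · exact (hne 0 (by omega)).ne_empty h
    · refine ih (fun j hj => ?_) (fun j hj => ?_) h
      · rw [← sub_succ']; exact hne (j + 1) (by omega)
      · rw [← sub_succ']; exact hlast (j + 1) (by omega)
    · have := hlast 0 (by omega)
      simp only [sub] at this
      omega

/-- The path that follows `f` in lexicographic order and differs from it at `p` first. -/
def incr (f : ℕ → ℕ) (p : ℕ) : ℕ → ℕ := fun q => if q < p then f q else if q = p then f p + 1 else 0

/-- The path `f` ends without success and takes the last branch at every level beyond `p`, so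
nothing unseen remains below its choice at `p`. The unseen part starts at the next branch of level
`p`, with first choices below it. -/
theorem rem_incr (hcl : ClosedLists n cl) {k p : ℕ} {S : Finset ℕ} {f : ℕ → ℕ} (hSn : S ⊆ range n)
    (hne : ∀ j ≤ k, (sub cl S f j).Nonempty) (hpk : p < k)
    (hlast : ∀ j < k, p < j → deg cl (sub cl S f j) ≤ f j + 1)
    (hp : f p + 1 < deg cl (sub cl S f p)) :
    (Rem n cl k S (incr f p) ↔ Rem n cl k S f) := by
  induction k generalizing S f p with
  | zero => omega
  | succ k ih =>
    have hS := hne 0 (by omega)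
    cases p with
    | zero =>
      have hno : ¬ Rem n cl k (child cl S (f 0)) (fun i => f (i + 1)) := by
        refine not_rem_of_last (fun j hj => ?_) (fun j hj => ?_)
        · rw [← sub_succ']; exact hne (j + 1) (by omega)
        · rw [← sub_succ']; exact hlast (j + 1) (by omega) (by omega)
      have e1 : incr f 0 0 = f 0 + 1 := by simp [incr]
      have e2 : (fun i => incr f 0 (i + 1)) = fun _ => 0 := by funext i; simp [incr]
      rw [Rem, Rem, e1, e2, rem_zero hcl _ ((child_subset _ _).trans hSn)]
      simp only [sub] at hp hS
      simp only [hS.ne_empty, hno, false_or]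
      constructor
      · rintro (h | ⟨i, h1, h2, h3⟩)
        · exact ⟨_, by omega, hp, h⟩
        · exact ⟨i, by omega, h2, h3⟩
      · rintro ⟨i, h1, h2, h3⟩
        rcases Nat.eq_or_lt_of_le h1 with rfl | h1
        · exact Or.inl h3
        · exact Or.inr ⟨i, h1, h2, h3⟩
    | succ p =>
      have e1 : incr f (p + 1) 0 = f 0 := by simp [incr]
      have e2 : (fun i => incr f (p + 1) (i + 1)) = incr (fun i => f (i + 1)) p := by
        funext i; simp [incr]
      rw [Rem, Rem, e1, e2, ih ((child_subset _ _).trans hSn) (fun j hj => ?_) (by omega)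
        (fun j hj hpj => ?_)]
      · rw [← sub_succ']; exact hp
      · rw [← sub_succ']; exact hne (j + 1) (by omega)
      · rw [← sub_succ']; exact hlast (j + 1) (by omega) (by omega)

/-- At level `p` one full summand `D ^ _` is given up. The fresh subtree counts at most that much by
`rest_le`, while the abandoned one counted at least 1. This is the termination measure of the
search. -/
theorem rest_incr_lt {D k p : ℕ} {S : Finset ℕ} {f : ℕ → ℕ} (hSn : S ⊆ range n)
    (hD : ∀ S ⊆ range n, S.Nonempty → deg cl S ≤ D)
    (hne : ∀ j ≤ k, (sub cl S f j).Nonempty) (hpk : p < k)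
    (hp : f p + 1 < deg cl (sub cl S f p)) :
    rest cl D k S (incr f p) < rest cl D k S f := by
  induction k generalizing S f p with
  | zero => omega
  | succ k ih =>
    have hS := hne 0 (by omega)
    cases p with
    | zero =>
      have e1 : incr f 0 0 = f 0 + 1 := by simp [incr]
      simp only [sub] at hp hS
      have hDS := hD S hSn hS
      have h1 := rest_pos (cl := cl) D k (child cl S (f 0)) (fun i => f (i + 1))
      have h2 := rest_le (cl := cl) (D := D) (by omega) k (child cl S (f 0 + 1))
        (fun i => incr f 0 (i + 1))
      rw [rest, rest, e1, min_eq_left hDS]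
      obtain ⟨a, ha⟩ : ∃ a, deg cl S - 1 - f 0 = a + 1 := ⟨deg cl S - 1 - f 0 - 1, by omega⟩
      have hb : deg cl S - 1 - (f 0 + 1) = a := by omega
      rw [ha, hb, add_mul]
      omega
    | succ p =>
      have e1 : incr f (p + 1) 0 = f 0 := by simp [incr]
      have e2 : (fun i => incr f (p + 1) (i + 1)) = incr (fun i => f (i + 1)) p := by
        funext i; simp [incr]
      rw [rest, rest, e1, e2]
      have := ih (S := child cl S (f 0)) (f := fun i => f (i + 1)) (p := p)
        ((child_subset _ _).trans hSn) (fun j hj => by rw [← sub_succ']; exact hne (j + 1) (by omega))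
        (by omega) (by rw [← sub_succ']; exact hp)
      omega

/-- All choices along the path `f` exist. -/
def Valid (cl : ℕ → List ℕ) (k : ℕ) (S : Finset ℕ) (f : ℕ → ℕ) : Prop :=
  ∀ j < k, (sub cl S f j).Nonempty → f j < deg cl (sub cl S f j)

theorem valid_zero (hcl : ClosedLists n cl) {k : ℕ} {S : Finset ℕ} (hSn : S ⊆ range n) :
    Valid cl k S fun _ => 0 :=
  fun _ _ hS => deg_pos hcl ((sub_subset _ _ _).trans hSn) hS

theorem Valid.incr (hcl : ClosedLists n cl) {k p : ℕ} {S : Finset ℕ} {f : ℕ → ℕ}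
    (hv : Valid cl k S f) (hSn : S ⊆ range n) (hp : f p + 1 < deg cl (sub cl S f p)) :
    Valid cl k S (incr f p) := by
  intro j hj hne
  rcases lt_trichotomy j p with h | rfl | h
  · have e : sub cl S (DomSearch.incr f p) j = sub cl S f j :=
      sub_congr S fun i hi => by simp [DomSearch.incr, hi.trans h]
    rw [e] at hne ⊢
    simpa [DomSearch.incr, h] using hv j hj hne
  · have e : sub cl S (DomSearch.incr f j) j = sub cl S f j :=
      sub_congr S fun i hi => by simp [DomSearch.incr, hi]
    rw [e]
    simpa [DomSearch.incr] using hp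
  · have := deg_pos hcl ((sub_subset (cl := cl) _ _ _).trans hSn) hne
    simpa [DomSearch.incr, show ¬ j < p by omega, show j ≠ p by omega] using this

/-- Each choice dominates at least the picked vertex, so every level shrinks the set. A path
therefore has fewer than `n` levels before a further choice, even if `k` is large. -/
theorem card_sub_add_le {k : ℕ} {S : Finset ℕ} {f : ℕ → ℕ} (hv : Valid cl k S f) {j : ℕ} (hj : j ≤ k)
    (hne : ∀ i < j, (sub cl S f i).Nonempty) : #(sub cl S f j) + j ≤ #S := by
  induction j with
  | zero => simp [sub]
  | succ j ih =>
    have h1 := ih (by omega) fun i hi => hne i (by omega)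
    have h2 := card_child_lt (hne j (by omega)) (hv j (by omega) (hne j (by omega)))
    rw [sub]
    omega

/-- The vertices chosen along a path. -/
noncomputable def chosen (cl : ℕ → List ℕ) (S : Finset ℕ) (f : ℕ → ℕ) (j : ℕ) : List ℕ :=
  (List.range j).map fun i => cand cl (sub cl S f i) (f i)

theorem exists_chosen_of_notMem_sub {S : Finset ℕ} {f : ℕ → ℕ} {j b : ℕ} (hb : b ∈ S)
    (hb' : b ∉ sub cl S f j) : ∃ u ∈ chosen cl S f j, u ∈ cl b := by
  induction j with
  | zero => exact absurd hb hb'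
  | succ j ih =>
    by_cases h : b ∈ sub cl S f j
    · refine ⟨cand cl (sub cl S f j) (f j), by simp [chosen, List.range_succ], ?_⟩
      by_contra hc
      exact hb' (mem_filter.2 ⟨h, hc⟩)
    · obtain ⟨u, hu, h⟩ := ih h
      refine ⟨u, ?_, h⟩
      simp only [chosen, List.range_succ, List.map_append, List.mem_append] at hu ⊢
      exact Or.inl hu

/-- What is left over is dominated by no earlier choice. A later choice dominates a vertex that was
left over, so it differs from all earlier ones and the output list has no repetition. -/
theorem notMem_cl_of_mem_chosen {S : Finset ℕ} {f : ℕ → ℕ} {j b u : ℕ} (hb : b ∈ sub cl S f j)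
    (hu : u ∈ chosen cl S f j) : u ∉ cl b := by
  induction j with
  | zero => simp [chosen] at hu
  | succ j ih =>
    obtain ⟨h1, h2⟩ := mem_filter.1 hb
    simp only [chosen, List.range_succ, List.map_append, List.mem_append, List.map_cons, List.map_nil,
      List.mem_singleton] at hu
    rcases hu with hu | rfl
    · exact ih h1 hu
    · exact h2

theorem chosen_spec (hcl : ClosedLists n cl) {k : ℕ} {S : Finset ℕ} {f : ℕ → ℕ} (hSn : S ⊆ range n)
    (hv : Valid cl k S f) {j : ℕ} (hj : j ≤ k) (hne : ∀ i < j, (sub cl S f i).Nonempty) :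
    (chosen cl S f j).Nodup ∧ ∀ u ∈ chosen cl S f j, u < n := by
  induction j with
  | zero => simp [chosen]
  | succ j ih =>
    obtain ⟨h1, h2⟩ := ih (by omega) fun i hi => hne i (by omega)
    have hS := hne j (by omega)
    have hp := (isPick_pick (cl := cl) hS).1
    have hc := (mem_cands.1 (cand_mem (hv j (by omega) hS))).1
    have e : chosen cl S f (j + 1) = chosen cl S f j ++ [cand cl (sub cl S f j) (f j)] := by
      simp [chosen, List.range_succ]
    rw [e]
    constructor
    · refine List.nodup_append.2 ⟨h1, by simp, ?_⟩
      rintro u hu _ hu' rfl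
      rw [List.mem_singleton.1 hu'] at hu
      exact notMem_cl_of_mem_chosen hp hu hc
    · intro u hu
      rcases List.mem_append.1 hu with hu | hu
      · exact h2 u hu
      · rw [List.mem_singleton.1 hu]
        exact hcl.lt _ (mem_range.1 (hSn (sub_subset _ _ _ hp))) _ hc

end DomSearch

end

section

open Finset

namespace DomSearch

open RAM

/-! ### The program

Registers: `0` and `1` hold the numbers `n` and `k`, `2` and `3` the constants `0` and `1`, `4` a
vertex, `5` and `6` the ends of an interval of addresses, `9` the level in the search tree, `10` the
number of vertices still to be dominated, `12` the number of classes of vertices, `13` the least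
number of candidates, `14` the chosen vertex, `18` whether the search goes on, `19` whether it was
successful. Arrays: `0` the addresses of the adjacency lists, `1` the colours, `2` the current path,
`3` the numbers of branches along it, `4` the vertices still to be dominated, `5` the classes of the
vertices, `6` and `7` the successors of classes in a refinement and the times of their creation, `8`
whether a class has a representative, `9` the representatives. -/

/-- Run through the closed neighbourhood of the vertex in the register `v`. -/
def scan (v : ℕ) (body : Cmd) : Cmd :=
  .load 5 0 v ;; .add 7 v 3 ;; .load 6 0 7 ;;
  .whileLt 5 6 (.loadLow 7 5 ;; body ;; .add 5 5 3)

/-- Run through all vertices. -/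
def forVertices (body : Cmd) : Cmd :=
  .const 4 0 ;; .whileLt 4 0 (body ;; .add 4 4 3)

/-- Read the input. -/
def prelude : Cmd :=
  .const 2 0 ;; .const 3 1 ;; .loadLow 0 2 ;; .loadLow 1 3 ;; .const 5 2 ;;
  forVertices (.loadLow 7 5 ;; .store 1 4 7 ;; .add 5 5 3) ;;
  -- The degree of each vertex is overwritten by the vertex itself, which turns the stored adjacency
  -- lists into lists of closed neighbourhoods.
  forVertices (.store 0 4 5 ;; .loadLow 7 5 ;; .storeLow 5 4 ;; .add 5 5 7 ;; .add 5 5 3) ;;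
  .store 0 4 5

/-- Count the vertices still to be dominated, and find out whether the search has to go deeper. -/
def count : Cmd :=
  .const 10 0 ;; forVertices (.load 8 4 4 ;; .add 10 10 8) ;;
  .const 22 0 ;; .ifLt 2 10 (.ifLt 9 1 (.const 22 1) .skip) .skip

/-- Partition the vertices according to what they dominate. -/
def refine : Cmd :=
  forVertices (.store 5 4 2) ;; .store 7 2 2 ;; .store 8 2 2 ;; .const 12 1 ;;
  forVertices (.load 8 4 4 ;; .add 21 4 3 ;; .ifLt 2 8 (scan 4
    (.load 11 5 7 ;; .load 8 7 11 ;;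
      -- Register `21` holds the number of the round, plus one. A class with an older time has no
      -- successor in this round yet and gets a new one. The time stamps make it unnecessary to
      -- clear the successors between rounds.
      .ifLt 8 21 (.store 6 11 12 ;; .store 7 11 21 ;; .store 7 12 2 ;; .store 8 12 2 ;; .add 12 12 3)
        .skip ;;
      .load 8 6 11 ;; .store 5 7 8)) .skip)

/-- Find the representatives of the classes. -/
def represent : Cmd :=
  forVertices (.load 11 5 4 ;; .load 8 8 11 ;;
    .ifLt 2 8 (.store 9 4 2) (.store 9 4 3 ;; .store 8 11 3))

/-- Find the vertex with the least number of candidates, and the candidate for it. -/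
def choose : Cmd :=
  .load 17 2 9 ;; .add 13 0 3 ;; .const 14 0 ;;
  forVertices (.load 8 4 4 ;; .ifLt 2 8 (.const 16 0 ;; .const 15 0 ;;
    scan 4 (.load 8 9 7 ;; .ifLt 2 8 (.ifLt 17 16 .skip (.add 15 7 2) ;; .add 16 16 3) .skip) ;;
    .ifLt 16 13 (.add 13 16 2 ;; .add 14 15 2) .skip) .skip)

/-- Choose the candidate. -/
def descend : Cmd :=
  .store 3 9 13 ;; .storeLow 9 14 ;; scan 14 (.store 4 7 2) ;; .add 9 9 3

/-- Follow a path from the root of the search tree. -/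
def followPath : Cmd :=
  forVertices (.load 8 1 4 ;; .store 4 4 8) ;; .const 9 0 ;; count ;;
  .whileLt 2 22 (refine ;; represent ;; choose ;; descend ;; count)

/-- Go to the next path in lexicographic order. -/
def nextPath : Cmd :=
  .const 18 0 ;; .add 20 9 2 ;;
  .whileLt 2 20 (.sub 20 20 3 ;; .load 7 2 20 ;; .add 7 7 3 ;; .load 8 3 20 ;;
    .ifLt 7 8 (.store 2 20 7 ;; .const 18 1 ;; .const 20 0) (.store 2 20 2))

/-- The search. -/
def search : Cmd :=
  prelude ;; .const 18 1 ;; .const 19 0 ;;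
  .whileLt 2 18 (followPath ;; .ifLt 2 10 nextPath (.const 18 0 ;; .const 19 1))

/-! ### Its correctness -/

/-- The address of the closed neighbourhood of `v`. -/
def ofs (n : ℕ) (cl : ℕ → List ℕ) (v : ℕ) : ℕ := n + 2 + ∑ u ∈ range v, (cl u).length

theorem ofs_succ (n : ℕ) (cl : ℕ → List ℕ) (v : ℕ) : ofs n cl (v + 1) = ofs n cl v + (cl v).length := by
  rw [ofs, ofs, sum_range_succ]; ring

theorem ofs_mono (n : ℕ) (cl : ℕ → List ℕ) : Monotone (ofs n cl) :=
  monotone_nat_of_le_succ fun v => by rw [ofs_succ]; exact Nat.le_add_right _ _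

/-- The number range suffices for the given input. -/
structure Fits (N base n k : ℕ) (cl : ℕ → List ℕ) : Prop where
  ofs_le : ofs n cl n ≤ base
  base_le : base ≤ N
  n_le : (n + 2) ^ 2 ≤ N
  k_le : k + 1 ≤ N

/-- The constants and the adjacency lists are in place. -/
structure Ready (n : ℕ) (cl : ℕ → List ℕ) (s : Store) : Prop where
  n_eq : s.reg 0 = n
  zero : s.reg 2 = 0
  one : s.reg 3 = 1
  off : ∀ v ≤ n, s.arr 0 v = ofs n cl v
  adj : ∀ v < n, ∀ i (hi : i < (cl v).length), s.low (ofs n cl v + i) = (cl v)[i]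

variable {N base n k : ℕ} {cl : ℕ → List ℕ} {s : Store} {Q : ℕ → Store → Prop}

theorem Ready.of_frame {c : Cmd} {s' : Store} (h : Ready n cl s) (hF : Frame c s s')
    (h0 : 0 ∉ c.regs ∧ 2 ∉ c.regs ∧ 3 ∉ c.regs ∧ 0 ∉ c.arrs ∧ c.changesLow = false) :
    Ready n cl s' :=
  ⟨(hF.reg 0 h0.1).trans h.n_eq, (hF.reg 2 h0.2.1).trans h.zero, (hF.reg 3 h0.2.2.1).trans h.one,
    fun v hv => by rw [hF.arr 0 h0.2.2.2.1]; exact h.off v hv,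
    fun v hv i hi => by rw [hF.low h0.2.2.2.2]; exact h.adj v hv i hi⟩

theorem Fits.le (hf : Fits N base n k cl) : n + 2 ≤ N ∧ n * n + 4 * n + 4 ≤ N := by
  have := hf.n_le
  constructor <;> nlinarith

theorem Fits.ofs_lt (hf : Fits N base n k cl) {v i : ℕ} (hv : v < n) (hi : i < (cl v).length) :
    ofs n cl v + i < base := by
  have h1 := ofs_mono n cl (show v + 1 ≤ n from hv)
  have h2 := hf.ofs_le
  rw [ofs_succ] at h1
  omega

/-- The invariant is required for every value of the loop register `4`, so it cannot depend on that
register. The count `i` of treated vertices is passed separately. -/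
theorem wp_forVertices {body : Cmd} (hf : Fits N base n k cl) (hn : s.reg 0 = n) (h3 : s.reg 3 = 1)
    (hb : 0 ∉ body.regs ∧ 3 ∉ body.regs ∧ 4 ∉ body.regs)
    (I : ℕ → Store → Prop) (K : ℕ → ℕ) (hI : ∀ v, I 0 (s.setReg 4 v))
    (hc : ∀ i < n, ∀ s', Frame (forVertices body) s s' → s'.reg 4 = i → I i s' →
      Wp N base body s' fun t s'' => t ≤ K i ∧ ∀ v, I (i + 1) (s''.setReg 4 v))
    (hQ : ∀ t s', t ≤ ∑ i ∈ range n, K i + 2 * n + 2 → Frame (forVertices body) s s' →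
      s'.reg 4 = n → I n s' → Q t s') :
    Wp N base (forVertices body) s Q := by
  have hle := hf.le
  have hreg : (forVertices body).regs = 4 :: (body.regs ++ [4]) := rfl
  have harr : (forVertices body).arrs = body.arrs ++ [] := rfl
  have hlow : (forVertices body).changesLow = (body.changesLow || false) := by
    simp [forVertices, Cmd.changesLow]
  have hlift : ∀ s', Frame (body ;; .add 4 4 3) (s.setReg 4 0) s' → Frame (forVertices body) s s' := by
    intro s' hF
    refine ⟨fun r hr => ?_, fun x hx => ?_, fun hl => ?_⟩
    · rw [hreg] at hr
      simp only [List.mem_cons, List.mem_append, List.not_mem_nil, or_false, not_or] at hr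
      rw [hF.reg r (by simp [Cmd.regs, hr])]
      simp [hr.1]
    · rw [harr] at hx
      exact hF.arr x (by simpa [Cmd.arrs] using hx)
    · rw [hlow] at hl
      exact hF.low (by simpa [Cmd.changesLow] using hl)
  simp only [forVertices, wp_seq, wp_const]
  refine ⟨by omega, wp_for I (fun i => K i + 1) 0 n (by simp [Cmd.regs, hb]) (by simp)
    (by simpa using hn) (hI 0) ?_ ?_⟩
  · intro i hi s' hF ha hI'
    have hF' := hlift s' hF
    rw [wp_seq]
    refine (hc i hi s' hF' (by simpa using ha) hI').frame.mono fun t s'' ⟨⟨ht, hI''⟩, hFb⟩ => ?_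
    have h4 : s''.reg 4 = i := by rw [hFb.reg 4 hb.2.2]; simpa using ha
    have h3' : s''.reg 3 = 1 := by
      rw [hFb.reg 3 hb.2.1, hF.reg 3 (by simp [Cmd.regs, hb])]; simpa using h3
    simp only [wp_add, h4, h3', Store.setReg_reg, if_true]
    exact ⟨by omega, by omega, by omega, hI'' _⟩
  · intro t s' ht hF ha hI'
    refine hQ _ s' ?_ (hlift s' hF) (by simpa using ha) hI'
    simp only [sum_add_distrib, sum_const, card_range, smul_eq_mul] at ht
    omega

theorem wp_scan {body : Cmd} {r u : ℕ} (hf : Fits N base n k cl) (hR : Ready n cl s) (hu : u < n)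
    (hr : s.reg r = u) (hr5 : r ≠ 5)
    (hb : 3 ∉ body.regs ∧ 5 ∉ body.regs ∧ 6 ∉ body.regs ∧ body.changesLow = false)
    (I : ℕ → Store → Prop) (K : ℕ)
    (hI : ∀ s', s'.arr = s.arr → (∀ r, r ≠ 5 → r ≠ 6 → r ≠ 7 → s'.reg r = s.reg r) → I 0 s')
    (hc : ∀ i (hi : i < (cl u).length), ∀ s', Frame (scan r body) s s' → I i s' →
      Wp N base body (s'.setReg 7 (cl u)[i]) fun t s'' => t ≤ K ∧ ∀ v, I (i + 1) (s''.setReg 5 v))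
    (hQ : ∀ t s', t ≤ (cl u).length * (K + 3) + 4 → Frame (scan r body) s s' →
      I (cl u).length s' → Q t s') :
    Wp N base (scan r body) s Q := by
  have hle := hf.le
  have hlen := hf.ofs_le
  have hmono := ofs_mono n cl (show u + 1 ≤ n from hu)
  have hbase := hf.base_le
  have hsucc := ofs_succ n cl u
  set s1 := (((s.setReg 5 (ofs n cl u)).setReg 7 (u + 1)).setReg 6 (ofs n cl (u + 1))) with hs1
  have hlift : ∀ s', Frame (.loadLow 7 5 ;; body ;; .add 5 5 3) s1 s' → Frame (scan r body) s s' := by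
    intro s' hF
    refine ⟨fun q hq => ?_, fun x hx => ?_, fun hl => ?_⟩
    · simp only [scan, Cmd.regs, List.mem_cons, List.mem_append, List.not_mem_nil, or_false,
        not_or] at hq
      rw [hF.reg q (by simp [Cmd.regs, hq])]
      simp [hs1, hq]
    · rw [hF.arr x (by simpa [scan, Cmd.arrs] using hx)]; rfl
    · rw [hF.low (by simpa [scan, Cmd.changesLow] using hl)]; rfl
  simp only [scan, wp_seq, wp_load, wp_add, Store.setReg_reg, Store.setReg_arr, hr, hr5, if_false,
    hR.one, if_true, show (3 : ℕ) ≠ 5 by norm_num,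
    hR.off u hu.le, hR.off (u + 1) hu]
  refine ⟨by omega, wp_for I (fun _ => K + 2) (ofs n cl u) (cl u).length (by simp [Cmd.regs, hb])
    (by simp) (by simpa using hsucc) (hI _ rfl fun q h5 h6 h7 => by simp [h5, h6, h7]) ?_ ?_⟩
  · intro i hi s' hF ha hI'
    have hF' := hlift s' hF
    have h3 : s'.reg 3 = 1 := by
      rw [hF.reg 3 (by simp [Cmd.regs, hb])]; simpa using hR.one
    have hlow : s'.low = s.low := hF.low (by simp [Cmd.changesLow, hb])
    simp only [wp_seq, wp_loadLow, ha, hlow, hR.adj u hu i hi]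
    refine ⟨hf.ofs_lt hu hi, (hc i hi s' hF' hI').frame.mono fun t s'' ⟨⟨ht, hI''⟩, hFb⟩ => ?_⟩
    have h5 : s''.reg 5 = ofs n cl u + i := by rw [hFb.reg 5 hb.2.1]; simpa using ha
    have h3' : s''.reg 3 = 1 := by rw [hFb.reg 3 hb.1]; simpa using h3
    simp only [wp_add, h5, h3', Store.setReg_reg, if_true]
    exact ⟨by omega, by omega, by omega, hI'' _⟩
  · intro t s' ht hF ha hI'
    refine hQ _ s' ?_ (hlift s' hF) hI'
    simp only [sum_const, card_range, smul_eq_mul] at ht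
    nlinarith

end DomSearch

end

/-! ### Reading the input, counting, and representatives -/

section

open Finset

namespace DomSearch

open RAM

variable {N base n k : ℕ} {cl : ℕ → List ℕ} {s : Store} {Q : ℕ → Store → Prop}

/-- The input is in place: `n`, `k`, the colours, and, for each vertex, its degree and its
neighbours. -/
structure Input (n k : ℕ) (S : Finset ℕ) (cl : ℕ → List ℕ) (s : Store) : Prop where
  low_zero : s.low 0 = n
  low_one : s.low 1 = k
  colour : ∀ v < n, s.low (2 + v) = if v ∈ S then 1 else 0
  head : ∀ v < n, ∀ h : 0 < (cl v).length, (cl v)[0] = v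
  degree : ∀ v < n, s.low (ofs n cl v) + 1 = (cl v).length
  adj : ∀ v < n, ∀ i (hi : i + 1 < (cl v).length), s.low (ofs n cl v + (i + 1)) = (cl v)[i + 1]

theorem wp_prelude {S : Finset ℕ} (hf : Fits N base n k cl) (hin : Input n k S cl s)
    (hQ : ∀ t s', t ≤ 15 * n + 15 → Ready n cl s' → s'.reg 1 = k →
      (∀ v < n, s'.arr 1 v = if v ∈ S then 1 else 0) → s'.arr 2 = s.arr 2 → Q t s') :
    Wp N base prelude s Q := by
  have hle := hf.le
  have hofs := hf.ofs_le
  have hbase := hf.base_le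
  have h0 := ofs_mono n cl (Nat.zero_le n)
  have hofs0 : ofs n cl 0 = n + 2 := by simp [ofs]
  have hlt0 : (0 : ℕ) < base := by omega
  have hlt1 : (1 : ℕ) < base := by omega
  simp only [prelude, wp_seq, wp_const, wp_loadLow, Store.setReg_reg, Store.setReg_low, if_true,
    Nat.reduceEqDiff, if_false, hin.low_zero, hin.low_one]
  refine ⟨by omega, by omega, hlt0, hlt1, by omega, ?_⟩
  refine wp_forVertices hf (by simp) (by simp) (by decide)
    (fun i s' => s'.reg 5 = 2 + i ∧ ∀ v < i, s'.arr 1 v = if v ∈ S then 1 else 0) (fun _ => 3)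
    (by simp) ?_ ?_
  · intro i hi s' hF h4 ⟨h5, hcol⟩
    have hlow : s'.low = s.low := hF.low rfl
    have h3 : s'.reg 3 = 1 := by rw [hF.reg 3 (by decide)]; simp
    simp [h5, hlow, hin.colour i hi, h4, h3]
    refine ⟨by omega, by omega, by ring, fun v hv => ?_⟩
    by_cases hvi : v = i
    · simp [hvi]
    · simp [hvi, hcol v (by omega)]
  · intro t1 s1 ht1 hF1 _ ⟨h5, hcol⟩
    have hlow1 : s1.low = s.low := hF1.low rfl
    have hn1 : s1.reg 0 = n := by rw [hF1.reg 0 (by decide)]; simp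
    have hz1 : s1.reg 2 = 0 := by rw [hF1.reg 2 (by decide)]; simp
    have ho1 : s1.reg 3 = 1 := by rw [hF1.reg 3 (by decide)]; simp
    have hk1 : s1.reg 1 = k := by rw [hF1.reg 1 (by decide)]; simp
    refine wp_forVertices hf hn1 ho1 (by decide)
      (fun i s' => s'.reg 5 = ofs n cl i ∧ (∀ v < i, s'.arr 0 v = ofs n cl v) ∧
        (∀ v < i, ∀ j (hj : j < (cl v).length), s'.low (ofs n cl v + j) = (cl v)[j]) ∧
        ∀ a, ofs n cl i ≤ a → s'.low a = s.low a) (fun _ => 5)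
      (by simp [h5, hofs0, hlow1]; omega) ?_ ?_
    · intro i hi s' hF h4 ⟨h5, hoff, hadj, hrest⟩
      have h3 : s'.reg 3 = 1 := by rw [hF.reg 3 (by decide)]; exact ho1
      have hdeg := hin.degree i hi
      have hlt := hf.ofs_lt hi (show 0 < (cl i).length by omega)
      have hs := ofs_succ n cl i
      have hm := ofs_mono n cl (show i + 1 ≤ n from hi)
      have hl : s'.low (ofs n cl i) = s.low (ofs n cl i) := hrest _ le_rfl
      simp [h5, h4, h3, hl]
      refine ⟨by omega, by omega, by omega, by omega, fun v hv => ?_, fun v hv j hj => ?_, fun a ha => ?_⟩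
      · by_cases hvi : v = i
        · simp [hvi]
        · simp [hvi, hoff v (by omega)]
      · rcases Nat.lt_or_eq_of_le hv with hv' | rfl
        · have h6 := ofs_mono n cl (show v + 1 ≤ i from hv')
          rw [ofs_succ] at h6
          rw [if_neg (by omega)]
          exact hadj v hv' j hj
        · cases j with
          | zero => simp [hin.head v hi hj]
          | succ j =>
            rw [if_neg (by omega), hrest _ (by omega)]
            exact hin.adj v hi j hj
      · rw [if_neg (by omega)]
        exact hrest a (by omega)
    · intro t2 s2 ht2 hF2 h4 ⟨h5, hoff, hadj, _⟩
      rw [wp_store]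
      refine hQ _ _ ?_ ⟨?_, ?_, ?_, ?_, ?_⟩ ?_ ?_ ?_
      · simp at ht1 ht2; omega
      · simpa [hF2.reg 0 (by decide)] using hn1
      · simpa [hF2.reg 2 (by decide)] using hz1
      · simpa [hF2.reg 3 (by decide)] using ho1
      · intro v hv
        simp only [Store.setArr_arr, h4, h5, true_and]
        by_cases hvn : v = n
        · simp [hvn]
        · rw [if_neg hvn]; exact hoff v (by omega)
      · exact hadj
      · simpa [hF2.reg 1 (by decide)] using hk1
      · intro v hv
        simpa [hF2.arr 1 (by decide)] using hcol v hv
      · funext v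
        simp [hF2.arr 2 (by decide), hF1.arr 2 (by decide)]

/-- The array `4` describes the set `S`. -/
def Marks (n : ℕ) (S : Finset ℕ) (s : Store) : Prop := ∀ v < n, s.arr 4 v = if v ∈ S then 1 else 0

theorem wp_count {S : Finset ℕ} {j : ℕ} (hf : Fits N base n k cl) (hR : Ready n cl s) (hSn : S ⊆ range n)
    (hM : Marks n S s) (hk : s.reg 1 = k) (hj : s.reg 9 = j)
    (hQ : ∀ t s', t ≤ 5 * n + 10 → Frame count s s' → s'.reg 10 = #S →
      s'.reg 22 = (if S.Nonempty ∧ j < k then 1 else 0) → Q t s') : Wp N base count s Q := by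
  have hle := hf.le
  suffices h : Wp N base count s fun t s' => t ≤ 5 * n + 10 ∧ s'.reg 10 = #S ∧
      s'.reg 22 = (if S.Nonempty ∧ j < k then 1 else 0) from
    h.frame.mono fun t s' h => hQ t s' h.1.1 h.2 h.1.2.1 h.1.2.2
  simp only [count, wp_seq, wp_const]
  refine ⟨by omega, wp_forVertices hf (by simpa using hR.n_eq) (by simpa using hR.one) (by decide)
    (fun i s' => s'.reg 10 = #(S ∩ range i)) (fun _ => 2) (by simp) ?_ ?_⟩
  · intro i hi s' hF h4 h10
    have harr : s'.arr 4 = s.arr 4 := hF.arr 4 (by decide)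
    have e : S ∩ range (i + 1) = if i ∈ S then insert i (S ∩ range i) else S ∩ range i := by
      ext v
      split_ifs with h <;> simp <;> grind
    have hc : #(S ∩ range (i + 1)) = #(S ∩ range i) + if i ∈ S then 1 else 0 := by
      rw [e]; split_ifs with h
      · rw [card_insert_of_notMem (by simp)]
      · simp
    have hle' : #(S ∩ range i) ≤ i := (card_le_card inter_subset_right).trans (by simp)
    simp [h4, harr, hM i hi, h10, hc]
    split_ifs <;> omega
  · intro t s' ht hF h4 h10
    have hz : s'.reg 2 = 0 := by rw [hF.reg 2 (by decide)]; simpa using hR.zero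
    have hk' : s'.reg 1 = k := by rw [hF.reg 1 (by decide)]; simpa using hk
    have hj' : s'.reg 9 = j := by rw [hF.reg 9 (by decide)]; simpa using hj
    have hS : S ∩ range n = S := inter_eq_left.2 hSn
    rw [hS] at h10
    simp only [sum_const, card_range, smul_eq_mul] at ht
    simp [hz, hk', hj', h10, card_pos]
    refine ⟨fun hne => ⟨fun hjk => ⟨by omega, by omega, ?_⟩, fun hjk => ⟨by omega, ?_⟩⟩,
      fun he => ⟨by omega, ?_⟩⟩
    · exact ⟨hne, hjk⟩
    · exact fun _ => hjk
    · exact fun h => absurd he h.ne_empty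

theorem wp_represent {S : Finset ℕ} (hf : Fits N base n k cl) (hR : Ready n cl s)
    (hcls : ∀ x < n, ∀ y < n, s.arr 5 x = s.arr 5 y ↔ sig cl S x = sig cl S y)
    (hmark : ∀ x < n, s.arr 8 (s.arr 5 x) = 0)
    (hQ : ∀ t s', t ≤ 7 * n + 2 → Frame represent s s' →
      (∀ v < n, s'.arr 9 v = if IsRep cl S v then 1 else 0) → Q t s') : Wp N base represent s Q := by
  have hle := hf.le
  rw [represent]
  refine wp_forVertices hf hR.n_eq hR.one (by decide)
    -- A class is marked as soon as one of its members has been seen, so the first member finds it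
    -- unmatched by a mark and becomes the representative.
    (fun i s' => (∀ v < i, s'.arr 9 v = if IsRep cl S v then 1 else 0) ∧
      ∀ x < n, s'.arr 8 (s.arr 5 x) = if ∃ y < i, sig cl S y = sig cl S x then 1 else 0) (fun _ => 5)
    (by simpa using hmark) ?_ ?_
  · intro i hi s' hF h4 ⟨hrep, hm⟩
    have harr : s'.arr 5 = s.arr 5 := hF.arr 5 (by decide)
    have hz : s'.reg 2 = 0 := by rw [hF.reg 2 (by decide)]; exact hR.zero
    have ho : s'.reg 3 = 1 := by rw [hF.reg 3 (by decide)]; exact hR.one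
    simp only [wp_seq, wp_load, wp_ifLt, wp_store, Store.setReg_reg, Store.setReg_arr, Store.setArr_arr,
      Store.setArr_reg, h4, harr, hz, ho, hm i hi, Nat.reduceEqDiff, if_false, if_true, Fin.reduceEq,
      false_and, true_and]
    by_cases hex : ∃ y < i, sig cl S y = sig cl S i
    · have hnr : ¬ IsRep cl S i := fun h => by obtain ⟨y, hy, he⟩ := hex; exact h y hy he
      simp only [hex, if_true, zero_lt_one, true_implies, not_true, false_implies, and_true]
      refine ⟨by omega, fun _ => ⟨fun v hv => ?_, fun x hx => ?_⟩⟩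
      · by_cases hvi : v = i
        · subst hvi; simp [hnr]
        · simp [hvi, hrep v (by omega)]
      · rw [hm x hx]
        refine if_congr ⟨fun ⟨y, hy, he⟩ => ⟨y, by omega, he⟩, fun ⟨y, hy, he⟩ => ?_⟩ rfl rfl
        rcases Nat.lt_succ_iff_lt_or_eq.1 hy with hy | rfl
        · exact ⟨y, hy, he⟩
        · obtain ⟨z, hz, hz'⟩ := hex
          exact ⟨z, hz, hz'.trans he⟩
    · have hr : IsRep cl S i := fun y hy he => hex ⟨y, hy, he⟩
      simp only [hex, if_false, lt_irrefl, false_implies, not_false_iff, true_implies, true_and]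
      refine ⟨by omega, fun _ => ⟨fun v hv => ?_, fun x hx => ?_⟩⟩
      · by_cases hvi : v = i
        · subst hvi; simp [hr]
        · simp [hvi, hrep v (by omega)]
      · by_cases hxi : s.arr 5 x = s.arr 5 i
        · rw [if_pos hxi, if_pos ⟨i, by omega, ((hcls x hx i hi).1 hxi).symm⟩]
        · rw [if_neg (by simp [hxi]), hm x hx]
          refine if_congr ⟨fun ⟨y, hy, he⟩ => ⟨y, by omega, he⟩, fun ⟨y, hy, he⟩ => ?_⟩ rfl rfl
          rcases Nat.lt_succ_iff_lt_or_eq.1 hy with hy | rfl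
          · exact ⟨y, hy, he⟩
          · exact absurd ((hcls x hx y hi).2 he.symm) hxi
  · intro t s' ht hF _ ⟨hrep, _⟩
    simp only [sum_const, card_range, smul_eq_mul] at ht
    exact hQ t s' (by omega) hF hrep

end DomSearch

end

/-! ### Partition refinement, the branching vertex, and one choice -/

section

open Finset

namespace DomSearch

open RAM

variable {N base n k : ℕ} {cl : ℕ → List ℕ} {s : Store} {Q : ℕ → Store → Prop}

theorem ClosedLists.length_le (hcl : ClosedLists n cl) {v : ℕ} (hv : v < n) : (cl v).length ≤ n := by
  rw [← List.toFinset_card_of_nodup (hcl.nodup v hv)]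
  calc _ ≤ #(range n) := card_le_card fun x hx => by simpa using hcl.lt v hv x (by simpa using hx)
    _ = n := card_range n

theorem sig_insert_eq_iff {T : Finset ℕ} {b x y : ℕ} (hb : b ∉ T) :
    sig cl (insert b T) x = sig cl (insert b T) y ↔
      sig cl T x = sig cl T y ∧ (x ∈ cl b ↔ y ∈ cl b) := by
  simp only [Finset.ext_iff, mem_sig, mem_insert]
  constructor
  · refine fun h => ⟨fun c => ?_, ?_⟩
    · have := h c
      by_cases hc : c = b
      · subst hc; simp [hb]
      · simpa [hc] using this
    · simpa using h b
  · rintro ⟨h1, h2⟩ c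
    by_cases hc : c = b
    · subst hc; simpa [hb] using h2
    · simpa [hc] using h1 c

/-- The array `5` describes the partition of the vertices according to what they dominate in `T`. -/
structure Part (n : ℕ) (cl : ℕ → List ℕ) (T : Finset ℕ) (i m : ℕ) (s : Store) : Prop where
  num_le : s.reg 12 ≤ m
  cls_lt : ∀ x < n, s.arr 5 x < s.reg 12
  cls_eq : ∀ x < n, ∀ y < n, s.arr 5 x = s.arr 5 y ↔ sig cl T x = sig cl T y
  time_le : ∀ c < s.reg 12, s.arr 7 c ≤ i
  mark : ∀ c < s.reg 12, s.arr 8 c = 0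

/-- The state of the refinement of the partition in `s` by the neighbourhood of a vertex, when the
vertices in `l` have been treated. -/
structure Refining (n : ℕ) (s : Store) (i : ℕ) (l : List ℕ) (s' : Store) : Prop where
  num_le : s.reg 12 ≤ s'.reg 12 ∧ s'.reg 12 ≤ s.reg 12 + l.length
  old : ∀ x < n, x ∉ l → s'.arr 5 x = s.arr 5 x
  new : ∀ x ∈ l, s'.arr 5 x = s'.arr 6 (s.arr 5 x) ∧ s'.arr 7 (s.arr 5 x) = i + 1
  succ_lt : ∀ c < s.reg 12, s'.arr 7 c = i + 1 → s.reg 12 ≤ s'.arr 6 c ∧ s'.arr 6 c < s'.reg 12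
  succ_inj : ∀ c < s.reg 12, ∀ c' < s.reg 12, s'.arr 7 c = i + 1 → s'.arr 7 c' = i + 1 →
    s'.arr 6 c = s'.arr 6 c' → c = c'
  time_le : ∀ c < s'.reg 12, s'.arr 7 c ≤ i + 1
  mark : ∀ c < s'.reg 12, s'.arr 8 c = 0

/-- Vertices in `cl i` move to classes numbered from the old count on, and all others keep smaller
numbers, so the two kinds never share a class. Among the moved ones the successor map is injective
on old classes. Numbers of emptied classes are not reused, so the count may grow by `n` per round.
-/
theorem Refining.part {T : Finset ℕ} {i m : ℕ} {s' : Store} (hcl : ClosedLists n cl) (hi : i < n)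
    (hiT : i ∉ T) (hP : Part n cl T i m s) (h : Refining n s i (cl i) s') :
    Part n cl (insert i T) (i + 1) (m + n) s' := by
  have hlen := hcl.length_le hi
  have hnew : ∀ x ∈ cl i, s.reg 12 ≤ s'.arr 5 x ∧ s'.arr 5 x < s'.reg 12 := fun x hx => by
    rw [(h.new x hx).1]
    exact h.succ_lt _ (hP.cls_lt x (hcl.lt i hi x hx)) (h.new x hx).2
  have hold : ∀ x < n, x ∉ cl i → s'.arr 5 x < s.reg 12 := fun x hx hxi => by
    rw [h.old x hx hxi]; exact hP.cls_lt x hx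
  refine ⟨by have := hP.num_le; have := h.num_le; omega, fun x hx => ?_, fun x hx y hy => ?_,
    h.time_le, h.mark⟩
  · by_cases hxi : x ∈ cl i
    · exact (hnew x hxi).2
    · exact (hold x hx hxi).trans_le h.num_le.1
  · rw [sig_insert_eq_iff hiT, ← hP.cls_eq x hx y hy]
    by_cases hxi : x ∈ cl i <;> by_cases hyi : y ∈ cl i
    · rw [(h.new x hxi).1, (h.new y hyi).1]
      simp only [hxi, hyi, and_true]
      exact ⟨h.succ_inj _ (hP.cls_lt x hx) _ (hP.cls_lt y hy) (h.new x hxi).2 (h.new y hyi).2,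
        fun e => by rw [e]⟩
    · have := hnew x hxi
      have := hold y hy hyi
      exact ⟨fun e => by omega, fun e => absurd (e.2.1 hxi) hyi⟩
    · have := hnew y hyi
      have := hold x hx hxi
      exact ⟨fun e => by omega, fun e => absurd (e.2.2 hyi) hxi⟩
    · rw [h.old x hx hxi, h.old y hy hyi]
      simp [hxi, hyi]

theorem wp_refine {S : Finset ℕ} (hf : Fits N base n k cl) (hcl : ClosedLists n cl)
    (hR : Ready n cl s) (hSn : S ⊆ range n) (hM : Marks n S s)
    (hQ : ∀ t s', t ≤ 16 * n + 16 * (∑ i ∈ range n, (cl i).length) + 7 → Frame refine s s' →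
      (∀ x < n, ∀ y < n, s'.arr 5 x = s'.arr 5 y ↔ sig cl S x = sig cl S y) →
      (∀ x < n, s'.arr 8 (s'.arr 5 x) = 0) → Q t s') : Wp N base refine s Q := by
  have hle := hf.le
  suffices h : Wp N base refine s fun t s' => t ≤ 16 * n + 16 * (∑ i ∈ range n, (cl i).length) + 7 ∧
      (∀ x < n, ∀ y < n, s'.arr 5 x = s'.arr 5 y ↔ sig cl S x = sig cl S y) ∧
      (∀ x < n, s'.arr 8 (s'.arr 5 x) = 0) from
    h.frame.mono fun t s' h => hQ t s' h.1.1 h.2 h.1.2.1 h.1.2.2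
  simp only [refine, wp_seq]
  refine wp_forVertices hf hR.n_eq hR.one (by decide) (fun i s' => ∀ x < i, s'.arr 5 x = 0) (fun _ => 1)
    (by simp) ?_ ?_
  · intro i hi s' hF h4 h5
    have hz : s'.reg 2 = 0 := by rw [hF.reg 2 (by decide)]; exact hR.zero
    simp [hz, h4]
    exact fun x hx hxi => h5 x (by omega)
  intro t1 s1 ht1 hF1 _ h5
  have hR1 := hR.of_frame hF1 (by decide)
  have hz1 := hR1.zero
  have ho1 := hR1.one
  simp only [wp_store, wp_const, Store.setArr_reg, hz1]
  refine ⟨by omega, ?_⟩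
  -- The class numbers stay below about `n ^ 2`, which is why `Fits` asks for `(n + 2) ^ 2 ≤ N`. New
  -- classes start with time and mark 0, so marks left by earlier levels do no harm.
  refine wp_forVertices hf (by simpa using hR1.n_eq) (by simpa using ho1) (by decide)
    (fun i s' => Part n cl (S ∩ range i) i (1 + i * n) s') (fun i => 11 + 14 * (cl i).length) ?_ ?_ ?_
  · intro v
    refine ⟨by simp, fun x hx => ?_, fun x hx y hy => ?_, fun c hc => ?_, fun c hc => ?_⟩
    · simp [h5 x hx]
    · simp [h5 x hx, h5 y hy, sig]
    · simp at hc; simp [hc]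
    · simp at hc; simp [hc]
  · intro i hi s' hF h4 hP
    have hR' : Ready n cl s' := by
      refine ⟨?_, ?_, ?_, fun v hv => ?_, fun v hv j hj => ?_⟩
      · rw [hF.reg 0 (by decide)]; simpa using hR1.n_eq
      · rw [hF.reg 2 (by decide)]; simpa using hR1.zero
      · rw [hF.reg 3 (by decide)]; simpa using hR1.one
      · rw [hF.arr 0 (by decide)]; simpa using hR1.off v hv
      · rw [hF.low (by decide)]; simpa using hR1.adj v hv j hj
    have hMi : s'.arr 4 i = if i ∈ S then 1 else 0 := by
      rw [hF.arr 4 (by decide)]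
      simpa [hF1.arr 4 (by decide)] using hM i hi
    have hlen := hcl.length_le hi
    have hin : i * n + n ≤ n * n := by nlinarith
    simp only [wp_seq, wp_load, wp_add, wp_ifLt, Store.setReg_reg, h4, hMi,
      Nat.reduceEqDiff, if_false, if_true, hR'.zero, hR'.one]
    refine ⟨by omega, fun hiS => ?_, fun hiS => ?_⟩
    · replace hiS : i ∈ S := by by_contra h; simp [h] at hiS
      simp only [hiS, if_true]
      have eS : S ∩ range (i + 1) = insert i (S ∩ range i) := by
        ext v; simp; grind
      have hR2 : Ready n cl ((s'.setReg 8 1).setReg 21 (i + 1)) :=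
        ⟨by simpa using hR'.n_eq, by simpa using hR'.zero, by simpa using hR'.one, hR'.off, hR'.adj⟩
      refine wp_scan hf hR2 hi (by simpa using h4) (by norm_num) (by decide)
        (fun p s2 => Refining n s' i ((cl i).take p) s2) 11 ?_ ?_ ?_
      · intro s2 harr hreg
        have hreg12 : s2.reg 12 = s'.reg 12 := by simpa using hreg 12 (by norm_num) (by norm_num) (by norm_num)
        simp only [Store.setReg_arr] at harr
        have ht : ∀ c < s'.reg 12, s2.arr 7 c ≤ i := by rw [harr]; exact hP.time_le
        refine ⟨by simp [hreg12], by simp [harr], by simp, fun c hc h => ?_, fun c hc c' hc' h => ?_,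
          fun c hc => ?_, fun c hc => ?_⟩
        · have := ht c hc; omega
        · have := ht c hc; omega
        · have := ht c (hreg12 ▸ hc); omega
        · rw [harr]; exact hP.mark c (hreg12 ▸ hc)
      · intro p hp s2 hF2 hI
        set x := (cl i)[p] with hx
        have hxcl : x ∈ cl i := List.getElem_mem hp
        have hxn : x < n := hcl.lt i hi x hxcl
        have htake : (cl i).take (p + 1) = (cl i).take p ++ [x] := by simp [hx]
        have hxp : x ∉ (cl i).take p := by
          have h1 := (hcl.nodup i hi).sublist (List.take_sublist (p + 1) (cl i))
          rw [htake, List.nodup_append] at h1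
          exact fun h => h1.2.2 x h x (by simp) rfl
        have hz2 : s2.reg 2 = 0 := by rw [hF2.reg 2 (by decide)]; exact hR2.zero
        have ho2 : s2.reg 3 = 1 := by rw [hF2.reg 3 (by decide)]; exact hR2.one
        have h21 : s2.reg 21 = i + 1 := by rw [hF2.reg 21 (by decide)]; simp
        have hold := hI.old x hxn hxp
        have hc0 := hP.cls_lt x hxn
        have hnum := hI.num_le
        rw [List.length_take] at hnum
        have hnum0 := hP.num_le
        have hlp : (List.take (p + 1) (cl i)).length = p + 1 := by simp; omega
        have hlp' : (List.take p (cl i)).length = p := by simp; omega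
        obtain ⟨hI1, hI2, hI3, hI4, hI5, hI6, hI7⟩ := hI
        simp only [wp_seq, wp_load, wp_add, wp_ifLt, wp_store, wp_skip, Store.setReg_reg, Store.setReg_arr,
          Store.setArr_arr, Store.setArr_reg, h21, hz2, ho2, hold, Nat.reduceEqDiff, if_false, if_true,
          Fin.reduceEq, false_and, true_and]
        have hcne : s'.arr 5 x ≠ s2.reg 12 := by omega
        refine ⟨fun hlt => ⟨by omega, by omega, fun v => ?_⟩, fun hlt => ⟨by omega, fun v => ?_⟩⟩
        · constructor
          · simp [hlp]; omega
          · intro y hy hyl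
            simp only [htake, List.mem_append, List.mem_singleton, not_or] at hyl
            simp [hyl.2, hI2 y hy hyl.1]
          · intro y hyl
            simp only [htake, List.mem_append, List.mem_singleton] at hyl
            rcases hyl with hyl | rfl
            · have hyn := hcl.lt i hi y (List.mem_of_mem_take hyl)
              have hy0 := hP.cls_lt y hyn
              have hyx : y ≠ x := fun h => hxp (h ▸ hyl)
              have hy3 := hI3 y hyl
              have hne : s'.arr 5 y ≠ s'.arr 5 x := fun h => by rw [h] at hy3; omega
              simp [hyx, hne, hy3, show s'.arr 5 y ≠ s2.reg 12 by omega]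
            · simp [hcne]
          · intro c hc
            by_cases hcx : c = s'.arr 5 x
            · simp [hcx, hnum.1]
            · have := hI4 c hc
              simp [hcx, show c ≠ s2.reg 12 by omega]
              intro h; have := this h; omega
          · intro c hc c' hc'
            have h1 := hI4 c hc
            have h2 := hI4 c' hc'
            have h3 := hI5 c hc c' hc'
            by_cases hcx : c = s'.arr 5 x <;> by_cases hcx' : c' = s'.arr 5 x
            · simp [hcx, hcx']
            · simp [hcx, hcx', show c' ≠ s2.reg 12 by omega, hcne]
              intro h4 h5; have := h2 h4; omega
            · simp [hcx, hcx', show c ≠ s2.reg 12 by omega, hcne]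
              intro h4 h5; have := h1 h4; omega
            · simp [hcx, hcx', show c ≠ s2.reg 12 by omega, show c' ≠ s2.reg 12 by omega]
              exact h3
          · intro c hc
            simp at hc ⊢
            split_ifs
            · omega
            · omega
            · exact hI6 c (by omega)
          · intro c hc
            simp at hc ⊢
            exact fun h => hI7 c (by omega)
        · have h7 := hI6 (s'.arr 5 x) (by omega)
          have h7' : s2.arr 7 (s'.arr 5 x) = i + 1 := by omega
          constructor
          · simp [hlp]; omega
          · intro y hy hyl
            simp only [htake, List.mem_append, List.mem_singleton, not_or] at hyl
            simp [hyl.2, hI2 y hy hyl.1]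
          · intro y hyl
            simp only [htake, List.mem_append, List.mem_singleton] at hyl
            rcases hyl with hyl | rfl
            · have hyx : y ≠ x := fun h => hxp (h ▸ hyl)
              simp [hyx, hI3 y hyl]
            · simp [h7']
          · simpa using hI4
          · simpa using hI5
          · simpa using hI6
          · simpa using hI7
      · intro t s2 ht hF2 hI
        rw [List.take_length] at hI
        have hpart := hI.part hcl hi (by simp) hP
        rw [← eS] at hpart
        refine ⟨by omega, fun v => ⟨?_, hpart.cls_lt, hpart.cls_eq, hpart.time_le, hpart.mark⟩⟩
        have := hpart.num_le
        simp; nlinarith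
    · replace hiS : i ∉ S := by intro h; simp [h] at hiS
      have eS : S ∩ range (i + 1) = S ∩ range i := by
        ext v; simp; grind
      rw [wp_skip, eS]
      refine ⟨by omega, fun v => ⟨?_, hP.cls_lt, hP.cls_eq, fun c hc => ?_, hP.mark⟩⟩
      · have := hP.num_le
        simp; nlinarith
      · exact (hP.time_le c hc).trans (by omega)
  · intro t2 s2 ht2 hF2 _ hP
    rw [inter_eq_left.2 hSn] at hP
    refine ⟨?_, hP.cls_eq, fun x hx => hP.mark _ (hP.cls_lt x hx)⟩
    simp only [sum_add_distrib, sum_const, card_range, smul_eq_mul, ← mul_sum] at ht1 ht2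
    omega

theorem wp_choose {S : Finset ℕ} {f : ℕ} (hf : Fits N base n k cl) (hcl : ClosedLists n cl)
    (hR : Ready n cl s) (hSn : S ⊆ range n) (hS : S.Nonempty) (hM : Marks n S s)
    (hrep : ∀ v < n, s.arr 9 v = if IsRep cl S v then 1 else 0) (hidx : s.arr 2 (s.reg 9) = f)
    (hQ : ∀ t s', t ≤ 15 * n + 8 * (∑ i ∈ range n, (cl i).length) + 5 → Frame choose s s' →
      s'.reg 13 = deg cl S → (f < deg cl S → s'.reg 14 = cand cl S f) → Q t s') :
    Wp N base choose s Q := by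
  have hle := hf.le
  suffices h : Wp N base choose s fun t s' => t ≤ 15 * n + 8 * (∑ i ∈ range n, (cl i).length) + 5 ∧
      s'.reg 13 = deg cl S ∧ (f < deg cl S → s'.reg 14 = cand cl S f) from
    h.frame.mono fun t s' h => hQ t s' h.1.1 h.2 h.1.2.1 h.1.2.2
  simp only [choose, wp_seq, wp_load, wp_add, wp_const, Store.setReg_reg, hidx, hR.n_eq, hR.one,
    Nat.reduceEqDiff, if_false]
  refine ⟨by omega, by omega, ?_⟩
  refine wp_forVertices hf (by simpa using hR.n_eq) (by simpa using hR.one) (by decide)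
    (fun i s' => (s'.reg 13 = n + 1 ∧ S ∩ range i = ∅) ∨ ∃ b ∈ S, b < i ∧
      (∀ b' ∈ S, b' < i → (cands cl S b).length < (cands cl S b').length ∨
        (cands cl S b).length = (cands cl S b').length ∧ b ≤ b') ∧
      s'.reg 13 = (cands cl S b).length ∧
      (f < (cands cl S b).length → s'.reg 14 = (cands cl S b).getD f 0))
    (fun i => 12 + 8 * (cl i).length) (fun v => by simp) ?_ ?_
  · intro i hi s' hF h4 hI
    have hR' : Ready n cl s' := by
      refine ⟨?_, ?_, ?_, fun v hv => ?_, fun v hv j hj => ?_⟩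
      · rw [hF.reg 0 (by decide)]; simpa using hR.n_eq
      · rw [hF.reg 2 (by decide)]; simpa using hR.zero
      · rw [hF.reg 3 (by decide)]; simpa using hR.one
      · rw [hF.arr 0 (by decide)]; simpa using hR.off v hv
      · rw [hF.low (by decide)]; simpa using hR.adj v hv j hj
    have hMi : s'.arr 4 i = if i ∈ S then 1 else 0 := by
      rw [hF.arr 4 (by decide)]; exact hM i hi
    have h17 : s'.reg 17 = f := by rw [hF.reg 17 (by decide)]; simp
    have h9 : s'.arr 9 = s.arr 9 := hF.arr 9 (by decide)
    simp only [wp_seq, wp_load, wp_ifLt, wp_const, Store.setReg_reg, h4, hMi, Nat.reduceEqDiff,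
      if_false, if_true, hR'.zero]
    refine ⟨fun hiS => ?_, fun hiS => ?_⟩
    · replace hiS : i ∈ S := by by_contra h; simp [h] at hiS
      simp only [hiS, if_true]
      refine ⟨by omega, by omega, ?_⟩
      have hR2 : Ready n cl (((s'.setReg 8 1).setReg 16 0).setReg 15 0) :=
        ⟨by simpa using hR'.n_eq, by simpa using hR'.zero, by simpa using hR'.one, hR'.off, hR'.adj⟩
      -- Register `15` follows the candidates until the one with index `f` has been stored, since it
      -- is overwritten only while the number of earlier candidates is at most `f`.
      refine wp_scan hf hR2 hi (by simpa using h4) (by norm_num) (by decide)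
        (fun p s2 => s2.reg 16 = (((cl i).take p).filter (IsRep cl S)).length ∧ s2.reg 15 ≤ n ∧
          (f < (((cl i).take p).filter (IsRep cl S)).length →
            s2.reg 15 = (((cl i).take p).filter (IsRep cl S)).getD f 0)) 5 ?_ ?_ ?_
      · intro s2 _ hreg
        have h16 := hreg 16 (by norm_num) (by norm_num) (by norm_num)
        have h15 := hreg 15 (by norm_num) (by norm_num) (by norm_num)
        simp at h16 h15
        simp [h16, h15]
      · intro p hp s2 hF2 ⟨h16, h15n, h15⟩
        set x := (cl i)[p] with hx
        have hxn : x < n := hcl.lt i hi x (List.getElem_mem hp)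
        have htake : (cl i).take (p + 1) = (cl i).take p ++ [x] := by simp [hx]
        have hz2 : s2.reg 2 = 0 := by rw [hF2.reg 2 (by decide)]; exact hR2.zero
        have ho2 : s2.reg 3 = 1 := by rw [hF2.reg 3 (by decide)]; exact hR2.one
        have h17' : s2.reg 17 = f := by rw [hF2.reg 17 (by decide)]; simpa using h17
        have h92 : s2.arr 9 = s.arr 9 := by rw [hF2.arr 9 (by decide)]; exact h9
        have hl1 : (((cl i).take p).filter (IsRep cl S)).length ≤ p :=
          (List.length_filter_le _ _).trans (by simp)
        have hl2 := hcl.length_le hi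
        rw [htake, List.filter_append]
        generalize List.filter (fun b => decide (IsRep cl S b)) ((cl i).take p) = L at *
        simp only [wp_seq, wp_load, wp_add, wp_ifLt, wp_skip, Store.setReg_reg, Store.setReg_arr,
          h92, hrep x hxn, hz2, ho2, h17', h16, Nat.reduceEqDiff, if_false, if_true]
        by_cases hrx : IsRep cl S x
        · simp [hrx]
          refine ⟨fun hlt => ⟨by omega, h15n, fun _ => ?_⟩,
            fun hle' => ⟨by omega, by omega, hxn.le, fun _ => ?_⟩⟩
          · rw [h15 hlt, List.getElem?_append_left hlt, List.getD_eq_getElem?_getD]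
          · have : f = L.length := by omega
            subst this
            simp
        · simp [hrx]
          exact ⟨h15n, by simpa using h15⟩
      · intro t s2 ht hF2 ⟨h16, h15n, h15⟩
        rw [List.take_length] at h16 h15
        change s2.reg 16 = (cands cl S i).length at h16
        change f < (cands cl S i).length → s2.reg 15 = (cands cl S i).getD f 0 at h15
        have hlen : (cands cl S i).length ≤ n := (List.length_filter_le _ _).trans (hcl.length_le hi)
        have h13 : s2.reg 13 = s'.reg 13 := by rw [hF2.reg 13 (by decide)]; simp
        have h14 : s2.reg 14 = s'.reg 14 := by rw [hF2.reg 14 (by decide)]; simp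
        have hz2 : s2.reg 2 = 0 := by rw [hF2.reg 2 (by decide)]; exact hR2.zero
        simp only [wp_add, wp_skip, Store.setReg_reg, h16, h13, hz2, Nat.reduceEqDiff,
          if_false, if_true, add_zero]
        refine ⟨fun hlt => ⟨by omega, ?_⟩, fun hge => ⟨by omega, fun v => ?_⟩⟩
        · refine ⟨by omega, by omega, fun v => Or.inr ⟨i, hiS, by omega, fun b' hb' hb'i => ?_, rfl, h15⟩⟩
          rcases Nat.lt_succ_iff_lt_or_eq.1 hb'i with hb'i | rfl
          · rcases hI with ⟨_, hI⟩ | ⟨b, hb, hbi, hmin, h13', _⟩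
            · have : b' ∈ S ∩ range i := mem_inter.2 ⟨hb', mem_range.2 hb'i⟩
              rw [hI] at this
              simp at this
            · have := hmin b' hb' hb'i
              omega
          · exact Or.inr ⟨rfl, le_rfl⟩
        · rcases hI with ⟨hI, _⟩ | ⟨b, hb, hbi, hmin, h13', h14'⟩
          · omega
          · refine Or.inr ⟨b, hb, by omega, fun b' hb' hb'i => ?_, by simpa [h13] using h13',
              by simpa [h14] using h14'⟩
            rcases Nat.lt_succ_iff_lt_or_eq.1 hb'i with hb'i | rfl
            · exact hmin b' hb' hb'i
            · omega
    · replace hiS : i ∉ S := by intro h; simp [h] at hiS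
      rw [wp_skip]
      refine ⟨by omega, fun v => ?_⟩
      rcases hI with ⟨h13, hI⟩ | ⟨b, hb, hbi, hmin, h13, h14⟩
      · refine Or.inl ⟨by simpa using h13, ?_⟩
        rw [← hI]; ext v; simp; grind
      · refine Or.inr ⟨b, hb, by omega, fun b' hb' hb'i => ?_, by simpa using h13, by simpa using h14⟩
        rcases Nat.lt_succ_iff_lt_or_eq.1 hb'i with hb'i | rfl
        · exact hmin b' hb' hb'i
        · exact absurd hb' hiS
  · intro t s' ht hF _ hI
    simp only [sum_add_distrib, sum_const, card_range, smul_eq_mul, ← mul_sum] at ht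
    rcases hI with ⟨_, hI⟩ | ⟨b, hb, hbi, hmin, h13, h14⟩
    · rw [inter_eq_left.2 hSn] at hI
      exact absurd hI hS.ne_empty
    · have hpick : pick cl S = b := (isPick_pick hS).unique
        ⟨hb, fun b' hb' => hmin b' hb' (mem_range.1 (hSn hb'))⟩
      rw [deg, cand, hpick]
      exact ⟨by omega, h13, h14⟩

theorem wp_descend {S : Finset ℕ} {j u : ℕ} (hf : Fits N base n k cl) (hcl : ClosedLists n cl)
    (hR : Ready n cl s) (hM : Marks n S s) (hj : s.reg 9 = j) (hu : s.reg 14 = u)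
    (hun : u < n) (hjn : j < n)
    (hQ : ∀ t s', t ≤ 4 * n + 7 → Frame descend s s' → Ready n cl s' →
      Marks n (S.filter fun b => u ∉ cl b) s' → s'.reg 9 = j + 1 →
      (∀ i, s'.arr 3 i = if i = j then s.reg 13 else s.arr 3 i) →
      (∀ i, s'.low i = if i = j then u else s.low i) → Q t s') :
    Wp N base descend s Q := by
  have hle := hf.le
  have hofs := hf.ofs_le
  have h0 := ofs_mono n cl (Nat.zero_le n)
  have hofs0 : ofs n cl 0 = n + 2 := by simp [ofs]
  suffices h : Wp N base descend s fun t s' => t ≤ 4 * n + 7 ∧ Ready n cl s' ∧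
      Marks n (S.filter fun b => u ∉ cl b) s' ∧ s'.reg 9 = j + 1 ∧
      (∀ i, s'.arr 3 i = if i = j then s.reg 13 else s.arr 3 i) ∧
      (∀ i, s'.low i = if i = j then u else s.low i) from
    h.frame.mono fun t s' ⟨⟨h1, h2, h3, h4, h5, h6⟩, hF⟩ => hQ t s' h1 hF h2 h3 h4 h5 h6
  simp only [descend, wp_seq, wp_store, wp_storeLow, Store.setArr_reg, hj, hu]
  refine ⟨by omega, ?_⟩
  set s1 := (s.setArr 3 j (s.reg 13)).setLow j u with hs1
  have hR1 : Ready n cl s1 := by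
    refine ⟨hR.n_eq, hR.zero, hR.one, fun v hv => ?_, fun v hv i hi => ?_⟩
    · simpa [hs1] using hR.off v hv
    · have := ofs_mono n cl (Nat.zero_le v)
      simp only [hs1, Store.setLow_low, Store.setArr_low]
      rw [if_neg (by omega)]
      exact hR.adj v hv i hi
  have hlen := hcl.length_le hun
  refine wp_scan hf hR1 hun (by simpa [hs1] using hu) (by norm_num) (by decide)
    (fun p s2 => ∀ v < n, s2.arr 4 v = if v ∈ S ∧ v ∉ (cl u).take p then 1 else 0) 1 ?_ ?_ ?_
  · intro s2 harr _ v hv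
    rw [harr]
    simpa [hs1] using hM v hv
  · intro p hp s2 hF2 hI
    have hz2 : s2.reg 2 = 0 := by rw [hF2.reg 2 (by decide)]; exact hR1.zero
    have htake : (cl u).take (p + 1) = (cl u).take p ++ [(cl u)[p]] := by simp
    simp only [wp_store, Store.setReg_reg, Store.setReg_arr, Store.setArr_arr, Nat.reduceEqDiff, if_false,
      if_true, hz2, true_and, htake, List.mem_append, List.mem_singleton]
    refine ⟨le_rfl, fun _ v hv => ?_⟩
    by_cases hvx : v = (cl u)[p]
    · simp [hvx]
    · simp [hvx, hI v hv]
  · intro t s2 ht hF2 hI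
    rw [List.take_length] at hI
    have hR2 := hR1.of_frame hF2 (by decide)
    have h9 : s2.reg 9 = j := by rw [hF2.reg 9 (by decide)]; simpa [hs1] using hj
    have h3 : s2.arr 3 = s1.arr 3 := hF2.arr 3 (by decide)
    have hlow : s2.low = s1.low := hF2.low (by decide)
    simp only [wp_add, h9, hR2.one, Store.setReg_reg, Store.setReg_arr, Store.setReg_low, if_true]
    refine ⟨by omega, by omega, ⟨by simpa using hR2.n_eq, by simpa using hR2.zero, by simpa using hR2.one,
      hR2.off, hR2.adj⟩, fun v hv => ?_, trivial, fun i => ?_, fun i => ?_⟩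
    · have : u ∈ cl v ↔ v ∈ cl u := ⟨hcl.symm v hv u, hcl.symm u hun v⟩
      simp only [Store.setReg_arr, hI v hv, mem_filter, this]
    · rw [h3]; simp [hs1]
    · rw [hlow]; simp [hs1]

end DomSearch

end

/-! ### Traversal of the search tree -/

section

open Finset

namespace DomSearch

open RAM

variable {N base n k : ℕ} {cl : ℕ → List ℕ} {s : Store} {Q : ℕ → Store → Prop}

theorem deg_le (hcl : ClosedLists n cl) {S : Finset ℕ} (hSn : S ⊆ range n) (hS : S.Nonempty) :
    deg cl S ≤ n :=
  (List.length_filter_le _ _).trans (hcl.length_le (mem_range.1 (hSn (isPick_pick hS).1)))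

/-- The first `j` levels of the path `f` have been followed. -/
structure Followed (n k : ℕ) (cl : ℕ → List ℕ) (S : Finset ℕ) (f : ℕ → ℕ) (j : ℕ) (s : Store) :
    Prop where
  ready : Ready n cl s
  reg_one : s.reg 1 = k
  path : s.arr 2 = f
  level : s.reg 9 = j
  level_le : j ≤ k
  num : s.reg 10 = #(sub cl S f j)
  nonempty : ∀ i < j, (sub cl S f i).Nonempty
  degs : ∀ i < j, s.arr 3 i = deg cl (sub cl S f i)
  low : ∀ i < j, s.low i = cand cl (sub cl S f i) (f i)

/-- The time for one level of the search tree. -/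
def levelTime (n : ℕ) (cl : ℕ → List ℕ) : ℕ := 47 * n + 24 * (∑ i ∈ range n, (cl i).length) + 31

theorem wp_level {S : Finset ℕ} {f : ℕ → ℕ} {j : ℕ} (hf : Fits N base n k cl)
    (hcl : ClosedLists n cl) (hSn : S ⊆ range n) (hv : Valid cl k S f) (hjk : j < k)
    (hne : (sub cl S f j).Nonempty) (hP : Followed n k cl S f j s) (hM : Marks n (sub cl S f j) s) :
    Wp N base (refine ;; represent ;; choose ;; descend ;; count) s fun t s' => t ≤ levelTime n cl ∧
      Followed n k cl S f (j + 1) s' ∧ Marks n (sub cl S f (j + 1)) s' ∧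
      s'.reg 22 = (if (sub cl S f (j + 1)).Nonempty ∧ j + 1 < k then 1 else 0) := by
  have hsn : sub cl S f j ⊆ range n := (sub_subset _ _ _).trans hSn
  have hjn : j < n := by
    have h1 := card_sub_add_le hv hjk.le hP.nonempty
    have h2 := card_le_card hSn
    rw [card_range] at h2
    have := card_pos.2 hne
    omega
  simp only [wp_seq]
  refine wp_refine hf hcl hP.ready hsn hM fun t1 s1 ht1 hF1 hcls hmark => ?_
  have hR1 := hP.ready.of_frame hF1 (by decide)
  refine wp_represent hf hR1 hcls hmark fun t2 s2 ht2 hF2 hrep => ?_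
  have hR2 := hR1.of_frame hF2 (by decide)
  have hM2 : Marks n (sub cl S f j) s2 := fun v hv => by
    rw [hF2.arr 4 (by decide), hF1.arr 4 (by decide)]; exact hM v hv
  have h92 : s2.reg 9 = j := by rw [hF2.reg 9 (by decide), hF1.reg 9 (by decide)]; exact hP.level
  have hidx2 : s2.arr 2 = f := by rw [hF2.arr 2 (by decide), hF1.arr 2 (by decide)]; exact hP.path
  refine wp_choose hf hcl hR2 hsn hne hM2 hrep (by rw [hidx2, h92]) fun t3 s3 ht3 hF3 h13 h14 => ?_
  have hR3 := hR2.of_frame hF3 (by decide)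
  have hM3 : Marks n (sub cl S f j) s3 := fun v hv => by
    rw [hF3.arr 4 (by decide)]; exact hM2 v hv
  have h93 : s3.reg 9 = j := by rw [hF3.reg 9 (by decide)]; exact h92
  have hfj := hv j hjk hne
  have hp := (isPick_pick (cl := cl) hne).1
  have hun : cand cl (sub cl S f j) (f j) < n :=
    hcl.lt _ (mem_range.1 (hsn hp)) _ (mem_cands.1 (cand_mem hfj)).1
  refine wp_descend hf hcl hR3 hM3 h93 (h14 hfj) hun hjn
    fun t4 s4 ht4 hF4 hR4 hM4 h94 h34 hlow4 => ?_
  have h14 : s4.reg 1 = k := by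
    rw [hF4.reg 1 (by decide), hF3.reg 1 (by decide), hF2.reg 1 (by decide), hF1.reg 1 (by decide)]
    exact hP.reg_one
  refine wp_count hf hR4 ((child_subset _ _).trans hsn) hM4 h14 h94 fun t5 s5 ht5 hF5 h10 h22 => ?_
  have e : ∀ i, s4.arr 3 i = if i = j then deg cl (sub cl S f j) else s.arr 3 i := fun i => by
    rw [h34, h13, hF3.arr 3 (by decide), hF2.arr 3 (by decide), hF1.arr 3 (by decide)]
  have el : ∀ i, s4.low i = if i = j then cand cl (sub cl S f j) (f j) else s.low i := fun i => by
    rw [hlow4, hF3.low (by decide), hF2.low (by decide), hF1.low (by decide)]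
  refine ⟨by unfold levelTime; omega, ⟨hR4.of_frame hF5 (by decide), ?_, ?_, ?_, hjk, h10, fun i hi => ?_,
    fun i hi => ?_, fun i hi => ?_⟩, fun v hv => ?_, h22⟩
  · rw [hF5.reg 1 (by decide)]; exact h14
  · rw [hF5.arr 2 (by decide), hF4.arr 2 (by decide), hF3.arr 2 (by decide)]; exact hidx2
  · rw [hF5.reg 9 (by decide)]; exact h94
  · rcases Nat.lt_succ_iff_lt_or_eq.1 hi with hi | rfl
    · exact hP.nonempty i hi
    · exact hne
  · rw [hF5.arr 3 (by decide), e]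
    rcases Nat.lt_succ_iff_lt_or_eq.1 hi with hi | rfl
    · rw [if_neg hi.ne]; exact hP.degs i hi
    · rw [if_pos rfl]
  · rw [hF5.low (by decide), el]
    rcases Nat.lt_succ_iff_lt_or_eq.1 hi with hi | rfl
    · rw [if_neg hi.ne]; exact hP.low i hi
    · rw [if_pos rfl]
  · rw [hF5.arr 4 (by decide)]; exact hM4 v hv

theorem wp_followPath {S : Finset ℕ} {f : ℕ → ℕ} (hf : Fits N base n k cl) (hcl : ClosedLists n cl)
    (hR : Ready n cl s) (hSn : S ⊆ range n) (hk : s.reg 1 = k)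
    (hcol : ∀ v < n, s.arr 1 v = if v ∈ S then 1 else 0) (hpath : s.arr 2 = f) (hv : Valid cl k S f)
    (hQ : ∀ t s' j, t ≤ 9 * n + 14 + k * (levelTime n cl + 1) → Frame followPath s s' →
      Followed n k cl S f j s' → (j = k ∨ sub cl S f j = ∅) → Q t s') :
    Wp N base followPath s Q := by
  have hle := hf.le
  suffices h : Wp N base followPath s fun t s' => t ≤ 9 * n + 14 + k * (levelTime n cl + 1) ∧
      ∃ j, Followed n k cl S f j s' ∧ (j = k ∨ sub cl S f j = ∅) from
    h.frame.mono fun t s' ⟨⟨ht, j, h1, h2⟩, hF⟩ => hQ t s' j ht hF h1 h2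
  simp only [followPath, wp_seq]
  refine wp_forVertices hf hR.n_eq hR.one (by decide)
    (fun i s' => ∀ v < i, s'.arr 4 v = if v ∈ S then 1 else 0) (fun _ => 2) (by simp) ?_ ?_
  · intro i hi s' hF h4 h
    have h1 : s'.arr 1 = s.arr 1 := hF.arr 1 (by decide)
    simp only [wp_seq, wp_load, wp_store, Store.setReg_reg, Store.setReg_arr, Store.setArr_arr, h4, h1,
      hcol i hi, Nat.reduceEqDiff, if_false, if_true, true_and]
    refine ⟨by omega, fun _ v hv => ?_⟩
    by_cases hvi : v = i
    · simp [hvi]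
    · simp [hvi, h v (by omega)]
  intro t1 s1 ht1 hF1 _ hM1
  have hR1 := hR.of_frame hF1 (by decide)
  have hk1 : s1.reg 1 = k := by rw [hF1.reg 1 (by decide)]; exact hk
  have hpath1 : s1.arr 2 = f := by rw [hF1.arr 2 (by decide)]; exact hpath
  rw [wp_const]
  refine ⟨by omega, wp_count (j := 0) hf ⟨by simpa using hR1.n_eq, by simpa using hR1.zero,
    by simpa using hR1.one, hR1.off, hR1.adj⟩ hSn hM1 (by simpa using hk1) (by simp)
    fun t2 s2 ht2 hF2 h10 h22 => ?_⟩
  -- The measure is the number `k - j` of levels still available.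
  refine wp_while (fun m s' => ∃ j, j + m = k ∧ Followed n k cl S f j s' ∧ Marks n (sub cl S f j) s' ∧
      s'.reg 22 = (if (sub cl S f j).Nonempty ∧ j < k then 1 else 0)) (levelTime n cl) k ?_ ?_ ?_
  · refine ⟨0, by omega, ⟨?_, ?_, ?_, ?_, by omega, h10, by simp, by simp, by simp⟩, fun v hv => ?_, h22⟩
    · refine ⟨?_, ?_, ?_, fun v hv => ?_, fun v hv i hi => ?_⟩
      · rw [hF2.reg 0 (by decide)]; simpa using hR1.n_eq
      · rw [hF2.reg 2 (by decide)]; simpa using hR1.zero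
      · rw [hF2.reg 3 (by decide)]; simpa using hR1.one
      · rw [hF2.arr 0 (by decide)]; exact hR1.off v hv
      · rw [hF2.low (by decide)]; exact hR1.adj v hv i hi
    · rw [hF2.reg 1 (by decide)]; simpa using hk1
    · rw [hF2.arr 2 (by decide)]; exact hpath1
    · rw [hF2.reg 9 (by decide)]; simp
    · rw [hF2.arr 4 (by decide)]; exact hM1 v hv
  · rintro m s' ⟨j, hjm, hP, hM, h22⟩ hlt
    rw [hP.ready.zero, h22] at hlt
    have hcond : (sub cl S f j).Nonempty ∧ j < k := by
      by_contra h; simp [h] at hlt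
    refine (wp_level hf hcl hSn hv hcond.2 hcond.1 hP hM).mono fun t s'' ⟨ht, h1, h2, h3⟩ => ?_
    exact ⟨ht, m - 1, by omega, j + 1, by omega, h1, h2, h3⟩
  · rintro t3 s3 m ht3 ⟨j, hjm, hP, hM, h22⟩ hlt
    refine ⟨?_, j, hP, ?_⟩
    · simp only [sum_const, card_range, smul_eq_mul] at ht1
      omega
    · by_contra hcon
      push Not at hcon
      rw [hP.ready.zero, h22,
        if_pos ⟨hcon.2, lt_of_le_of_ne hP.level_le hcon.1⟩] at hlt
      omega

/-- As in incrementing a counter, positions are visited from the last one downwards. Exhausted ones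
are reset to 0, and the first one that can still grow is increased. -/
theorem wp_nextPath {f d : ℕ → ℕ} (hf : Fits N base n k cl) (hR : Ready n cl s) (hj : s.reg 9 = k)
    (hpath : s.arr 2 = f) (hdeg : ∀ i < k, s.arr 3 i = d i) (hfN : ∀ i < k, f i + 1 ≤ N)
    (hf0 : ∀ i, k ≤ i → f i = 0)
    (hQ : ∀ t s', t ≤ 10 * k + 3 → Frame nextPath s s' →
      (s'.reg 18 = 0 ∧ ∀ i < k, d i ≤ f i + 1) ∨ (s'.reg 18 = 1 ∧ ∃ p < k, f p + 1 < d p ∧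
        (∀ i < k, p < i → d i ≤ f i + 1) ∧ s'.arr 2 = incr f p) → Q t s') :
    Wp N base nextPath s Q := by
  have hle := hf.le
  have hkN := hf.k_le
  suffices h : Wp N base nextPath s fun t s' => t ≤ 10 * k + 3 ∧
      ((s'.reg 18 = 0 ∧ ∀ i < k, d i ≤ f i + 1) ∨ (s'.reg 18 = 1 ∧ ∃ p < k, f p + 1 < d p ∧
        (∀ i < k, p < i → d i ≤ f i + 1) ∧ s'.arr 2 = incr f p)) from
    h.frame.mono fun t s' ⟨⟨ht, h1⟩, hF⟩ => hQ t s' ht hF h1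
  simp only [nextPath, wp_seq, wp_const, wp_add, Store.setReg_reg, Nat.reduceEqDiff, if_false, hj,
    hR.zero]
  refine ⟨by omega, by omega, ?_⟩
  refine wp_while (fun m s' => s'.reg 2 = 0 ∧ s'.reg 3 = 1 ∧ (∀ i < k, s'.arr 3 i = d i) ∧
    ((s'.reg 18 = 0 ∧ s'.reg 20 = m ∧ m ≤ k ∧ (∀ i < k, m ≤ i → d i ≤ f i + 1) ∧
      ∀ i, s'.arr 2 i = if i < m then f i else 0) ∨
    (s'.reg 18 = 1 ∧ s'.reg 20 = 0 ∧ ∃ p < k, f p + 1 < d p ∧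
        (∀ i < k, p < i → d i ≤ f i + 1) ∧ s'.arr 2 = incr f p))) 9 k ?_ ?_ ?_
  · refine ⟨by simpa using hR.zero, by simpa using hR.one, hdeg, Or.inl ⟨by simp, by simp, le_rfl,
      fun i h1 h2 => by omega, fun i => ?_⟩⟩
    simp only [Store.setReg_arr, hpath]
    split_ifs with h
    · rfl
    · exact hf0 i (by omega)
  · rintro m s' ⟨hz, ho, hd, h⟩ hlt
    rcases h with ⟨h18, h20, hmk, hlast, harr⟩ | ⟨_, h20, _⟩
    · have hm0 : 0 < m := by omega
      have hfm := hfN (m - 1) (by omega)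
      simp only [wp_seq, wp_load, wp_add, wp_sub, wp_ifLt, wp_store, wp_const, Store.setReg_reg,
        Store.setReg_arr, Store.setArr_reg, Store.setArr_arr, h18, h20, hz, ho, Nat.reduceEqDiff, if_false, if_true,
        harr, hd (m - 1) (by omega), show m - 1 < m by omega, true_and]
      refine ⟨by omega, fun hlt' => ⟨by omega, by omega, by omega, 0, hm0, ?_⟩, fun hge =>
        ⟨by omega, m - 1, by omega, ?_⟩⟩
      · refine ⟨by simpa using hd, Or.inr ⟨m - 1, by omega, hlt', fun i hi hmi => hlast i hi (by omega), ?_⟩⟩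
        funext i
        simp only [Store.setArr_arr, Store.setReg_arr, true_and, harr, incr]
        rcases lt_trichotomy i (m - 1) with h | rfl | h
        · simp [h, h.ne, show i < m by omega]
        · simp
        · simp [show ¬ i < m - 1 by omega, h.ne', show ¬ i < m by omega]
      · refine ⟨by simpa using hd, Or.inl ⟨by omega, by omega, fun i hi hmi => ?_, fun i => ?_⟩⟩
        · rcases Nat.eq_or_lt_of_le hmi with rfl | h
          · omega
          · exact hlast i hi (by omega)
        · rcases lt_trichotomy i (m - 1) with h | rfl | h
          · simp [h, h.ne, show i < m by omega]
          · simp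
          · simp [show ¬ i < m - 1 by omega, h.ne', show ¬ i < m by omega]
    · omega
  · rintro t s' m ht ⟨hz, ho, hd, h⟩ hlt
    refine ⟨by omega, ?_⟩
    rcases h with ⟨h18, h20, hmk, hlast, harr⟩ | ⟨h18, h20, h⟩
    · exact Or.inl ⟨h18, fun i hi => hlast i hi (by omega)⟩
    · exact Or.inr ⟨h18, h⟩

/-- The time for one path in the search tree. -/
def pathTime (n k : ℕ) (cl : ℕ → List ℕ) : ℕ := 9 * n + 20 + k * (levelTime n cl + 11)

theorem wp_search {S : Finset ℕ} {D : ℕ} (hf : Fits N base n k cl) (hcl : ClosedLists n cl)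
    (hSn : S ⊆ range n) (hD0 : 0 < D) (hD : ∀ S ⊆ range n, S.Nonempty → deg cl S ≤ D)
    (hin : Input n k S cl s) (hidx : ∀ i, s.arr 2 i = 0)
    (hQ : ∀ t s', t ≤ 15 * n + 18 + D ^ k * (pathTime n k cl + 1) → s'.reg 2 = 0 →
      (s'.reg 19 = 0 ∧ ¬ Sol n cl S k) ∨ (s'.reg 19 = 1 ∧ ∃ f j, Valid cl k S f ∧
        Followed n k cl S f j s' ∧ sub cl S f j = ∅) → Q t s') :
    Wp N base search s Q := by
  have hle := hf.le
  simp only [search, wp_seq]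
  refine wp_prelude hf hin fun t1 s1 ht1 hR1 hk1 hcol1 hidx1 => ?_
  simp only [wp_const]
  refine ⟨by omega, by omega, ?_⟩
  -- While the search runs, the measure is `rest` of the current path, and the unseen part contains
  -- a solution exactly if there is one at all. The starting value is at most `D ^ k`.
  refine wp_while (fun m s' => (s'.reg 18 = 1 ∧ s'.reg 19 = 0 ∧ Ready n cl s' ∧ s'.reg 1 = k ∧
      (∀ v < n, s'.arr 1 v = if v ∈ S then 1 else 0) ∧ ∃ f, s'.arr 2 = f ∧ rest cl D k S f = m ∧
      Valid cl k S f ∧ (∀ i, k ≤ i → f i = 0) ∧ (Rem n cl k S f ↔ Sol n cl S k)) ∨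
    (s'.reg 18 = 0 ∧ s'.reg 2 = 0 ∧ ((s'.reg 19 = 0 ∧ ¬ Sol n cl S k) ∨ (s'.reg 19 = 1 ∧
      ∃ f j, Valid cl k S f ∧ Followed n k cl S f j s' ∧ sub cl S f j = ∅))))
    (pathTime n k cl) (rest cl D k S fun _ => 0) ?_ ?_ ?_
  · refine Or.inl ⟨by simp, by simp, ⟨by simpa using hR1.n_eq, by simpa using hR1.zero,
      by simpa using hR1.one, hR1.off, hR1.adj⟩, by simpa using hk1, hcol1, _, ?_, rfl,
      valid_zero hcl hSn, fun _ _ => rfl, rem_zero hcl k hSn⟩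
    funext i
    simp [hidx1, hidx]
  · rintro m s' h hlt
    rcases h with ⟨h18, h19, hR, hk, hcol, f, hpath, hm, hv, hf0, hrem⟩ | ⟨h18, h2, _⟩
    swap
    · omega
    rw [wp_seq]
    refine wp_followPath hf hcl hR hSn hk hcol hpath hv fun t2 s2 j ht2 hF2 hP hend => ?_
    have hz2 := hP.ready.zero
    have h182 : s2.reg 18 = 1 := by rw [hF2.reg 18 (by decide)]; exact h18
    have h192 : s2.reg 19 = 0 := by rw [hF2.reg 19 (by decide)]; exact h19
    have hmpos : 0 < m := hm ▸ rest_pos D k S f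
    rw [wp_ifLt, hz2, hP.num]
    refine ⟨fun hpos => ?_, fun hpos => ?_⟩
    · rw [card_pos] at hpos
      obtain rfl : j = k := hend.resolve_right hpos.ne_empty
      have hne : ∀ i ≤ j, (sub cl S f i).Nonempty := fun i hi => by
        rcases Nat.lt_or_eq_of_le hi with hi | rfl
        · exact hP.nonempty i hi
        · exact hpos
      refine wp_nextPath (d := fun i => deg cl (sub cl S f i)) hf hP.ready hP.level hP.path hP.degs
        (fun i hi => ?_) hf0 fun t3 s3 ht3 hF3 h => ?_
      · have h1 := hv i hi (hne i hi.le)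
        have h2 := deg_le hcl ((sub_subset (cl := cl) S f i).trans hSn) (hne i hi.le)
        omega
      · have h193 : s3.reg 19 = 0 := by rw [hF3.reg 19 (by decide)]; exact h192
        have hR3 := hP.ready
        refine ⟨by unfold pathTime; nlinarith, ?_⟩
        rcases h with ⟨h18', hlast⟩ | ⟨h18', p, hp, hlt', hlast, hpath'⟩
        · refine ⟨0, hmpos, Or.inr ⟨h18', ?_, Or.inl ⟨h193, ?_⟩⟩⟩
          · rw [hF3.reg 2 (by decide)]; exact hz2
          · rw [← hrem]
            exact not_rem_of_last hne hlast
        · refine ⟨_, hm ▸ rest_incr_lt hSn hD hne hp hlt', Or.inl ⟨h18', h193, ⟨?_, ?_, ?_, ?_, ?_⟩, ?_,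
            fun v hv => ?_, _, hpath', rfl, hv.incr hcl hSn hlt', fun i hi => ?_,
            (rem_incr hcl hSn hne hp hlast hlt').trans hrem⟩⟩
          · rw [hF3.reg 0 (by decide)]; exact hR3.n_eq
          · rw [hF3.reg 2 (by decide)]; exact hR3.zero
          · rw [hF3.reg 3 (by decide)]; exact hR3.one
          · rw [hF3.arr 0 (by decide)]; exact hR3.off
          · rw [hF3.low (by decide)]; exact hR3.adj
          · rw [hF3.reg 1 (by decide)]; exact hP.reg_one
          · rw [hF3.arr 1 (by decide), hF2.arr 1 (by decide)]; exact hcol v hv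
          · simp [incr, show ¬ i < p by omega, show i ≠ p by omega]
    · have hemp : sub cl S f j = ∅ := by rw [← card_eq_zero]; omega
      simp only [wp_seq, wp_const]
      refine ⟨by omega, by omega, by unfold pathTime; nlinarith, 0, hmpos, Or.inr ⟨by simp, by simpa using hz2,
        Or.inr ⟨by simp, f, j, hv, ⟨?_, ?_, hP.path, ?_, hP.level_le, ?_, hP.nonempty, hP.degs, hP.low⟩,
          hemp⟩⟩⟩
      · exact ⟨by simpa using hP.ready.n_eq, by simpa using hz2, by simpa using hP.ready.one,
          hP.ready.off, hP.ready.adj⟩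
      · simpa using hP.reg_one
      · simpa using hP.level
      · simpa using hP.num
  · rintro t s' m ht h hlt
    have hrest := rest_le (cl := cl) hD0 k S fun _ => 0
    have hmul : rest cl D k S (fun _ => 0) * (pathTime n k cl + 1) ≤ D ^ k * (pathTime n k cl + 1) :=
      Nat.mul_le_mul_right _ hrest
    rcases h with ⟨h18, _, hR, _⟩ | ⟨_, h2, h⟩
    · have := hR.zero; omega
    · exact hQ _ s' (by omega) h2 h

end DomSearch

end

section

open Finset

namespace BlackWhite

open SimpleGraph DomSearch

variable {n k h : ℕ} {G : SimpleGraph (Fin n)} {B : Finset (Fin n)} {adj : Fin n → List (Fin n)}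

/-! ### From adjacency lists to closed neighbourhoods -/

/-- The closed neighbourhoods of the vertices. -/
def closedLists (adj : Fin n → List (Fin n)) (v : ℕ) : List ℕ :=
  if hv : v < n then v :: (adj ⟨v, hv⟩).map Fin.val else []

theorem closedLists_coe (adj : Fin n → List (Fin n)) (v : Fin n) :
    closedLists adj v = v.val :: (adj v).map Fin.val := by
  simp [closedLists]

theorem coe_mem_closedLists (hadj : IsAdjacencyList G adj) {u v : Fin n} :
    u.val ∈ closedLists adj v ↔ u = v ∨ G.Adj v u := by
  rw [closedLists_coe, List.mem_cons, List.mem_map_of_injective Fin.val_injective, (hadj v).2,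
    Fin.val_inj]

theorem lt_of_mem_closedLists {v x : ℕ} (h : x ∈ closedLists adj v) : x < n := by
  unfold closedLists at h
  split_ifs at h with hv
  · rcases List.mem_cons.1 h with rfl | h
    · exact hv
    · obtain ⟨u, _, rfl⟩ := List.mem_map.1 h
      exact u.2
  · simp at h

theorem closedLists_spec (hadj : IsAdjacencyList G adj) : ClosedLists n (closedLists adj) where
  nodup v hv := by
    rw [closedLists, dif_pos hv, List.nodup_cons]
    refine ⟨fun hm => ?_, (hadj _).1.map Fin.val_injective⟩
    obtain ⟨u, hu, he⟩ := List.mem_map.1 hm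
    exact G.ne_of_adj (((hadj _).2 u).1 hu) (Fin.ext he.symm)
  lt v _ x hx := lt_of_mem_closedLists hx
  self v hv := by simp [closedLists, hv]
  symm v hv x hx := by
    have hxn := lt_of_mem_closedLists hx
    have h1 := (coe_mem_closedLists hadj (u := ⟨x, hxn⟩) (v := ⟨v, hv⟩)).1 hx
    exact (coe_mem_closedLists hadj (u := ⟨v, hv⟩) (v := ⟨x, hxn⟩)).2
      (h1.imp Eq.symm SimpleGraph.Adj.symm)

theorem sum_length_closedLists_le (hG : G.CompleteMinorFree h) (hadj : IsAdjacencyList G adj) :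
    ∑ v ∈ range n, (closedLists adj v).length ≤ n + 2 * edgeConst h * n := by
  classical
  have h1 := hG.card_adj_le n G (Fintype.card_fin n)
  have h2 := card_adj_eq_sum_degree G
  have h3 : ∀ v, (adj v).length = G.degree v := fun v => by
    rw [← List.toFinset_card_of_nodup (hadj v).1, ← card_neighborFinset_eq_degree]
    congr 1
    ext u
    simp [(hadj v).2]
  rw [sum_range]
  simp only [closedLists_coe, List.length_cons, List.length_map, sum_add_distrib, h3, ← h2]
  simp only [sum_const, card_univ, Fintype.card_fin, smul_eq_mul, mul_one]
  have h4 : #{p : Fin n × Fin n | G.Adj p.1 p.2} ≤ 2 * edgeConst h * n := by convert h1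
  omega

/-- Representatives have pairwise different traces, so the candidates of a vertex are at most as
many as the traces of its closed neighbours. The graph theorem supplies a vertex with few of them,
and `pick` has no more candidates than that vertex. -/
theorem deg_closedLists_le (hG : G.CompleteMinorFree h) (hadj : IsAdjacencyList G adj)
    {S : Finset ℕ} (hSn : S ⊆ range n) (hS : S.Nonempty) :
    deg (closedLists adj) S ≤ branchConst h := by
  classical
  set cl := closedLists adj with hcl
  set T : Finset (Fin n) := {v | v.val ∈ S} with hT
  have hTne : T.Nonempty := by
    obtain ⟨b, hb⟩ := hS
    exact ⟨⟨b, mem_range.1 (hSn hb)⟩, by simpa [hT] using hb⟩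
  obtain ⟨b, hbT, hb⟩ := hG.exists_card_image_domSet_le T hTne
  have hbS : b.val ∈ S := by simpa [hT] using hbT
  have hsig : ∀ v : Fin n, sig cl S v = (G.domSet T v).map Fin.valEmbedding := by
    intro v
    ext x
    simp only [mem_sig, mem_map, mem_domSet, Fin.valEmbedding_apply]
    constructor
    · rintro ⟨hxS, hx⟩
      refine ⟨⟨x, mem_range.1 (hSn hxS)⟩, ⟨by simpa [hT] using hxS, ?_⟩, rfl⟩
      exact ((coe_mem_closedLists hadj (v := ⟨x, mem_range.1 (hSn hxS)⟩)).1 hx).imp Eq.symm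
        SimpleGraph.Adj.symm
    · rintro ⟨y, ⟨hyT, hy⟩, rfl⟩
      exact ⟨by simpa [hT] using hyT,
        (coe_mem_closedLists hadj).2 (hy.imp Eq.symm SimpleGraph.Adj.symm)⟩
  have hpick : deg cl S ≤ (cands cl S b).length := by
    rcases (isPick_pick (cl := cl) hS).2 b hbS with h | h
    · exact h.le
    · exact h.1.le
  refine hpick.trans (le_trans ?_ hb)
  have hnd : (cands cl S b).Nodup := ((closedLists_spec hadj).nodup b b.2).filter _
  rw [← List.toFinset_card_of_nodup hnd]
  have hinj : Set.InjOn (sig cl S) (cands cl S b).toFinset := by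
    intro x hx y hy hxy
    simp only [List.coe_toFinset, Set.mem_ofPred_eq, mem_cands] at hx hy
    rcases lt_trichotomy x y with hlt | rfl | hlt
    · exact absurd hxy (hy.2 x hlt)
    · rfl
    · exact absurd hxy.symm (hx.2 y hlt)
  rw [← card_image_of_injOn hinj]
  refine le_trans (card_le_card ?_) (card_image_le (f := Finset.map Fin.valEmbedding))
  intro T' hT'
  obtain ⟨x, hx, rfl⟩ := mem_image.1 hT'
  have hx' := (mem_cands.1 (List.mem_toFinset.1 hx)).1
  refine mem_image.2 ⟨G.domSet T ⟨x, lt_of_mem_closedLists hx'⟩, ?_, (hsig _).symm⟩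
  simp only [mem_image]
  refine ⟨_, ?_, rfl⟩
  simpa using (coe_mem_closedLists hadj (u := ⟨x, lt_of_mem_closedLists hx'⟩)).1 hx'

/-! ### The input -/

theorem length_flatMap_range (f : ℕ → List ℕ) (m : ℕ) :
    ((List.range m).flatMap f).length = ∑ u ∈ range m, (f u).length := by
  induction m with
  | zero => simp
  | succ m ih =>
    rw [List.range_succ, List.flatMap_append, List.length_append, ih, sum_range_succ]
    simp

theorem getElem?_flatMap_range (f : ℕ → List ℕ) {m v i : ℕ} (hv : v < m) (hi : i < (f v).length) :
    ((List.range m).flatMap f)[∑ u ∈ range v, (f u).length + i]? = (f v)[i]? := by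
  induction m with
  | zero => omega
  | succ m ih =>
    rw [List.range_succ, List.flatMap_append]
    rcases Nat.lt_succ_iff_lt_or_eq.1 hv with h | rfl
    · rw [List.getElem?_append_left, ih h]
      rw [length_flatMap_range]
      have := sum_le_sum_of_subset (f := fun u => (f u).length)
        (range_subset_range.2 (show v + 1 ≤ m from h))
      rw [sum_range_succ] at this
      omega
    · rw [List.getElem?_append_right (by rw [length_flatMap_range]; omega), length_flatMap_range]
      simp

/-- The adjacency list of a vertex, preceded by its length. -/
def lengthList (adj : Fin n → List (Fin n)) (v : ℕ) : List ℕ :=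
  if hv : v < n then (adj ⟨v, hv⟩).length :: (adj ⟨v, hv⟩).map Fin.val else []

theorem length_lengthList (adj : Fin n → List (Fin n)) (v : ℕ) :
    (lengthList adj v).length = (closedLists adj v).length := by
  unfold lengthList closedLists
  split_ifs <;> simp

theorem encode_eq (B : Finset (Fin n)) (adj : Fin n → List (Fin n)) (k : ℕ) :
    encode B adj k = ([n, k] ++ (List.finRange n).map (fun v => if v ∈ B then 1 else 0)) ++
      (List.range n).flatMap (lengthList adj) := by
  rw [encode, ← List.map_coe_finRange_eq_range, List.flatMap_map]
  congr 1
  exact List.flatMap_congr fun v _ => by simp [lengthList]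

theorem encode_ofs (B : Finset (Fin n)) (adj : Fin n → List (Fin n)) (k : ℕ) {v i : ℕ} (hv : v < n)
    (hi : i < (closedLists adj v).length) :
    (encode B adj k)[ofs n (closedLists adj) v + i]? = (lengthList adj v)[i]? := by
  rw [← length_lengthList] at hi
  rw [encode_eq, List.getElem?_append_right (by simp [ofs]; omega), ← getElem?_flatMap_range _ hv hi]
  congr 1
  simp [ofs, length_lengthList]
  omega

theorem length_encode (B : Finset (Fin n)) (adj : Fin n → List (Fin n)) (k : ℕ) :
    (encode B adj k).length = ofs n (closedLists adj) n := by
  rw [encode_eq]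
  simp only [List.length_append, length_flatMap_range, List.length_map, List.length_finRange,
    List.length_cons, List.length_nil, length_lengthList, ofs]
  ring

theorem getD_encode_le (hadj : IsAdjacencyList G adj) (i : ℕ) :
    (encode B adj k).getD i 0 ≤ n + k + 1 := by
  have hmem : ∀ x ∈ encode B adj k, x ≤ n + k + 1 := by
    intro x hx
    simp only [encode, List.mem_append, List.mem_cons, List.not_mem_nil, or_false, List.mem_map,
      List.mem_flatMap] at hx
    rcases hx with ((rfl | rfl) | ⟨v, _, rfl⟩) | ⟨v, _, rfl | ⟨u, _, rfl⟩⟩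
    · omega
    · omega
    · split_ifs <;> omega
    · have := (hadj v).1.length_le_card
      simp at this
      omega
    · omega
  rw [List.getD_eq_getElem?_getD]
  rcases hi : (encode B adj k)[i]? with _ | x
  · simp
  · simpa using hmem x (List.mem_of_getElem? hi)

theorem input_encode {s : RAM.Store}
    (hs : ∀ i, s.low i = (encode B adj k).getD i 0) :
    Input n k (B.map Fin.valEmbedding) (closedLists adj) s where
  low_zero := by simp [hs, encode]
  low_one := by simp [hs, encode]
  colour v hv := by
    rw [hs, encode, List.getD_eq_getElem?_getD, List.append_assoc, List.getElem?_append_right (by simp),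
      List.getElem?_append_left (by simpa using hv)]
    simp [hv]
    congr 1
    refine propext ⟨fun h => ⟨_, h, rfl⟩, ?_⟩
    rintro ⟨u, hu, rfl⟩
    exact hu
  head v hv h := by simp [closedLists, hv]
  degree v hv := by
    have h0 : 0 < (closedLists adj v).length := by simp [closedLists, hv]
    have := encode_ofs B adj k hv h0
    rw [add_zero] at this
    rw [hs, List.getD_eq_getElem?_getD, this]
    simp [lengthList, closedLists, hv]
  adj v hv i hi := by
    rw [hs, List.getD_eq_getElem?_getD, encode_ofs B adj k hv hi]
    have : i < (adj ⟨v, hv⟩).length := by simpa [closedLists, hv] using hi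
    simp [lengthList, closedLists, hv, this]

/-- The input takes `n + 2` cells and at most `n` more per vertex, so arrays may start at `(n + 2) ^
2`, a number that the machine can compute from `n` alone. -/
theorem fits_closedLists (hadj : IsAdjacencyList G adj) (k : ℕ) :
    Fits ((n + k + 2) ^ 2) ((n + 2) ^ 2) n k (closedLists adj) where
  ofs_le := by
    have h1 : ∑ u ∈ range n, (closedLists adj u).length ≤ ∑ u ∈ range n, n :=
      sum_le_sum fun u hu => (closedLists_spec hadj).length_le (mem_range.1 hu)
    simp only [sum_const, card_range, smul_eq_mul] at h1
    rw [ofs]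
    nlinarith
  base_le := Nat.pow_le_pow_left (by omega) 2
  n_le := Nat.pow_le_pow_left (by omega) 2
  k_le := by rw [sq]; nlinarith [Nat.zero_le (n * k)]

/-! ### The output -/

theorem correctAnswer_none (hadj : IsAdjacencyList G adj)
    (h : ¬ Sol n (closedLists adj) (B.map Fin.valEmbedding) k) : CorrectAnswer G B k none := by
  rintro ⟨U, hU, hUk⟩
  refine h ⟨U.map Fin.valEmbedding, fun x hx => ?_, by simpa using hUk, fun b hb => ?_⟩
  · obtain ⟨u, _, rfl⟩ := mem_map.1 hx
    simp
  · obtain ⟨v, hv, rfl⟩ := mem_map.1 hb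
    by_cases hvU : v ∈ U
    · exact ⟨v, mem_map_of_mem _ hvU, (coe_mem_closedLists hadj).2 (Or.inl rfl)⟩
    · obtain ⟨u, hu, huv⟩ := hU v hv hvU
      exact ⟨u, mem_map_of_mem _ hu, (coe_mem_closedLists hadj).2 (Or.inr huv)⟩

theorem correctAnswer_some (hadj : IsAdjacencyList G adj) {l : List ℕ} (hl : l.Nodup)
    (hln : ∀ u ∈ l, u < n) (hlk : l.length ≤ k)
    (hd : ∀ b ∈ B.map Fin.valEmbedding, ∃ u ∈ l, u ∈ closedLists adj b) :
    CorrectAnswer G B k (some l) := by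
  have hmem : ∀ a, a ∈ l ↔ ∃ u ∈ ({v | v.val ∈ l} : Finset (Fin n)), u.val = a := by
    intro a
    refine ⟨fun ha => ⟨⟨a, hln a ha⟩, by simpa using ha, rfl⟩, ?_⟩
    rintro ⟨u, hu, rfl⟩
    simpa using hu
  refine ⟨({v | v.val ∈ l} : Finset (Fin n)), fun v hv hvU => ?_, ?_, hl, hmem⟩
  · obtain ⟨u, hu, huv⟩ := hd v (mem_map_of_mem _ hv)
    obtain ⟨w, hw, rfl⟩ := (hmem u).1 hu
    rcases (coe_mem_closedLists hadj).1 huv with rfl | h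
    · exact absurd hw hvU
    · exact ⟨w, hw, h⟩
  · refine le_trans (le_of_eq ?_) hlk
    rw [← List.toFinset_card_of_nodup hl, ← card_map Fin.valEmbedding]
    congr 1
    ext a
    simp [hmem a]

end BlackWhite

end

section

open Finset

namespace RAM

/-! ### The machine program -/

/-- Code that sets the register `0` to `(n + 2) ^ 2`, where `n` is the number at address `0`. -/
def setupCode : List Instr :=
  [.const 1 0, .load 2 1, .const 1 2, .add 1 1 2, .const 4 1, .add 0 0 1, .add 3 3 4, .jumpLt 3 1 5]

/-- Code that puts the output in place. -/
def finishCode : List Instr := [.add 0 22 5, .const 1 0, .add 2 12 5]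

variable {P : Program} {M : ℕ}

theorem Config.FitsIn.setReg {σ : Config} (h : σ.FitsIn M) (p d : ℕ) {v : ℕ} (hv : v ≤ M) :
    Config.FitsIn ⟨p, Function.update σ.reg d v, σ.mem⟩ M := by
  refine ⟨fun r => ?_, h.2⟩
  by_cases hr : r = d
  · subst hr; simpa using hv
  · simpa [Function.update_of_ne hr] using h.1 r

theorem codeAt_setupCode_append (code : List Instr) :
    CodeAt (setupCode ++ code ++ finishCode) 0 setupCode ∧
    CodeAt (setupCode ++ code ++ finishCode) 8 code ∧
    CodeAt (setupCode ++ code ++ finishCode) (8 + code.length) finishCode ∧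
    (setupCode ++ code ++ finishCode).length = 8 + code.length + 3 := by
  have h : CodeAt (setupCode ++ code ++ finishCode) 0 (setupCode ++ code ++ finishCode) :=
    fun i _ => by rw [zero_add]
  have h1 := h.left.right
  have h2 := h.right
  rw [zero_add] at h1 h2
  rw [List.length_append] at h2
  exact ⟨h.left.left, h1, h2, by simp [setupCode, finishCode]; omega⟩

theorem reaches_setupLoop (hP : CodeAt P 0 setupCode) (w : ℕ) :
    ∀ (m : ℕ) (σ : Config), σ.FitsIn M → σ.pc = 5 → σ.reg 1 = w → σ.reg 4 = 1 →
      σ.reg 3 + (m + 1) = w → w ≤ M → σ.reg 0 + (m + 1) * w ≤ M →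
      ∃ σ', Reaches P M (3 * (m + 1)) σ σ' ∧ σ'.pc = 8 ∧ σ'.mem = σ.mem ∧
        σ'.reg 0 = σ.reg 0 + (m + 1) * w ∧ σ'.reg 3 = w ∧
        ∀ r, r ≠ 0 → r ≠ 3 → σ'.reg r = σ.reg r := by
  have h5 : P[5]? = some (.add 0 0 1) := hP 5 (by decide)
  have h6 : P[6]? = some (.add 3 3 4) := hP 6 (by decide)
  have h7 : P[7]? = some (.jumpLt 3 1 5) := hP 7 (by decide)
  intro m
  induction m with
  | zero =>
    intro σ hσ hpc h1 h4 h3 hw h0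
    set σ1 : Config := ⟨6, Function.update σ.reg 0 (σ.reg 0 + w), σ.mem⟩ with hσ1
    set σ2 : Config := ⟨7, Function.update σ1.reg 3 w, σ.mem⟩ with hσ2
    set σ3 : Config := ⟨8, σ2.reg, σ.mem⟩ with hσ3
    have f1 : σ1.FitsIn M := hσ.setReg 6 0 (by omega)
    have f2 : σ2.FitsIn M := f1.setReg 7 3 hw
    have f3 : σ3.FitsIn M := f2
    have e1 : (Instr.add 0 0 1).exec σ = σ1 := by simp [Instr.exec, hσ1, hpc, h1]
    have e2 : (Instr.add 3 3 4).exec σ1 = σ2 := by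
      simp [Instr.exec, hσ1, hσ2, h4, show σ.reg 3 + 1 = w by omega]
    have e3 : (Instr.jumpLt 3 1 5).exec σ2 = σ3 := by simp [Instr.exec, hσ1, hσ2, hσ3, h1]
    have r1 : Reaches P M 1 σ σ1 := e1 ▸ Reaches.single (by rw [hpc, h5]) hσ (e1 ▸ f1)
    have r2 : Reaches P M 1 σ1 σ2 := e2 ▸ Reaches.single (by rw [← h6]) f1 (e2 ▸ f2)
    have r3 : Reaches P M 1 σ2 σ3 := e3 ▸ Reaches.single (by rw [← h7]) f2 (e3 ▸ f3)
    refine ⟨σ3, (r1.trans r2).trans r3, rfl, rfl, by simp [hσ3, hσ2, hσ1], by simp [hσ3, hσ2],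
      fun r hr0 hr3 => by simp [hσ3, hσ2, hσ1, hr0, hr3]⟩
  | succ m ih =>
    intro σ hσ hpc h1 h4 h3 hw h0
    have h0' : σ.reg 0 + w + (m + 1) * w = σ.reg 0 + (m + 1 + 1) * w := by ring
    set σ1 : Config := ⟨6, Function.update σ.reg 0 (σ.reg 0 + w), σ.mem⟩ with hσ1
    set σ2 : Config := ⟨7, Function.update σ1.reg 3 (σ.reg 3 + 1), σ.mem⟩ with hσ2
    set σ3 : Config := ⟨5, σ2.reg, σ.mem⟩ with hσ3
    have f1 : σ1.FitsIn M := hσ.setReg 6 0 (by omega)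
    have f2 : σ2.FitsIn M := f1.setReg 7 3 (by omega)
    have f3 : σ3.FitsIn M := f2
    have e1 : (Instr.add 0 0 1).exec σ = σ1 := by simp [Instr.exec, hσ1, hpc, h1]
    have e2 : (Instr.add 3 3 4).exec σ1 = σ2 := by simp [Instr.exec, hσ1, hσ2, h4]
    have e3 : (Instr.jumpLt 3 1 5).exec σ2 = σ3 := by
      simp [Instr.exec, hσ1, hσ2, hσ3, h1, show σ.reg 3 + 1 < w by omega]
    have r1 : Reaches P M 1 σ σ1 := e1 ▸ Reaches.single (by rw [hpc, h5]) hσ (e1 ▸ f1)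
    have r2 : Reaches P M 1 σ1 σ2 := e2 ▸ Reaches.single (by rw [← h6]) f1 (e2 ▸ f2)
    have r3 : Reaches P M 1 σ2 σ3 := e3 ▸ Reaches.single (by rw [← h7]) f2 (e3 ▸ f3)
    obtain ⟨σ', hr, hp, hm, hz, ht, ho⟩ := ih σ3 f3 rfl (by simpa [hσ3, hσ2, hσ1] using h1)
      (by simpa [hσ3, hσ2, hσ1] using h4) (by simp [hσ3, hσ2]; omega) hw
      (by simp only [hσ3, hσ2, hσ1, Function.update_self, ne_eq, OfNat.zero_ne_ofNat,
            not_false_eq_true, Function.update_of_ne]; omega)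
    refine ⟨σ', ?_, hp, hm, ?_, ht, fun r hr0 hr3 => ?_⟩
    · rw [show 3 * (m + 1 + 1) = 1 + 1 + 1 + 3 * (m + 1) by ring]
      exact ((r1.trans r2).trans r3).trans hr
    · rw [hz, ← h0']
      simp [hσ3, hσ2, hσ1]
    · rw [ho r hr0 hr3]
      simp [hσ3, hσ2, hσ1, hr0, hr3]

theorem reaches_setup (hP : CodeAt P 0 setupCode) {input : List ℕ} {n : ℕ}
    (hn : input.getD 0 0 = n) (hM : (n + 2) ^ 2 ≤ M) (hin : ∀ i, input.getD i 0 ≤ M) :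
    ∃ σ, Reaches P M (3 * n + 11) (init input) σ ∧ σ.pc = 8 ∧ σ.mem = (init input).mem ∧
      σ.reg 0 = (n + 2) ^ 2 ∧ ∀ r, r ≠ 0 → σ.reg r ≤ n + 2 := by
  have hnM : n + 2 ≤ M := by nlinarith
  have h0 : P[0]? = some (.const 1 0) := hP 0 (by decide)
  have h1 : P[1]? = some (.load 2 1) := hP 1 (by decide)
  have h2 : P[2]? = some (.const 1 2) := hP 2 (by decide)
  have h3 : P[3]? = some (.add 1 1 2) := hP 3 (by decide)
  have h4 : P[4]? = some (.const 4 1) := hP 4 (by decide)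
  set m := (init input).mem with hm
  have hm0 : m 0 = n := hn
  set σ1 : Config := ⟨1, Function.update (fun _ => 0) 1 0, m⟩ with hσ1
  set σ2 : Config := ⟨2, Function.update σ1.reg 2 n, m⟩ with hσ2
  set σ3 : Config := ⟨3, Function.update σ2.reg 1 2, m⟩ with hσ3
  set σ4 : Config := ⟨4, Function.update σ3.reg 1 (n + 2), m⟩ with hσ4
  set σ5 : Config := ⟨5, Function.update σ4.reg 4 1, m⟩ with hσ5
  have f0 : (init input).FitsIn M := ⟨fun _ => Nat.zero_le _, hin⟩
  have f1 : σ1.FitsIn M := f0.setReg 1 1 (by omega)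
  have f2 : σ2.FitsIn M := f1.setReg 2 2 (by omega)
  have f3 : σ3.FitsIn M := f2.setReg 3 1 (by omega)
  have f4 : σ4.FitsIn M := f3.setReg 4 1 (by omega)
  have f5 : σ5.FitsIn M := f4.setReg 5 4 (by omega)
  have e1 : (Instr.const 1 0).exec (init input) = σ1 := rfl
  have e2 : (Instr.load 2 1).exec σ1 = σ2 := by simp [Instr.exec, hσ1, hσ2, hm0]
  have e3 : (Instr.const 1 2).exec σ2 = σ3 := rfl
  have e4 : (Instr.add 1 1 2).exec σ3 = σ4 := by
    simp [Instr.exec, hσ1, hσ2, hσ3, hσ4, add_comm 2 n]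
  have e5 : (Instr.const 4 1).exec σ4 = σ5 := rfl
  have r1 : Reaches P M 1 (init input) σ1 := e1 ▸ Reaches.single (by rw [← h0]; rfl) f0 (e1 ▸ f1)
  have r2 : Reaches P M 1 σ1 σ2 := e2 ▸ Reaches.single (by rw [← h1]) f1 (e2 ▸ f2)
  have r3 : Reaches P M 1 σ2 σ3 := e3 ▸ Reaches.single (by rw [← h2]) f2 (e3 ▸ f3)
  have r4 : Reaches P M 1 σ3 σ4 := e4 ▸ Reaches.single (by rw [← h3]) f3 (e4 ▸ f4)
  have r5 : Reaches P M 1 σ4 σ5 := e5 ▸ Reaches.single (by rw [← h4]) f4 (e5 ▸ f5)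
  have hz : σ5.reg 0 = 0 := by simp [hσ5, hσ4, hσ3, hσ2, hσ1]
  obtain ⟨σ, hr, hp, hmem, hz', ht, ho⟩ := reaches_setupLoop hP (n + 2) (n + 1) σ5 f5 rfl
    (by simp [hσ5, hσ4]) (by simp [hσ5]) (by simp [hσ5, hσ4, hσ3, hσ2, hσ1]) hnM
    (by rw [hz]; nlinarith)
  refine ⟨σ, ?_, hp, hmem, by rw [hz', hz]; ring, fun r hr0 => ?_⟩
  · rw [show 3 * n + 11 = 1 + 1 + 1 + 1 + 1 + 3 * (n + 1 + 1) by ring]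
    exact ((((r1.trans r2).trans r3).trans r4).trans r5).trans hr
  · by_cases hr3 : r = 3
    · rw [hr3, ht]
    · rw [ho r hr0 hr3]
      simp only [hσ5, hσ4, hσ3, hσ2, hσ1, Function.update_apply]
      split_ifs <;> omega

theorem reaches_finish {p : ℕ} (hP : CodeAt P p finishCode) {σ : Config} (hσ : σ.FitsIn M)
    (hp : σ.pc = p) (h5 : σ.reg 5 = 0) :
    ∃ σ', Reaches P M 3 σ σ' ∧ σ'.pc = p + 3 ∧ σ'.mem = σ.mem ∧ σ'.reg 0 = σ.reg 22 ∧
      σ'.reg 1 = 0 ∧ σ'.reg 2 = σ.reg 12 := by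
  have h0 : P[p]? = some (.add 0 22 5) := hP 0 (by decide)
  have h1 : P[p + 1]? = some (.const 1 0) := hP 1 (by decide)
  have h2 : P[p + 2]? = some (.add 2 12 5) := hP 2 (by decide)
  set σ1 : Config := ⟨p + 1, Function.update σ.reg 0 (σ.reg 22), σ.mem⟩ with hσ1
  set σ2 : Config := ⟨p + 2, Function.update σ1.reg 1 0, σ.mem⟩ with hσ2
  set σ3 : Config := ⟨p + 3, Function.update σ2.reg 2 (σ.reg 12), σ.mem⟩ with hσ3
  have f1 : σ1.FitsIn M := hσ.setReg _ 0 (hσ.1 _)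
  have f2 : σ2.FitsIn M := f1.setReg _ 1 (Nat.zero_le _)
  have f3 : σ3.FitsIn M := f2.setReg _ 2 (hσ.1 _)
  have e1 : (Instr.add 0 22 5).exec σ = σ1 := by simp [Instr.exec, hσ1, h5, hp]
  have e2 : (Instr.const 1 0).exec σ1 = σ2 := rfl
  have e3 : (Instr.add 2 12 5).exec σ2 = σ3 := by simp [Instr.exec, hσ1, hσ2, hσ3, h5]
  have r1 : Reaches P M 1 σ σ1 := e1 ▸ Reaches.single (by rw [hp, h0]) hσ (e1 ▸ f1)
  have r2 : Reaches P M 1 σ1 σ2 := e2 ▸ Reaches.single (by rw [← h1]) f1 (e2 ▸ f2)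
  have r3 : Reaches P M 1 σ2 σ3 := e3 ▸ Reaches.single (by rw [← h2]) f2 (e3 ▸ f3)
  exact ⟨σ3, (r1.trans r2).trans r3, rfl, rfl, by simp [hσ3, hσ2, hσ1], by simp [hσ3, hσ2],
    by simp [hσ3]⟩

end RAM

/-! ### The complete program and its correctness -/

namespace BlackWhite

open RAM DomSearch SimpleGraph

/-- The machine program for the dominating set problem. -/
def program : Program := setupCode ++ search.compile 8 ++ finishCode

theorem program_correct {n k h : ℕ} (hn : 0 < n) {G : SimpleGraph (Fin n)} {B : Finset (Fin n)}
    {adj : Fin n → List (Fin n)} (hG : G.CompleteMinorFree h) (hadj : IsAdjacencyList G adj) :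
    ∃ t ≤ 3 * n + 14 + 8 * (15 * n + 18 + branchConst h ^ k * (pathTime n k (closedLists adj) + 1)),
      Halted program (configAt program (encode B adj k) t) ∧
      CorrectAnswer G B k (configAt program (encode B adj k) t).output ∧
      ∀ s ≤ t, (configAt program (encode B adj k) s).FitsIn ((n + k + 2) ^ 6) := by
  obtain ⟨hP1, hP2, hP3, hlen⟩ := codeAt_setupCode_append (search.compile 8)
  rw [← program] at hP1 hP2 hP3 hlen
  set M := (n + k + 2) ^ 6 with hMdef
  set N := (n + k + 2) ^ 2 with hN
  set base := (n + 2) ^ 2 with hbase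
  set S := B.map Fin.valEmbedding with hS
  have hSn : S ⊆ range n := fun x hx => by
    obtain ⟨u, _, rfl⟩ := mem_map.1 hx
    simp
  have hcl := closedLists_spec hadj
  have hf : Fits N base n k (closedLists adj) := fits_closedLists hadj k
  have hN9 : 9 ≤ N := Nat.pow_le_pow_left (show 3 ≤ n + k + 2 by omega) 2
  have hNn : n + k + 2 ≤ N := Nat.le_self_pow (by norm_num) _
  -- Since `base ≤ N` and `9 ≤ N`, the left side is at most `17 * N + 16`, which is below `81 * N ≤
  -- N ^ 3`.
  have hM : base + 16 * N + 16 ≤ M := by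
    have h1 : M = N * N * N := by rw [hMdef, hN]; ring
    have h2 : 9 * 9 ≤ N * N := Nat.mul_le_mul hN9 hN9
    have h3 := Nat.mul_le_mul_right N h2
    have h4 := hf.base_le
    omega
  obtain ⟨σ, hr1, hpc, hmem, h0, hregs⟩ := reaches_setup (M := M) (input := encode B adj k) hP1
    (n := n) (by simp [encode]) (by omega) (fun i => (getD_encode_le hadj i).trans (by omega))
  -- The arrays are empty initially, because the input ends before `base`. Registers may hold
  -- leftovers of the setup, which only need to be small.
  set s : Store := ⟨fun r => σ.reg (r + 3), fun _ _ => 0, fun i => (encode B adj k).getD i 0⟩ with hs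
  have hsim : Sim N base M s σ := by
    refine ⟨fun _ => rfl, h0, ⟨(hregs 1 (by norm_num)).trans (by omega),
      (hregs 2 (by norm_num)).trans (by omega)⟩, fun a _ => by rw [hmem]; rfl, fun x i => ?_,
      fun r => (hregs _ (by omega)).trans (by omega),
      fun a => (getD_encode_le hadj a).trans (by omega), fun _ _ => Nat.zero_le _⟩
    rw [hmem]
    refine List.getD_eq_default _ _ ?_
    rw [length_encode]
    have := hf.ofs_le
    omega
  obtain ⟨t, s', hexec, ht, hz, hcase⟩ : Wp N base search s fun t s' =>
      t ≤ 15 * n + 18 + branchConst h ^ k * (pathTime n k (closedLists adj) + 1) ∧ s'.reg 2 = 0 ∧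
      ((s'.reg 19 = 0 ∧ ¬ Sol n (closedLists adj) S k) ∨ (s'.reg 19 = 1 ∧ ∃ f j,
        Valid (closedLists adj) k S f ∧ Followed n k (closedLists adj) S f j s' ∧
          sub (closedLists adj) S f j = ∅)) :=
    wp_search hf hcl hSn (by unfold branchConst; omega)
      (fun T hT hne => deg_closedLists_le hG hadj hT hne) (input_encode fun _ => rfl)
      (fun _ => rfl) fun t s' h1 h2 h3 => ⟨h1, h2, h3⟩
  obtain ⟨t2, ht2, σ2, hr2, hsim2, hpc2⟩ := hexec.compile hM hP2 hsim hpc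
  obtain ⟨σ3, hr3, hpc3, hmem3, hout0, hout1, hout2⟩ := reaches_finish hP3 (hsim2.fitsIn hM) hpc2
    ((hsim2.reg 2).trans hz)
  obtain ⟨hfin, hfits⟩ := (hr1.trans hr2).trans hr3
  refine ⟨3 * n + 11 + t2 + 3, by omega, ?_, ?_, hfits⟩
  · rw [configAt, hfin, Halted, hlen, hpc3]
  · rw [configAt, hfin]
    -- Registers of the structured language are shifted by 3. The success flag `19` and the level
    -- `9` become the first and third output register.
    have e0 : σ3.reg 0 = s'.reg 19 := hout0.trans (hsim2.reg 19)
    have e2 : σ3.reg 2 = s'.reg 9 := hout2.trans (hsim2.reg 9)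
    rcases hcase with ⟨h19, hno⟩ | ⟨h19, f, j, hv, hP, hemp⟩
    · rw [Config.output, if_pos (e0.trans h19)]
      exact correctAnswer_none hadj hno
    · obtain ⟨hnd, hlt⟩ := chosen_spec hcl hSn hv hP.level_le hP.nonempty
      have hlenc : (chosen (closedLists adj) S f j).length = j := by simp [chosen]
      have hjn : j ≤ n := by
        rw [← hlenc, ← List.toFinset_card_of_nodup hnd]
        calc _ ≤ #(range n) := card_le_card fun u hu => mem_range.2 (hlt u (List.mem_toFinset.1 hu))
          _ = n := card_range n
      rw [Config.output, if_neg (by rw [e0, h19]; norm_num), e2, hP.level, hout1]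
      have hl : ((List.range j).map fun i => σ3.mem (0 + i)) = chosen (closedLists adj) S f j := by
        refine List.map_congr_left fun i hi => ?_
        have hi' := List.mem_range.1 hi
        rw [zero_add, hmem3, hsim2.low i (by nlinarith), hP.low i hi']
      rw [hl]
      refine correctAnswer_some hadj hnd hlt (hlenc.le.trans hP.level_le) fun b hb => ?_
      exact exists_chosen_of_notMem_sub hb (by rw [hemp]; simp)

end BlackWhite

end

section

open Finset

namespace SimpleGraph

/-! ### Estimates -/

/-- With `a = 4 * d` and `M = h * a`, weighting the terms by powers of `a` bounds the sum by `a ^ h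
* (1 + 1 / a) ^ M`, which is at most `(a * e) ^ h`, and `e < 3`. -/
theorem sum_choose_le {h d : ℕ} (hd : 0 < d) :
    ∑ i ∈ range h, (4 * h * d).choose i ≤ (12 * d) ^ h := by
  rcases h.eq_zero_or_pos with rfl | hh
  · simp
  set M := 4 * h * d with hM
  set a : ℝ := 4 * d with ha
  have hd1 : (1 : ℝ) ≤ d := by exact_mod_cast hd
  have ha1 : 1 ≤ a := by linarith
  have ha0 : 0 < a := by linarith
  have hhM : h ≤ M + 1 := by nlinarith
  have key : (∑ i ∈ range h, (M.choose i : ℝ)) ≤ (12 * d) ^ h := by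
    calc (∑ i ∈ range h, (M.choose i : ℝ)) ≤ ∑ i ∈ range h, a ^ h * ((1 / a) ^ i * M.choose i) := by
          refine sum_le_sum fun i hi => ?_
          have hih := (mem_range.1 hi).le
          have h1 : 1 ≤ a ^ h * (1 / a) ^ i := by
            rw [one_div, inv_pow, ← div_eq_mul_inv, le_div_iff₀ (by positivity), one_mul]
            exact pow_le_pow_right₀ ha1 hih
          rw [← mul_assoc]
          exact le_mul_of_one_le_left (by positivity) h1
      _ ≤ ∑ i ∈ range (M + 1), a ^ h * ((1 / a) ^ i * M.choose i) :=
          sum_le_sum_of_subset_of_nonneg (range_subset_range.2 hhM) fun i _ _ => by positivity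
      _ = a ^ h * (1 / a + 1) ^ M := by
          rw [add_pow, ← mul_sum]
          simp
      _ ≤ a ^ h * Real.exp (1 / a) ^ M := by
          gcongr
          exact Real.add_one_le_exp _
      _ = a ^ h * Real.exp 1 ^ h := by
          rw [← Real.exp_nat_mul, ← Real.exp_nat_mul]
          congr 2
          rw [hM, ha]
          push_cast
          field_simp
      _ ≤ a ^ h * 3 ^ h := by
          gcongr
          exact Real.exp_one_lt_three.le
      _ = (12 * d) ^ h := by rw [← mul_pow, ha]; ring
  exact_mod_cast key

theorem sq_succ_le_two_pow (L : ℕ) : (L + 1) ^ 2 ≤ 4 * 2 ^ L := by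
  induction L with
  | zero => norm_num
  | succ L ih =>
    rcases Nat.lt_or_ge L 2 with h | h
    · interval_cases L <;> norm_num
    · rw [pow_succ 2 L]
      nlinarith

/-- A polynomial in `h` raised to `O(log h)` is `2 ^ O(log ^ 2 h)`, and `log ^ 2 h = O(h)`. -/
theorem pow_log_le {h : ℕ} (hh : 2 ≤ h) :
    (2 * edgeConst h + 1) ^ (17 * (Nat.log 2 (3 * h) + 1)) ≤ 2 ^ (612 * h) := by
  set L := Nat.log 2 (3 * h) with hL
  have h1 : 2 ^ L ≤ 3 * h := Nat.pow_log_le_self 2 (by omega)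
  have h2 : 3 * h < 2 ^ (L + 1) := Nat.lt_pow_succ_log_self (by norm_num) _
  have h3 : 2 * edgeConst h + 1 ≤ 2 ^ (2 * L + 3) := by
    have h4 : 2 ^ (2 * L + 3) = 2 * (2 ^ (L + 1) * 2 ^ (L + 1)) := by ring
    rw [h4, edgeConst]
    nlinarith
  -- The left side is at most `51 * (L + 1) ^ 2 ≤ 204 * 2 ^ L ≤ 612 * h`.
  have h5 : (2 * L + 3) * (17 * (L + 1)) ≤ 612 * h := by
    have := sq_succ_le_two_pow L
    nlinarith
  calc (2 * edgeConst h + 1) ^ (17 * (L + 1)) ≤ (2 ^ (2 * L + 3)) ^ (17 * (L + 1)) :=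
        Nat.pow_le_pow_left h3 _
    _ = 2 ^ ((2 * L + 3) * (17 * (L + 1))) := by rw [← pow_mul]
    _ ≤ 2 ^ (612 * h) := Nat.pow_le_pow_right (by norm_num) h5

theorem exists_edgeConst_le : ∃ c : ℕ, ∀ h : ℕ, 2 ≤ h → 22 * edgeConst h ^ 3 ≤ c ^ h := by
  -- `64 ^ h` is the cube of `4 ^ h * 4 ^ h`'s square root squared, that is `(2 ^ h) ^ 6`, and 69 is
  -- large enough for `22 * 6 ^ 3 = 4752 ≤ 69 ^ 2`.
  refine ⟨69 * 64, fun h hh => ?_⟩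
  have h1 : h ≤ 2 ^ h := Nat.lt_two_pow_self.le
  have h2 : h * h ≤ 2 ^ h * 2 ^ h := Nat.mul_le_mul h1 h1
  have h3 : edgeConst h ≤ 6 * (2 ^ h * 2 ^ h) := by
    rw [edgeConst]
    nlinarith
  have h4 : 4752 ≤ 69 ^ h :=
    (show 4752 ≤ 69 ^ 2 by norm_num).trans (Nat.pow_le_pow_right (by norm_num) hh)
  have h5 : (64 : ℕ) ^ h = (2 ^ h) ^ 6 := by rw [← pow_mul, mul_comm h 6, pow_mul]; norm_num
  calc 22 * edgeConst h ^ 3 ≤ 22 * (6 * (2 ^ h * 2 ^ h)) ^ 3 :=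
        Nat.mul_le_mul_left _ (Nat.pow_le_pow_left h3 3)
    _ = 4752 * (2 ^ h) ^ 6 := by ring
    _ ≤ 69 ^ h * (2 ^ h) ^ 6 := Nat.mul_le_mul_right _ h4
    _ = (69 * 64) ^ h := by rw [mul_pow, h5]

/-- Powers of `edgeConst h` and the factor from `pow_log_le` are at most exponential in `h`, so only
`denseConst h` remains in the base. The additional `2 * edgeConst h` pays for the length and the
cost of a path in `time_le`. -/
theorem exists_branchConst_le : ∃ A : ℕ, ∀ h : ℕ, 2 ≤ h →
    2 * edgeConst h * branchConst h ≤ (A * denseConst h) ^ h := by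
  obtain ⟨K, hK0, hK⟩ : ∃ K : ℕ, 0 < K ∧ ∀ h, 2 ^ (612 * h) = K ^ h := by
    obtain ⟨m, hm⟩ : ∃ m, m = 612 := ⟨_, rfl⟩
    exact ⟨2 ^ m, by positivity, fun h => by rw [← pow_mul, hm]⟩
  obtain ⟨c, hc⟩ := exists_edgeConst_le
  refine ⟨c * 12 * K, fun h hh => ?_⟩
  have hd : 0 < denseConst h := Nat.succ_pos _
  have hQ : cliqueConst h ≤ (12 * denseConst h) ^ h * K ^ h :=
    Nat.mul_le_mul (sum_choose_le hd) ((pow_log_le hh).trans_eq (hK h))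
  have hX : 1 ≤ (12 * denseConst h) ^ h * K ^ h := Nat.one_le_iff_ne_zero.2 (by positivity)
  set X := (12 * denseConst h) ^ h * K ^ h with hXdef
  set E := edgeConst h with hE
  have hE1 : 1 ≤ E := by rw [hE, edgeConst]; nlinarith
  have hE3 : 22 * E ^ 3 ≤ c ^ h := hc h hh
  calc 2 * E * branchConst h = 2 * E * (1 + 2 * E * (2 + 2 * E + cliqueConst h)) := rfl
    _ ≤ 2 * E * (1 * X + 2 * E * (2 * X + 2 * E * X + X)) := by
        refine Nat.mul_le_mul_left _ (add_le_add (by omega) (Nat.mul_le_mul_left _ ?_))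
        refine add_le_add (add_le_add (by omega) ?_) hQ
        exact Nat.le_mul_of_pos_right _ hX
    _ = (2 * E + 12 * E ^ 2 + 8 * E ^ 3) * X := by ring
    _ ≤ 22 * E ^ 3 * X := by
        refine Nat.mul_le_mul_right _ ?_
        have h1 : E ≤ E ^ 3 := Nat.le_self_pow (by norm_num) _
        have h2 : E ^ 2 ≤ E ^ 3 := Nat.pow_le_pow_right hE1 (by norm_num)
        omega
    _ ≤ c ^ h * X := Nat.mul_le_mul_right _ hE3
    _ = (c * 12 * K * denseConst h) ^ h := by
        rw [hXdef, ← mul_pow, ← mul_pow]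
        congr 1
        ring

/-- Squaring removes the root: `(√L + 1) ^ 2 ≤ 2 * L + 2`. Moreover `3 * h ≤ h ^ 3` and `log 2 > 1 /
2` give `L ≤ 6 * log h`, and the summand 2 is at most `4 * log h`. -/
theorem denseConst_sq_le {h : ℕ} (hh : 2 ≤ h) : (denseConst h : ℝ) ^ 2 ≤ 16 * Real.log h := by
  set L := Nat.log 2 (3 * h) with hL
  have h1 : denseConst h ^ 2 ≤ 2 * L + 2 := by
    have := Nat.sqrt_le' L
    rw [denseConst]
    nlinarith [sq_nonneg ((Nat.sqrt L : ℤ) - 1)]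
  have hh' : (2 : ℝ) ≤ h := by exact_mod_cast hh
  have h2 : (L : ℝ) * Real.log 2 ≤ 3 * Real.log h := by
    have h3 : 2 ^ L ≤ 3 * h := Nat.pow_log_le_self 2 (by omega)
    have h4 : (2 : ℝ) ^ L ≤ (h : ℝ) ^ 3 := by
      have h5 : 2 ^ L ≤ h ^ 3 := h3.trans (by nlinarith [Nat.mul_le_mul hh hh])
      exact_mod_cast h5
    have h6 := Real.log_le_log (by positivity) h4
    rwa [Real.log_pow, Real.log_pow] at h6
  have h3 : Real.log 2 ≤ Real.log h := Real.log_le_log (by norm_num) hh'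
  have h4 := Real.log_two_gt_d9
  have h5 : (L : ℝ) ≤ 6 * Real.log h := by nlinarith [Nat.cast_nonneg (α := ℝ) L]
  have h6 : (denseConst h : ℝ) ^ 2 ≤ 2 * L + 2 := by exact_mod_cast h1
  linarith

theorem exists_branchConst_pow_le : ∃ A : ℕ, ∀ h k : ℕ, 2 ≤ h → ((2 * edgeConst h * branchConst h : ℕ) : ℝ) ^ k ≤
    (A * Real.log h) ^ ((h : ℝ) * k / 2) := by
  obtain ⟨A, hA⟩ := exists_branchConst_le
  refine ⟨16 * A ^ 2, fun h k hh => ?_⟩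
  have hlog : 0 ≤ Real.log h := Real.log_natCast_nonneg h
  have hd := denseConst_sq_le hh
  have h1 : ((A * denseConst h : ℕ) : ℝ) ^ 2 ≤ (16 * A ^ 2 : ℕ) * Real.log h := by
    push_cast
    rw [mul_pow]
    nlinarith [sq_nonneg (A : ℝ)]
  have hX := hA h hh
  generalize 2 * edgeConst h * branchConst h = X at hX ⊢
  generalize denseConst h = d at *
  calc (X : ℝ) ^ k ≤ (((A * d) ^ h : ℕ) : ℝ) ^ k := by gcongr
    -- The exponent `h * k` is halved at the price of squaring the base, because the square of
    -- `denseConst h` is of order `log h`.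
    _ = (((A * d : ℕ) : ℝ) ^ 2) ^ ((h : ℝ) * k / 2) := by
        rw [Nat.cast_pow, ← pow_mul, ← Real.rpow_natCast _ 2, ← Real.rpow_mul (by positivity),
          ← Real.rpow_natCast]
        congr 1
        push_cast
        ring
    _ ≤ _ := Real.rpow_le_rpow (by positivity) h1 (by positivity)

end SimpleGraph

/-! ### The running time and the main theorem -/

namespace BlackWhite

open SimpleGraph DomSearch

/-- The cost of a path carries a factor `k * E`, which is at most `(2 * E) ^ k` and joins the number
`D ^ k` of paths. The constant is `8 * 191 + 281`, where `281 * n` covers reading, setup and output.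
-/
theorem time_le {n k h : ℕ} (hn : 0 < n) {G : SimpleGraph (Fin n)}
    {adj : Fin n → List (Fin n)} (hG : G.CompleteMinorFree h) (hh : 2 ≤ h)
    (hadj : IsAdjacencyList G adj) :
    3 * n + 14 + 8 * (15 * n + 18 + branchConst h ^ k * (pathTime n k (closedLists adj) + 1)) ≤
      1809 * (2 * edgeConst h * branchConst h) ^ k * n := by
  have hlen := sum_length_closedLists_le hG hadj
  set E := edgeConst h with hE
  have hE1 : 1 ≤ E := by rw [hE, edgeConst]; nlinarith
  set D := branchConst h with hD
  have hD1 : 1 ≤ D ^ k := Nat.one_le_pow _ _ (by rw [hD, branchConst]; omega)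
  have h1 : levelTime n (closedLists adj) + 11 ≤ 161 * E * n := by
    have h2 : levelTime n (closedLists adj) + 11 ≤ 113 * n + 48 * (E * n) := by
      unfold levelTime
      nlinarith
    have h3 : n ≤ E * n := Nat.le_mul_of_pos_left _ hE1
    rw [mul_assoc]
    omega
  have h2 : k ≤ 2 ^ k := Nat.lt_two_pow_self.le
  have h3 : k * E ≤ (2 * E) ^ k := by
    rcases k.eq_zero_or_pos with rfl | hk
    · simp
    · rw [mul_pow]
      exact Nat.mul_le_mul h2 (Nat.le_self_pow hk.ne' _)
  have h4 : 1 ≤ (2 * E) ^ k := Nat.one_le_pow _ _ (by omega)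
  have h5 : pathTime n k (closedLists adj) + 1 ≤ 191 * (2 * E) ^ k * n := by
    calc pathTime n k (closedLists adj) + 1 ≤ 30 * n + k * (161 * E * n) := by
          have := Nat.mul_le_mul_left k h1
          unfold pathTime
          omega
      _ = (30 + 161 * (k * E)) * n := by ring
      _ ≤ 191 * (2 * E) ^ k * n := Nat.mul_le_mul_right _ (by linarith)
  have h6 : n ≤ (2 * E * D) ^ k * n := Nat.le_mul_of_pos_left _ (by rw [mul_pow]; exact Nat.mul_pos h4 hD1)
  have h7 : D ^ k * (pathTime n k (closedLists adj) + 1) ≤ 191 * ((2 * E * D) ^ k * n) := by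
    calc _ ≤ D ^ k * (191 * (2 * E) ^ k * n) := Nat.mul_le_mul_left _ h5
      _ = 191 * ((2 * E * D) ^ k * n) := by rw [mul_pow (2 * E)]; ring
  rw [mul_assoc]
  omega

end BlackWhite

/-- One program `P` and one absolute constant `C` serve all `h`, `k`, `n` and all `K_h`-minor-free
black and white graphs. Throughout the computation words of `O(log (n + k))` bits suffice. -/
theorem mainTheorem5 :
    ∃ (P : RAM.Program) (C : ℕ), 0 < C ∧
      ∀ (h k n : ℕ), 0 < n →
      ∀ (G : SimpleGraph (Fin n)) (B : Finset (Fin n)) (adj : Fin n → List (Fin n)),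
        G.CompleteMinorFree h → BlackWhite.IsAdjacencyList G adj →
        ∃ t : ℕ,
          (t : ℝ) ≤ C * ((C : ℝ) * Real.log h) ^ ((h : ℝ) * k / 2) * n ∧
          RAM.Halted P (RAM.configAt P (BlackWhite.encode B adj k) t) ∧
          BlackWhite.CorrectAnswer G B k
            (RAM.configAt P (BlackWhite.encode B adj k) t).output ∧
          ∀ s ≤ t, (RAM.configAt P (BlackWhite.encode B adj k) s).FitsIn ((n + k + 2) ^ C) := by
  obtain ⟨A, hA⟩ := SimpleGraph.exists_branchConst_pow_le
  -- One constant serves three times: in front, where 1809 is needed; in the base, where `A` is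
  -- needed; and as the exponent of the word size, where 6 is needed.
  refine ⟨BlackWhite.program, A + 1809, by omega, fun h k n hn G B adj hG hadj => ?_⟩
  have : Nonempty (Fin n) := ⟨⟨0, hn⟩⟩
  have hh := hG.two_le
  obtain ⟨t, ht, hhalt, hans, hfits⟩ := BlackWhite.program_correct (k := k) (B := B) hn hG hadj
  refine ⟨t, ?_, hhalt, hans, fun s hs => ?_⟩
  · have hlog : 0 ≤ Real.log h := Real.log_natCast_nonneg h
    calc (t : ℝ) ≤ ((1809 * (2 * SimpleGraph.edgeConst h * SimpleGraph.branchConst h) ^ k * n : ℕ) : ℝ) := by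
          exact_mod_cast ht.trans (BlackWhite.time_le hn hG hh hadj)
      _ = 1809 * ((2 * SimpleGraph.edgeConst h * SimpleGraph.branchConst h : ℕ) : ℝ) ^ k * n := by
          push_cast
          ring
      _ ≤ 1809 * (A * Real.log h) ^ ((h : ℝ) * k / 2) * n := by
          gcongr
          exact hA h k hh
      _ ≤ _ := by
          push_cast
          gcongr <;> simp
  · have hpow : (n + k + 2) ^ 6 ≤ (n + k + 2) ^ (A + 1809) :=
      Nat.pow_le_pow_right (by omega) (by omega)
    exact ⟨fun i => ((hfits s hs).1 i).trans hpow, fun i => ((hfits s hs).2 i).trans hpow⟩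

end
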